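/- Let $\mathbb T^2=\mathbb R^2/\mathbb Z^2$. Let $H$ be the space of mean-zero, (weakly) divergence-free fields $u\in L^2(\mathbb T^2,\mathbb R^2)$ with the $L^2$ inner product $\langle\cdot,\cdot\rangle$ and norm $|\cdot|$, let $V=H\cap H^1(\mathbb T^2,\mathbb R^2)$ with the $H^1$ norm and $D(A)=H\cap H^2(\mathbb T^2,\mathbb R^2)$ with the $H^2$ norm. Let $Au=-\Delta u$ for $u\in D(A)$, and let $B(u)=B(u,u)\in H$ be given for $u\in D(A)$ by $$\langle B(u,v),w\rangle=\sum_{i,j=1}^2\int_{\mathbb T^2}u^i\,\frac{\partial v^j}{\partial x^i}\,w^j\,dx\qquad\text{for all } w\in H.$$ Write $|\nabla u|^2$ for the square of the $L^2$ norm of $\nabla u$, and $M=\{u\in H:|u|=1\}$. Let $f:H\to H$ be globally Lipschitz (hence of linear growth) and tangent to $M$, that is, $\langle f(u),u\rangle=0$ for every $u\in M$, and let $u_0\in V\cap M$. For $T>0$, a solution on $[0,T]$ of $$\frac{du}{dt}+Au+B(u)=|\nabla u|^2u+f(u),\qquad u(0)=u_0, \tag{1}$$ is a function $u:[0,T]\to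 H$ with $u\in L^2(0,T;D(A))$ and $\frac{du}{dt}\in L^2(0,T;H)$ (so that $u(t)=u(0)+\int_0^t\frac{du}{ds}\,ds$ for all $t\in[0,T]$), with $u(0)=u_0$, which satisfies the equation in $H$ for almost every $t\in(0,T)$. Then there is a function $u:[0,\infty)\to H$ that is a solution of (1) on $[0,T]$ for every $T>0$, and $u\in L^\infty(0,T;V)\cap L^2(0,T;D(A))$ for every $T>0$. It is unique: for every $T>0$, every solution of (1) on $[0,T]$ coincides with $u$ on $[0,T]$. -/

import Mathlib

open MeasureTheory Set
open scoped ENNReal NNReal ContDiff InnerProductSpace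

noncomputable section

namespace CNS

/-- The two-dimensional torus `ℝ² / ℤ²`. -/
abbrev T2 : Type := UnitAddTorus (Fin 2)

/-- Lebesgue measure on the torus (the Haar measure of total mass one). -/
abbrev torusMeasure : Measure T2 := Measure.pi fun _ => AddCircle.haarAddCircle

abbrev R2 : Type := EuclideanSpace ℝ (Fin 2)

/-- `L²(𝕋², ℝ²)`. -/
abbrev L2 : Type := Lp R2 2 torusMeasure

/-- The quotient map `ℝ² → 𝕋²`. -/
def proj (y : Fin 2 → ℝ) : T2 := fun i => (y i : UnitAddCircle)

/-- Smooth real functions on the torus: those whose periodic lift to `ℝ²` is `C^∞`. -/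
def IsTest (φ : T2 → ℝ) : Prop := ContDiff ℝ ∞ (fun y : Fin 2 → ℝ => φ (proj y))

/-- Classical partial derivative `∂φ/∂xⁱ` on the torus. -/
def pderiv (i : Fin 2) (φ : T2 → ℝ) (x : T2) : ℝ :=
  deriv (fun s : ℝ => φ (x + Pi.single i (s : UnitAddCircle))) 0

/-- `u` is divergence free in the sense of distributions. -/
def IsDivFree (u : L2) : Prop :=
  ∀ φ : T2 → ℝ, IsTest φ → ∫ x, ∑ i, pderiv i φ x * u x i ∂torusMeasure = 0

theorem isOpenQuotientMap_proj : IsOpenQuotientMap proj := by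
  have h : IsOpenQuotientMap (Pi.map (fun (_ : Fin 2) (y : ℝ) => (y : UnitAddCircle))) :=
    IsOpenQuotientMap.piMap (fun _ => QuotientAddGroup.isOpenQuotientMap_mk)
  exact h

theorem pderiv_proj (i : Fin 2) {φ : T2 → ℝ} (hφ : IsTest φ) (y : Fin 2 → ℝ) :
    pderiv i φ (proj y) = fderiv ℝ (fun y : Fin 2 → ℝ => φ (proj y)) y (Pi.single i 1) := by
  have hd : DifferentiableAt ℝ (fun y : Fin 2 → ℝ => φ (proj y)) y :=
    (hφ.differentiable (by simp)) y
  have h1 : ∀ s : ℝ, proj y + Pi.single i (s : UnitAddCircle)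
      = proj (y + s • (Pi.single i 1 : Fin 2 → ℝ)) := by
    intro s
    funext j
    by_cases h : j = i
    · subst h; simp [proj]
    · simp [proj, h]
  unfold pderiv
  simp only [h1]
  exact hd.lineDeriv_eq_fderiv (v := Pi.single i 1)

theorem continuous_pderiv (i : Fin 2) {φ : T2 → ℝ} (hφ : IsTest φ) :
    Continuous (pderiv i φ) := by
  rw [isOpenQuotientMap_proj.isQuotientMap.continuous_iff]
  have h : pderiv i φ ∘ proj
      = fun y => fderiv ℝ (fun y : Fin 2 → ℝ => φ (proj y)) y (Pi.single i 1) := by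
    funext y; exact pderiv_proj i hφ y
  rw [h]
  exact (hφ.continuous_fderiv (by simp)).clm_apply continuous_const

theorem integrable_div (u : L2) {φ : T2 → ℝ} (hφ : IsTest φ) :
    Integrable (fun x => ∑ i, pderiv i φ x * u x i) torusMeasure := by
  refine integrable_finsetSum _ fun i _ => ?_
  have hu : Integrable (fun x => u x i) torusMeasure :=
    (EuclideanSpace.proj (𝕜 := ℝ) i).integrable_comp
      ((Lp.memLp u).integrable (by norm_num))
  obtain ⟨C, hC⟩ := (isCompact_range (continuous_pderiv i hφ)).isBounded.exists_norm_le
  exact hu.bdd_mul (c := C) (continuous_pderiv i hφ).aestronglyMeasurable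
    (Filter.Eventually.of_forall fun x => hC _ (mem_range_self x))

/-- `H`: square integrable, mean zero, divergence free vector fields, with the `L²` inner
product. -/
def H : Submodule ℝ L2 where
  carrier := {u | ∫ x, u x ∂torusMeasure = 0 ∧ IsDivFree u}
  zero_mem' := by
    have h : ((0 : L2) : T2 → R2) =ᵐ[torusMeasure] 0 := Lp.coeFn_zero _ _ _
    refine ⟨?_, fun φ _ => ?_⟩
    · rw [integral_congr_ae h]; simp
    · rw [integral_congr_ae (g := fun _ => (0 : ℝ))]
      · simp
      · filter_upwards [h] with x hx
        simp only [hx, Pi.zero_apply, PiLp.zero_apply, mul_zero, Finset.sum_const_zero]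
  add_mem' := by
    rintro u v ⟨hu, hu'⟩ ⟨hv, hv'⟩
    have h := Lp.coeFn_add u v
    refine ⟨?_, fun φ hφ => ?_⟩
    · rw [integral_congr_ae h]
      simp only [Pi.add_apply]
      rw [integral_add ((Lp.memLp u).integrable (by norm_num))
        ((Lp.memLp v).integrable (by norm_num)), hu, hv, add_zero]
    · rw [integral_congr_ae (g := fun x => (∑ i, pderiv i φ x * u x i)
        + ∑ i, pderiv i φ x * v x i)]
      · rw [integral_add (integrable_div u hφ) (integrable_div v hφ), hu' φ hφ, hv' φ hφ,
          add_zero]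
      · filter_upwards [h] with x hx
        simp only [hx, Pi.add_apply, PiLp.add_apply, mul_add, Finset.sum_add_distrib]
  smul_mem' := by
    rintro c u ⟨hu, hu'⟩
    have h := Lp.coeFn_smul c u
    refine ⟨?_, fun φ hφ => ?_⟩
    · rw [integral_congr_ae h]
      simp only [Pi.smul_apply]
      rw [integral_smul, hu, smul_zero]
    · rw [integral_congr_ae (g := fun x => c * ∑ i, pderiv i φ x * u x i)]
      · rw [integral_const_mul, hu' φ hφ, mul_zero]
      · filter_upwards [h] with x hx
        simp only [hx, Pi.smul_apply, PiLp.smul_apply, smul_eq_mul, Finset.mul_sum]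
        exact Finset.sum_congr rfl fun i _ => by ring

/-- `g ∈ L²` is the weak partial derivative `∂u/∂xⁱ` of `u ∈ L²`. -/
def IsWeakPartial (i : Fin 2) (u g : L2) : Prop :=
  ∀ φ : T2 → ℝ, IsTest φ → ∫ x, pderiv i φ x • u x ∂torusMeasure = -∫ x, φ x • g x ∂torusMeasure

/-- `u ∈ H¹(𝕋², ℝ²)`. -/
def MemH1 (u : L2) : Prop := ∀ i, ∃ g, IsWeakPartial i u g

open Classical in
/-- The weak partial derivative (zero if there is none in `L²`). -/
def wpartial (i : Fin 2) (u : L2) : L2 :=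
  if h : ∃ g, IsWeakPartial i u g then h.choose else 0

/-- `u ∈ H²(𝕋², ℝ²)`. -/
def MemH2 (u : L2) : Prop := MemH1 u ∧ ∀ i, MemH1 (wpartial i u)

/-- `V = H ∩ H¹`. -/
def V : Set H := {u | MemH1 (u : L2)}

/-- `D(A) = H ∩ H²`. -/
def DA : Set H := {u | MemH2 (u : L2)}

/-- The Stokes operator `A u = -Δ u`, meaningful for `u ∈ D(A)`. -/
def stokesA (u : L2) : L2 := -∑ i, wpartial i (wpartial i u)

/-- `|∇u|²`, the square of the `L²` norm of the gradient. -/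
def gradSq (u : L2) : ℝ := ∑ i, ‖wpartial i u‖ ^ 2

/-- `b(u,v,w) = ∑ᵢⱼ ∫ uⁱ (∂vʲ/∂xⁱ) wʲ dx`. -/
def bForm (u v w : L2) : ℝ :=
  ∑ i, ∑ j, ∫ x, u x i * wpartial i v x j * w x j ∂torusMeasure

open Classical in
/-- `B(u,v) ∈ H`, determined by `⟨B(u,v), w⟩ = b(u,v,w)` for all `w ∈ H`
(zero if there is no such element of `H`; there is one for `u ∈ V`, `v ∈ D(A)`). -/
def opB (u v : H) : H :=
  if h : ∃ z : H, ∀ w : H, ⟪z, w⟫_ℝ = bForm u v w then h.choose else 0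

/-- The unit sphere `M` of `H`. -/
def M : Set H := {u | ‖u‖ = 1}

/-- The tangent space `T_u M`. -/
def tangentM (u : H) : Set H := {v | ⟪v, u⟫_ℝ = 0}

/-- Lebesgue measure on the time interval `(0,T)`. -/
def timeMeasure (T : ℝ) : Measure ℝ := volume.restrict (Ioo 0 T)

/-- `u ∈ L^p(0,T;V)`, with the `H¹` norm on `V`. -/
def MemLpV (p : ℝ≥0∞) (T : ℝ) (u : ℝ → H) : Prop :=
  (∀ᵐ t ∂timeMeasure T, u t ∈ V) ∧
  MemLp u p (timeMeasure T) ∧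
  ∀ i, MemLp (fun t => wpartial i (u t)) p (timeMeasure T)

/-- `u ∈ L^p(0,T;D(A))`, with the `H²` norm on `D(A)`. -/
def MemLpDA (p : ℝ≥0∞) (T : ℝ) (u : ℝ → H) : Prop :=
  (∀ᵐ t ∂timeMeasure T, u t ∈ DA) ∧
  MemLp u p (timeMeasure T) ∧
  (∀ i, MemLp (fun t => wpartial i (u t)) p (timeMeasure T)) ∧
  ∀ i j, MemLp (fun t => wpartial j (wpartial i (u t))) p (timeMeasure T)

/-- `u' ∈ L²(0,T;H)` is the time derivative of `u`, and `u` is the (absolutely) continuous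
representative on `[0,T]`. -/
def IsTimeDeriv (T : ℝ) (u u' : ℝ → H) : Prop :=
  MemLp u' 2 (timeMeasure T) ∧
  ∀ t ∈ Icc 0 T, (u t : L2) = (u 0 : L2) + ∫ s in (0 : ℝ)..t, (u' s : L2)

/-- `u` solves `du/dt + A u + B(u) = |∇u|² u + f(u)`, `u(0) = u₀`, on `[0,T]`:
`u ∈ L²(0,T;D(A))`, `du/dt ∈ L²(0,T;H)`, and the equation holds in `H` at almost every time. -/
def IsSolutionOn (f : H → H) (u₀ : H) (T : ℝ) (u : ℝ → H) : Prop :=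
  u 0 = u₀ ∧ MemLpDA 2 T u ∧
  ∃ u' : ℝ → H, IsTimeDeriv T u u' ∧
    ∀ᵐ t ∂timeMeasure T,
      (u' t : L2) + stokesA (u t) + (opB (u t) (u t) : L2)
        = gradSq (u t) • (u t : L2) + (f (u t) : L2)

end CNS

end

open MeasureTheory Set
open scoped ENNReal NNReal ContDiff InnerProductSpace

noncomputable section

namespace CNS

/-! ### Absolutely continuous curves and Grönwall's inequality -/

section Gronwall

variable {E : Type*} [NormedAddCommGroup E]

/-! Write N(u) = -Au - B(u,u) + |∇u|²u + f(u), so that (1) reads u' = N(u). The sphere M is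
invariant: ⟨B(u,u),u⟩ = 0, f is tangent, and -Au + |∇u|²u pairs with u to |∇u|²(|u|² - 1).

On M the gradient cannot blow up. On the two-dimensional torus ⟨B(u,u),Au⟩ = 0. For |u| = 1 one has
|Au|² - |∇u|⁴ = |Au - |∇u|²u|², so dissipation dominates the constraint force, and f(u) ⟂ u gives
⟨f(u),Au⟩ = ⟨f(u),Au - |∇u|²u⟩. Hence d/dt |∇u|² + |Au - |∇u|²u|² ≤ |f(u)|²
(`inner_specOp_constrainedRHS_le`). This bounds |∇u|² on [0,T], and then Au in L²(0,T;H).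

Two solutions are compared in H. With w = u - v, the only dangerous convection term is ⟨B(w,w),u⟩,
which is absorbed by the dissipation of w at the price of |Au|²|w|². The remaining terms cost a
multiple of (1 + |Au|² + |Av|²)|w|² (`inner_constrainedRHS_sub_le`). The weight is integrable in
time, so Grönwall's inequality (`norm_sq_add_le_mul_exp`) gives uniqueness.

Existence uses Galerkin approximations, which stay on M and satisfy the same bounds
(`exists_galerkin`, `energy_le`, `integral_norm_specOp_sq_le`). No compactness argument is needed:
the same Grönwall estimate, with truncation errors that vanish as the cut-off grows, makes them
uniformly Cauchy in H (`norm_sub_sq_le`). Fatou's lemma and coordinatewise convergence identify the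
limit as a solution (`isStrongSolution_of_tendsto`), and uniqueness glues the solutions on [0,n].

All this is carried out for an abstract diagonal operator and a bilinear map satisfying
`IsConvection`. The torus enters through real Fourier analysis: the Hartley functions diagonalise
the Stokes operator, D(A) embeds in the bounded fields, and finite-mode fields are smooth, so the
identities for B are classical integrations by parts (`exists_isConvection_opB`). -/

theorem absolutelyContinuousOnInterval_of_dist_le {X Y : Type*} [PseudoMetricSpace X]
    [PseudoMetricSpace Y] {f : ℝ → X} {h : ℝ → Y} {a b : ℝ} {C : ℝ}
    (hh : AbsolutelyContinuousOnInterval h a b)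
    (hfh : ∀ s ∈ uIcc a b, ∀ t ∈ uIcc a b, dist (f s) (f t) ≤ C * dist (h s) (h t)) :
    AbsolutelyContinuousOnInterval f a b := by
  unfold AbsolutelyContinuousOnInterval at hh ⊢
  refine squeeze_zero' ?_ ?_ (by simpa using hh.const_mul C)
  · exact Filter.Eventually.of_forall fun _ => Finset.sum_nonneg fun i _ => dist_nonneg
  rw [Filter.eventually_inf_principal]
  filter_upwards with p hp
  simp only [Finset.mul_sum]
  exact Finset.sum_le_sum fun i hi => hfh _ (hp.1 i hi).1 _ (hp.1 i hi).2

theorem _root_.IntervalIntegrable.zero_left {h : ℝ → E} {T s : ℝ}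
    (hh : IntervalIntegrable h volume 0 T) (hs : s ∈ uIcc 0 T) :
    IntervalIntegrable h volume 0 s :=
  hh.mono_set (uIcc_subset_uIcc left_mem_uIcc hs)

variable [InnerProductSpace ℝ E] [CompleteSpace E]

/-- Grönwall's inequality for the squared norm of an absolutely continuous curve in a Hilbert
space, with an integrable coefficient. -/
theorem norm_sq_add_le_mul_exp {T : ℝ} {w w' : ℝ → E} {g : ℝ → ℝ} {ε : ℝ} (hε : 0 ≤ ε)
    (hw' : IntervalIntegrable w' volume 0 T)
    (hw : ∀ t ∈ Icc 0 T, w t = w 0 + ∫ s in (0 : ℝ)..t, w' s)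
    (hg : IntervalIntegrable g volume 0 T) (hg0 : ∀ t, 0 ≤ g t)
    (hle : ∀ᵐ t, t ∈ Ioo 0 T → 2 * ⟪w t, w' t⟫_ℝ ≤ g t * (‖w t‖ ^ 2 + ε))
    {t : ℝ} (ht : t ∈ Icc 0 T) :
    ‖w t‖ ^ 2 + ε ≤ (‖w 0‖ ^ 2 + ε) * Real.exp (∫ s in (0 : ℝ)..T, g s) := by
  have hT : 0 ≤ T := ht.1.trans ht.2
  have huIcc : uIcc 0 T = Icc 0 T := uIcc_of_le hT
  -- `w` is controlled only on `[0, T]`; `W` is a primitive on the whole line, so it has two-sided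
  -- derivatives almost everywhere.
  set W : ℝ → E := fun t => w 0 + ∫ s in (0 : ℝ)..t, w' s with hW
  have hWw : ∀ t ∈ Icc 0 T, w t = W t := hw
  set Φ : ℝ → ℝ := fun t => ∫ s in (0 : ℝ)..t, ‖w' s‖ with hΦ
  set G : ℝ → ℝ := fun t => ∫ s in (0 : ℝ)..t, g s with hG
  have hΦac : AbsolutelyContinuousOnInterval Φ 0 T :=
    hw'.norm.absolutelyContinuousOnInterval_intervalIntegral (by simp)
  have hGac : AbsolutelyContinuousOnInterval G 0 T :=
    hg.absolutelyContinuousOnInterval_intervalIntegral (by simp)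
  -- Increments of `W` are dominated by those of the scalar primitive `Φ` of `‖w'‖`, so the scalar
  -- absolute continuity theorem transfers to the vector-valued curve.
  have hWdist : ∀ s ∈ uIcc 0 T, ∀ t ∈ uIcc 0 T, dist (W s) (W t) ≤ 1 * dist (Φ s) (Φ t) := by
    intro s hs t ht
    rw [one_mul, dist_eq_norm, Real.dist_eq]
    have h1 : W s - W t = ∫ r in t..s, w' r := by
      simp only [hW, add_sub_add_left_eq_sub]
      exact intervalIntegral.integral_interval_sub_left (hw'.zero_left hs) (hw'.zero_left ht)
    have h2 : Φ s - Φ t = ∫ r in t..s, ‖w' r‖ :=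
      intervalIntegral.integral_interval_sub_left (hw'.norm.zero_left hs) (hw'.norm.zero_left ht)
    rw [h1, h2]
    exact intervalIntegral.norm_integral_le_abs_integral_norm
  have hWac := absolutelyContinuousOnInterval_of_dist_le hΦac hWdist
  obtain ⟨R, hR⟩ := hWac.exists_bound
  -- The shift `ε` lets an error `ε g` on the right be treated as part of a homogeneous inequality;
  -- `ε = 0` is the usual case.
  have hzac : AbsolutelyContinuousOnInterval (fun t => ‖W t‖ ^ 2 + ε) 0 T := by
    refine absolutelyContinuousOnInterval_of_dist_le (C := 2 * R) hWac fun s hs t ht => ?_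
    rw [Real.dist_eq, dist_eq_norm]
    have h1 : ‖W s‖ ^ 2 + ε - (‖W t‖ ^ 2 + ε) = (‖W s‖ + ‖W t‖) * (‖W s‖ - ‖W t‖) := by ring
    rw [h1, abs_mul]
    have h2 := abs_norm_sub_norm_le (W s) (W t)
    have h3 : |‖W s‖ + ‖W t‖| ≤ 2 * R := by
      rw [abs_of_nonneg (by positivity)]
      linarith [hR s hs, hR t ht]
    exact mul_le_mul h3 h2 (abs_nonneg _) ((abs_nonneg _).trans h3)
  have hGnn : ∀ s ∈ uIcc 0 T, 0 ≤ G s := fun s hs =>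
    intervalIntegral.integral_nonneg (huIcc ▸ hs).1 fun r _ => hg0 r
  -- `exp (-·)` is 1-Lipschitz on `[0, ∞)`, and `G` is nonnegative there because `g` is.
  have hexpac : AbsolutelyContinuousOnInterval (fun t => Real.exp (-G t)) 0 T := by
    refine absolutelyContinuousOnInterval_of_dist_le (C := 1) hGac fun s hs t ht => ?_
    rw [one_mul, Real.dist_eq, Real.dist_eq]
    have key : ∀ a b : ℝ, 0 ≤ a → a ≤ b → |Real.exp (-a) - Real.exp (-b)| ≤ |a - b| := by
      intro a b ha hab
      rw [abs_of_nonneg (by simpa using Real.exp_le_exp.2 (neg_le_neg hab)), abs_sub_comm,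
        abs_of_nonneg (by linarith)]
      have h1 : Real.exp (-b) = Real.exp (-a) * Real.exp (-(b - a)) := by
        rw [← Real.exp_add]; ring_nf
      have h2 := Real.add_one_le_exp (-(b - a))
      have h3 : Real.exp (-a) ≤ 1 := by simpa using ha
      have h4 := Real.exp_pos (-a)
      rw [h1]
      nlinarith
    rcases le_total (G s) (G t) with h | h
    · exact key _ _ (hGnn s hs) h
    · rw [abs_sub_comm, abs_sub_comm (G s)]
      exact key _ _ (hGnn t ht) h
  -- Integrating factor: the product is absolutely continuous, so it is the integral of its a.e.
  -- derivative, which is nonpositive.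
  have hψac := hzac.fun_mul hexpac
  have hsubT : uIcc 0 t ⊆ uIcc 0 T := uIcc_subset_uIcc left_mem_uIcc (huIcc ▸ ht)
  have hFTC := (hψac.mono hsubT).integral_deriv_eq_sub
  have hnonpos : ∫ x in (0 : ℝ)..t, deriv (fun t => (‖W t‖ ^ 2 + ε) * Real.exp (-G t)) x ≤ 0 := by
    rw [intervalIntegral.integral_of_le ht.1]
    refine integral_nonpos_of_ae ?_
    rw [Filter.EventuallyLE, ae_restrict_iff' measurableSet_Ioc]
    have hne : ∀ᵐ x : ℝ, x ≠ T := by simp [ae_iff]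
    filter_upwards [hw'.ae_hasDerivAt_integral, hg.ae_hasDerivAt_integral, hle, hne]
      with x h1 h2 h3 hxT hx
    have hxI : x ∈ Ioo 0 T := ⟨hx.1, lt_of_le_of_ne (hx.2.trans ht.2) hxT⟩
    have hxu : x ∈ uIcc 0 T := huIcc ▸ Ioo_subset_Icc_self hxI
    have hWd : HasDerivAt W (w' x) x := (h1 hxu 0 left_mem_uIcc).const_add _
    have hGd : HasDerivAt G (g x) x := h2 hxu 0 left_mem_uIcc
    have hd := (hWd.norm_sq.add_const ε).mul hGd.neg.exp
    rw [show deriv (fun t => (‖W t‖ ^ 2 + ε) * Real.exp (-G t)) x = _ from hd.deriv]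
    have h4 := h3 hxI
    rw [hWw x (Ioo_subset_Icc_self hxI)] at h4
    have h5 := Real.exp_pos (-G x)
    simp only [Pi.zero_apply, Pi.neg_apply]
    nlinarith
  have h0 : (0 : ℝ) ∈ Icc 0 T := ⟨le_rfl, hT⟩
  have h1 : (‖W t‖ ^ 2 + ε) * Real.exp (-G t) ≤ ‖W 0‖ ^ 2 + ε := by
    have hG0 : G 0 = 0 := by simp [hG]
    rw [hFTC] at hnonpos
    simpa [hG0] using hnonpos
  rw [hWw t ht, hWw 0 h0]
  have h2 : G t ≤ G T := by
    have : G T - G t = ∫ r in t..T, g r :=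
      intervalIntegral.integral_interval_sub_left hg (hg.zero_left (huIcc ▸ ht))
    have h3 : 0 ≤ ∫ r in t..T, g r := intervalIntegral.integral_nonneg ht.2 fun r _ => hg0 r
    linarith
  calc ‖W t‖ ^ 2 + ε = (‖W t‖ ^ 2 + ε) * Real.exp (-G t) * Real.exp (G t) := by
        rw [mul_assoc, ← Real.exp_add]; simp
    _ ≤ (‖W 0‖ ^ 2 + ε) * Real.exp (G T) := by gcongr

end Gronwall

/-! ### Diagonal operators on a Hilbert space -/

section Spectral

variable {ι E : Type*} [NormedAddCommGroup E] [InnerProductSpace ℝ E]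

theorem hasSum_coord_mul (e : HilbertBasis ι ℝ E) (u v : E) :
    HasSum (fun k => ⟪e k, u⟫_ℝ * ⟪e k, v⟫_ℝ) ⟪u, v⟫_ℝ := by
  simpa only [real_inner_comm u] using e.hasSum_inner_mul_inner u v

theorem hasSum_coord_sq (e : HilbertBasis ι ℝ E) (u : E) :
    HasSum (fun k => ⟪e k, u⟫_ℝ ^ 2) (‖u‖ ^ 2) := by
  simpa only [sq, real_inner_self_eq_norm_mul_norm] using hasSum_coord_mul e u u

theorem ext_coord (e : HilbertBasis ι ℝ E) {u v : E} (h : ∀ k, ⟪e k, u⟫_ℝ = ⟪e k, v⟫_ℝ) :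
    u = v := by
  apply e.repr.injective
  ext k
  simpa only [HilbertBasis.repr_apply_apply] using h k

/-- Riesz–Fischer. -/
theorem exists_coord_eq (e : HilbertBasis ι ℝ E) {c : ι → ℝ} (hc : Summable fun k => c k ^ 2) :
    ∃ u, ∀ k, ⟪e k, u⟫_ℝ = c k := by
  have hm : Memℓp c 2 := by
    rw [memℓp_gen_iff (by norm_num)]
    simpa using hc
  refine ⟨e.repr.symm ⟨c, hm⟩, fun k => ?_⟩
  rw [← HilbertBasis.repr_apply_apply, LinearIsometryEquiv.apply_symm_apply]

theorem inner_basis_basis [DecidableEq ι] (e : HilbertBasis ι ℝ E) (k l : ι) :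
    ⟪e k, e l⟫_ℝ = if k = l then 1 else 0 :=
  orthonormal_iff_ite.1 e.orthonormal k l

/-- The domain of the diagonal operator with eigenvalues `lam` in the basis `e`. -/
def specDom (e : HilbertBasis ι ℝ E) (lam : ι → ℝ) : Submodule ℝ E where
  carrier := {u | Summable fun k => (lam k * ⟪e k, u⟫_ℝ) ^ 2}
  zero_mem' := by simp
  add_mem' := by
    intro u v hu hv
    refine Summable.of_nonneg_of_le (fun k => sq_nonneg _) (fun k => ?_)
      ((hu.mul_left 2).add (hv.mul_left 2))
    rw [inner_add_right]
    nlinarith [sq_nonneg (lam k * ⟪e k, u⟫_ℝ - lam k * ⟪e k, v⟫_ℝ)]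
  smul_mem' := by
    intro c u hu
    refine (hu.mul_left (c ^ 2)).congr fun k => ?_
    rw [inner_smul_right]
    ring

open Classical in
/-- The diagonal operator with eigenvalues `lam` in the basis `e` (zero off its domain). -/
def specOp (e : HilbertBasis ι ℝ E) (lam : ι → ℝ) (u : E) : E :=
  if h : u ∈ specDom e lam then (exists_coord_eq e h).choose else 0

variable {e : HilbertBasis ι ℝ E} {lam : ι → ℝ} {u v : E}

theorem coord_specOp (hu : u ∈ specDom e lam) (k : ι) :
    ⟪e k, specOp e lam u⟫_ℝ = lam k * ⟪e k, u⟫_ℝ := by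
  rw [specOp, dif_pos hu]
  exact (exists_coord_eq e hu).choose_spec k

theorem specOp_sub (hu : u ∈ specDom e lam) (hv : v ∈ specDom e lam) :
    specOp e lam (u - v) = specOp e lam u - specOp e lam v := by
  refine ext_coord e fun k => ?_
  rw [coord_specOp (sub_mem hu hv), inner_sub_right, inner_sub_right, coord_specOp hu,
    coord_specOp hv, mul_sub]

theorem specOp_smul (c : ℝ) (hu : u ∈ specDom e lam) :
    specOp e lam (c • u) = c • specOp e lam u := by
  refine ext_coord e fun k => ?_
  rw [coord_specOp (Submodule.smul_mem _ c hu), inner_smul_right, inner_smul_right,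
    coord_specOp hu]
  ring

theorem hasSum_energy (hu : u ∈ specDom e lam) (v : E) :
    HasSum (fun k => lam k * ⟪e k, u⟫_ℝ * ⟪e k, v⟫_ℝ) ⟪specOp e lam u, v⟫_ℝ := by
  simpa only [coord_specOp hu] using hasSum_coord_mul e (specOp e lam u) v

theorem hasSum_norm_specOp_sq (hu : u ∈ specDom e lam) :
    HasSum (fun k => (lam k * ⟪e k, u⟫_ℝ) ^ 2) (‖specOp e lam u‖ ^ 2) := by
  simpa only [coord_specOp hu] using hasSum_coord_sq e (specOp e lam u)

theorem specOp_symm (hu : u ∈ specDom e lam) (hv : v ∈ specDom e lam) :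
    ⟪specOp e lam u, v⟫_ℝ = ⟪u, specOp e lam v⟫_ℝ := by
  refine (hasSum_energy hu v).unique ?_
  rw [real_inner_comm]
  convert hasSum_energy hv u using 1
  ext k
  ring

/-- A difference of squares for the symmetric form of `A`. All derivatives land on `u + v`, so
differences of `|∇u|²` are controlled by `u - v` in the norm of `E` alone. -/
theorem energy_sub (hu : u ∈ specDom e lam) (hv : v ∈ specDom e lam) :
    ⟪specOp e lam u, u⟫_ℝ - ⟪specOp e lam v, v⟫_ℝ
      = ⟪specOp e lam u + specOp e lam v, u - v⟫_ℝ := by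
  have h : ⟪specOp e lam v, u⟫_ℝ = ⟪specOp e lam u, v⟫_ℝ := by
    rw [specOp_symm hv hu, real_inner_comm]
  rw [inner_add_left, inner_sub_right, inner_sub_right, h]
  ring

/-- Truncation to finitely many coordinates. -/
def trunc (e : HilbertBasis ι ℝ E) (F : Finset ι) : E →L[ℝ] E :=
  ∑ k ∈ F, (innerSL ℝ (e k)).smulRight (e k)

theorem trunc_apply (e : HilbertBasis ι ℝ E) (F : Finset ι) (u : E) :
    trunc e F u = ∑ k ∈ F, ⟪e k, u⟫_ℝ • e k := by
  simp [trunc]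

theorem coord_trunc [DecidableEq ι] (e : HilbertBasis ι ℝ E) (F : Finset ι) (u : E) (k : ι) :
    ⟪e k, trunc e F u⟫_ℝ = if k ∈ F then ⟪e k, u⟫_ℝ else 0 := by
  simp [trunc_apply, inner_sum, inner_smul_right, inner_basis_basis]

theorem coord_trunc_of_mem {F : Finset ι} (u : E) {k : ι} (hk : k ∈ F) :
    ⟪e k, trunc e F u⟫_ℝ = ⟪e k, u⟫_ℝ := by
  classical
  rw [coord_trunc, if_pos hk]

theorem coord_trunc_of_notMem {F : Finset ι} (u : E) {k : ι} (hk : k ∉ F) :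
    ⟪e k, trunc e F u⟫_ℝ = 0 := by
  classical
  rw [coord_trunc, if_neg hk]

theorem trunc_symm (e : HilbertBasis ι ℝ E) (F : Finset ι) (u v : E) :
    ⟪trunc e F u, v⟫_ℝ = ⟪u, trunc e F v⟫_ℝ := by
  simp only [trunc_apply, sum_inner, inner_sum, inner_smul_left, inner_smul_right,
    RCLike.conj_to_real]
  refine Finset.sum_congr rfl fun k _ => ?_
  rw [real_inner_comm (e k) u]
  ring

theorem trunc_eq_self {F : Finset ι} (h : ∀ k ∉ F, ⟪e k, u⟫_ℝ = 0) : trunc e F u = u := by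
  refine ext_coord e fun k => ?_
  by_cases hk : k ∈ F
  · rw [coord_trunc_of_mem _ hk]
  · rw [coord_trunc_of_notMem _ hk, h k hk]

theorem mem_specDom_of_finite {F : Finset ι} (h : ∀ k ∉ F, ⟪e k, u⟫_ℝ = 0) :
    u ∈ specDom e lam := by
  refine summable_of_ne_finset_zero (s := F) fun k hk => ?_
  rw [h k hk]
  simp

theorem trunc_mem_specDom (F : Finset ι) (u : E) : trunc e F u ∈ specDom e lam :=
  mem_specDom_of_finite fun _ hk => coord_trunc_of_notMem u hk

theorem basis_mem_specDom (k : ι) : e k ∈ specDom e lam := by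
  classical
  refine mem_specDom_of_finite (F := {k}) fun l hl => ?_
  rw [inner_basis_basis, if_neg (by simpa using hl)]

theorem norm_le_of_abs_coord_le (e : HilbertBasis ι ℝ E) {c : ℝ} (hc : 0 ≤ c)
    (h : ∀ k, |⟪e k, u⟫_ℝ| ≤ c * |⟪e k, v⟫_ℝ|) : ‖u‖ ≤ c * ‖v‖ := by
  refine abs_le_of_sq_le_sq' ?_ (by positivity) |>.2
  rw [mul_pow]
  refine hasSum_le (fun k => ?_) (hasSum_coord_sq e u) ((hasSum_coord_sq e v).mul_left (c ^ 2))
  rw [← mul_pow, ← sq_abs, ← sq_abs (c * _), abs_mul, abs_of_nonneg hc]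
  exact pow_le_pow_left₀ (abs_nonneg _) (h k) 2

theorem norm_trunc_le (e : HilbertBasis ι ℝ E) (F : Finset ι) (u : E) : ‖trunc e F u‖ ≤ ‖u‖ := by
  classical
  rw [← one_mul ‖u‖]
  refine norm_le_of_abs_coord_le e zero_le_one fun k => ?_
  rw [coord_trunc, one_mul]
  split_ifs <;> simp

theorem exists_norm_specOp_trunc_le (e : HilbertBasis ι ℝ E) (lam : ι → ℝ) (F : Finset ι) :
    ∃ L, 0 ≤ L ∧ ∀ u, ‖specOp e lam (trunc e F u)‖ ≤ L * ‖u‖ := by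
  classical
  refine ⟨∑ k ∈ F, |lam k|, Finset.sum_nonneg fun _ _ => abs_nonneg _, fun u => ?_⟩
  refine norm_le_of_abs_coord_le e (Finset.sum_nonneg fun _ _ => abs_nonneg _) fun k => ?_
  rw [coord_specOp (trunc_mem_specDom F u), coord_trunc, abs_mul]
  by_cases hk : k ∈ F
  · rw [if_pos hk]
    gcongr
    exact Finset.single_le_sum (f := fun k => |lam k|) (fun _ _ => abs_nonneg _) hk
  · rw [if_neg hk]
    simp only [abs_zero, mul_zero]
    exact mul_nonneg (Finset.sum_nonneg fun _ _ => abs_nonneg _) (abs_nonneg _)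

theorem norm_le_norm_specOp (hlam : ∀ k, 1 ≤ lam k) (hu : u ∈ specDom e lam) :
    ‖u‖ ≤ ‖specOp e lam u‖ := by
  rw [← one_mul ‖specOp e lam u‖]
  refine norm_le_of_abs_coord_le e zero_le_one fun k => ?_
  rw [coord_specOp hu, one_mul, abs_mul]
  exact le_mul_of_one_le_left (abs_nonneg _) ((hlam k).trans (le_abs_self _))

theorem norm_sq_le_energy (hlam : ∀ k, 1 ≤ lam k) (hu : u ∈ specDom e lam) :
    ‖u‖ ^ 2 ≤ ⟪specOp e lam u, u⟫_ℝ := by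
  refine hasSum_le (fun k => ?_) (hasSum_coord_sq e u) (hasSum_energy hu u)
  nlinarith [hlam k, sq_nonneg ⟪e k, u⟫_ℝ]

theorem energy_nonneg (hlam : ∀ k, 1 ≤ lam k) (hu : u ∈ specDom e lam) :
    0 ≤ ⟪specOp e lam u, u⟫_ℝ :=
  (sq_nonneg _).trans (norm_sq_le_energy hlam hu)

theorem energy_le_norm_sq (hlam : ∀ k, 1 ≤ lam k) (hu : u ∈ specDom e lam) :
    ⟪specOp e lam u, u⟫_ℝ ≤ ‖specOp e lam u‖ ^ 2 := by
  refine (real_inner_le_norm _ _).trans ?_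
  rw [sq]
  gcongr
  exact norm_le_norm_specOp hlam hu

theorem energy_trunc_le (hlam : ∀ k, 1 ≤ lam k) (hu : u ∈ specDom e lam) (F : Finset ι) :
    ⟪specOp e lam (trunc e F u), trunc e F u⟫_ℝ ≤ ⟪specOp e lam u, u⟫_ℝ := by
  classical
  refine hasSum_le (fun k => ?_) (hasSum_energy (trunc_mem_specDom F u) _) (hasSum_energy hu u)
  rw [coord_trunc]
  split_ifs
  · rfl
  · nlinarith [hlam k, sq_nonneg ⟪e k, u⟫_ℝ]

/-- Outside `F` each eigenvalue is at least `r`, so one power of `A` buys a factor `r`. This and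
`tail_energy_le` make truncation errors quantitative. -/
theorem tail_norm_sq_le (hlam : ∀ k, 1 ≤ lam k) (hu : u ∈ specDom e lam) {F : Finset ι} {r : ℝ}
    (hF : ∀ k ∉ F, r ≤ lam k) :
    r * ‖u - trunc e F u‖ ^ 2 ≤ ⟪specOp e lam u, u⟫_ℝ := by
  classical
  refine hasSum_le (fun k => ?_) ((hasSum_coord_sq e _).mul_left r) (hasSum_energy hu u)
  rw [inner_sub_right, coord_trunc]
  split_ifs with hk
  · nlinarith [hlam k, sq_nonneg ⟪e k, u⟫_ℝ]
  · nlinarith [hF k hk, sq_nonneg ⟪e k, u⟫_ℝ]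

theorem tail_energy_le (hlam : ∀ k, 1 ≤ lam k) (hu : u ∈ specDom e lam) {F : Finset ι} {r : ℝ}
    (hF : ∀ k ∉ F, r ≤ lam k) :
    r * ⟪specOp e lam (u - trunc e F u), u - trunc e F u⟫_ℝ ≤ ‖specOp e lam u‖ ^ 2 := by
  classical
  refine hasSum_le (fun k => ?_)
    ((hasSum_energy (sub_mem hu (trunc_mem_specDom F u)) _).mul_left r) (hasSum_norm_specOp_sq hu)
  rw [inner_sub_right, coord_trunc]
  split_ifs with hk
  · simpa using sq_nonneg _
  · have h1 : 0 ≤ lam k * ⟪e k, u⟫_ℝ ^ 2 :=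
      mul_nonneg (zero_le_one.trans (hlam k)) (sq_nonneg _)
    nlinarith [hF k hk]

end Spectral

/-! ### Convection operators dominated by a diagonal operator -/

section Convection

variable {ι E : Type*} [NormedAddCommGroup E] [InnerProductSpace ℝ E]

/-- The algebraic identities and bounds of the two-dimensional Navier–Stokes convection term `B`,
relative to the Stokes operator, which is diagonal in the basis `e` with eigenvalues `lam`. -/
structure IsConvection (e : HilbertBasis ι ℝ E) (lam : ι → ℝ) (B : E → E → E) (C : ℝ) : Prop where
  one_le : ∀ k, 1 ≤ lam k
  tail : ∀ r : ℝ, ∃ F : Finset ι, ∀ k ∉ F, r ≤ lam k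
  nonneg : 0 ≤ C
  sub_left : ∀ {u v w}, u ∈ specDom e lam → v ∈ specDom e lam → w ∈ specDom e lam →
    B (u - v) w = B u w - B v w
  add_right : ∀ {u v w}, u ∈ specDom e lam → v ∈ specDom e lam → w ∈ specDom e lam →
    B u (v + w) = B u v + B u w
  smul_right : ∀ {u v} (c : ℝ), u ∈ specDom e lam → v ∈ specDom e lam →
    B u (c • v) = c • B u v
  norm_le : ∀ {u v}, u ∈ specDom e lam → v ∈ specDom e lam →
    ‖B u v‖ ≤ C * ‖specOp e lam u‖ * √⟪specOp e lam v, v⟫_ℝ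
  abs_inner_le : ∀ {u v w}, u ∈ specDom e lam → v ∈ specDom e lam → w ∈ specDom e lam →
    |⟪B u v, w⟫_ℝ| ≤ C * ‖u‖ * √⟪specOp e lam v, v⟫_ℝ * ‖specOp e lam w‖
  inner_basis : ∀ {u} (k l : ι), u ∈ specDom e lam → ⟪B u (e k), e l⟫_ℝ = -⟪B u (e l), e k⟫_ℝ
  inner_specOp : ∀ {u} {F : Finset ι}, (∀ k ∉ F, ⟪e k, u⟫_ℝ = 0) →
    ⟪B u u, specOp e lam u⟫_ℝ = 0
  basis_le : ∀ k, ∃ c, ∀ {u w}, u ∈ specDom e lam → w ∈ specDom e lam →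
    |⟪B u (e k), w⟫_ℝ| ≤ c * ‖u‖ * ‖w‖

variable {e : HilbertBasis ι ℝ E} {lam : ι → ℝ} {B : E → E → E} {C : ℝ} {u v w : E}

namespace IsConvection

theorem sub_right (hB : IsConvection e lam B C) (hu : u ∈ specDom e lam)
    (hv : v ∈ specDom e lam) (hw : w ∈ specDom e lam) : B u (v - w) = B u v - B u w := by
  rw [eq_sub_iff_add_eq, ← hB.add_right hu (sub_mem hv hw) hw, sub_add_cancel]

theorem sum_right (hB : IsConvection e lam B C) (hu : u ∈ specDom e lam) (F : Finset ι)
    (c : ι → ℝ) : B u (∑ k ∈ F, c k • e k) = ∑ k ∈ F, c k • B u (e k) := by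
  classical
  have hmem : ∀ F : Finset ι, ∑ k ∈ F, c k • e k ∈ specDom e lam := fun F =>
    Submodule.sum_mem _ fun k _ => Submodule.smul_mem _ _ (basis_mem_specDom k)
  induction F using Finset.induction_on with
  | empty =>
    have h := hB.smul_right 0 hu (zero_mem _ : (0 : E) ∈ specDom e lam)
    simpa using h
  | insert k F hk ih =>
    rw [Finset.sum_insert hk, Finset.sum_insert hk, hB.add_right hu
      (Submodule.smul_mem _ _ (basis_mem_specDom k)) (hmem F),
      hB.smul_right _ hu (basis_mem_specDom k), ih]

/-- Expanding both slots in the basis leaves a quadratic form in the matrix `⟪B u (e k), e l⟫`,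
which is antisymmetric by `inner_basis`. -/
theorem inner_trunc_trunc (hB : IsConvection e lam B C) (hu : u ∈ specDom e lam)
    (F : Finset ι) (v w : E) :
    ⟪B u (trunc e F v), trunc e F w⟫_ℝ + ⟪B u (trunc e F w), trunc e F v⟫_ℝ = 0 := by
  have h : ∀ v w : E, ⟪B u (trunc e F v), trunc e F w⟫_ℝ
      = ∑ k ∈ F, ∑ l ∈ F, ⟪e k, v⟫_ℝ * ⟪e l, w⟫_ℝ * ⟪B u (e k), e l⟫_ℝ := by
    intro v w
    rw [trunc_apply, trunc_apply, hB.sum_right hu, sum_inner]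
    refine Finset.sum_congr rfl fun k _ => ?_
    rw [inner_sum]
    refine Finset.sum_congr rfl fun l _ => ?_
    rw [inner_smul_left, inner_smul_right, RCLike.conj_to_real]
    ring
  rw [h v w, h w v, Finset.sum_comm (s := F) (t := F) (f := fun k l =>
    ⟪e k, w⟫_ℝ * ⟪e l, v⟫_ℝ * ⟪B u (e k), e l⟫_ℝ), ← Finset.sum_add_distrib]
  refine Finset.sum_eq_zero fun k _ => ?_
  rw [← Finset.sum_add_distrib]
  refine Finset.sum_eq_zero fun l _ => ?_
  rw [hB.inner_basis k l hu]
  ring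

/-- Antisymmetry passes from finitely many modes to the whole domain, since the symmetrised form `S`
is continuous for the energy norm and truncations converge in that norm. -/
theorem inner_swap (hB : IsConvection e lam B C) (hu : u ∈ specDom e lam)
    (hv : v ∈ specDom e lam) (hw : w ∈ specDom e lam) : ⟪B u v, w⟫_ℝ = -⟪B u w, v⟫_ℝ := by
  set S : E → E → ℝ := fun v w => ⟪B u v, w⟫_ℝ + ⟪B u w, v⟫_ℝ with hS
  suffices h : S v w = 0 by simp only [hS] at h; linarith
  have hbound : ∀ {v w}, v ∈ specDom e lam → w ∈ specDom e lam → |S v w| ≤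
      C * ‖specOp e lam u‖ * (√⟪specOp e lam v, v⟫_ℝ * ‖w‖ + √⟪specOp e lam w, w⟫_ℝ * ‖v‖) := by
    intro v w hv hw
    have h1 := (abs_real_inner_le_norm (B u v) w).trans
      (mul_le_mul_of_nonneg_right (hB.norm_le hu hv) (norm_nonneg w))
    have h2 := (abs_real_inner_le_norm (B u w) v).trans
      (mul_le_mul_of_nonneg_right (hB.norm_le hu hw) (norm_nonneg v))
    have h3 := abs_add_le ⟪B u v, w⟫_ℝ ⟪B u w, v⟫_ℝ
    simp only [hS]
    linarith
  -- `D` collects the bounds on the two leftover pieces of `hsplit` below, each of which carries one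
  -- tail factor `1 / n`.
  set D := C * ‖specOp e lam u‖ * (‖specOp e lam v‖ * ‖w‖ + √⟪specOp e lam w, w⟫_ℝ
    * ‖specOp e lam v‖ + (√⟪specOp e lam v, v⟫_ℝ * ‖specOp e lam w‖ + ‖specOp e lam w‖ * ‖v‖))
    with hD
  have hCu : 0 ≤ C * ‖specOp e lam u‖ := mul_nonneg hB.nonneg (norm_nonneg _)
  have key : ∀ n : ℝ, 0 < n → |S v w| ≤ D / n := by
    intro n hn
    obtain ⟨F, hF⟩ := hB.tail (n ^ 2)
    have hPv := trunc_mem_specDom (e := e) (lam := lam) F v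
    have hPw := trunc_mem_specDom (e := e) (lam := lam) F w
    -- The missing term is `S` at the two truncations, which vanishes.
    have hsplit : S v w = S (v - trunc e F v) w + S (trunc e F v) (w - trunc e F w) := by
      have h0 := hB.inner_trunc_trunc hu F v w
      simp only [hS]
      rw [hB.sub_right hu hv hPv, hB.sub_right hu hw hPw]
      simp only [inner_sub_left, inner_sub_right]
      linarith
    have htail : ∀ {v}, v ∈ specDom e lam →
        √⟪specOp e lam (v - trunc e F v), v - trunc e F v⟫_ℝ ≤ ‖specOp e lam v‖ / n := by
      intro v hv
      rw [Real.sqrt_le_left (by positivity), div_pow, le_div_iff₀' (by positivity)]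
      exact tail_energy_le hB.one_le hv hF
    have htail' : ∀ {v}, v ∈ specDom e lam → ‖v - trunc e F v‖ ≤ ‖specOp e lam v‖ / n := by
      intro v hv
      refine le_trans ?_ (htail hv)
      refine Real.le_sqrt_of_sq_le ?_
      exact norm_sq_le_energy hB.one_le (sub_mem hv (trunc_mem_specDom F v))
    have h1 := hbound (sub_mem hv hPv) hw
    have h2 := hbound hPv (sub_mem hw hPw)
    have h3 : √⟪specOp e lam (trunc e F v), trunc e F v⟫_ℝ ≤ √⟪specOp e lam v, v⟫_ℝ :=
      Real.sqrt_le_sqrt (energy_trunc_le hB.one_le hv F)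
    have h4 := norm_trunc_le e F v
    rw [hsplit]
    refine (abs_add_le _ _).trans ((add_le_add h1 h2).trans ?_)
    rw [← mul_add]
    calc _ ≤ C * ‖specOp e lam u‖ * (‖specOp e lam v‖ / n * ‖w‖ + √⟪specOp e lam w, w⟫_ℝ *
          (‖specOp e lam v‖ / n) + (√⟪specOp e lam v, v⟫_ℝ * (‖specOp e lam w‖ / n) +
          ‖specOp e lam w‖ / n * ‖v‖)) := by
          gcongr
          · exact htail hv
          · exact htail' hv
          · exact htail' hw
          · exact htail hw
      _ = D / n := by rw [hD]; ring
  have hlim : Filter.Tendsto (fun n : ℝ => D / n) Filter.atTop (nhds 0) :=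
    tendsto_const_nhds.div_atTop Filter.tendsto_id
  have h0 : |S v w| ≤ 0 := ge_of_tendsto hlim
    ((Filter.eventually_gt_atTop 0).mono fun n hn => key n hn)
  exact abs_nonpos_iff.1 h0

theorem inner_self (hB : IsConvection e lam B C) (hu : u ∈ specDom e lam)
    (hv : v ∈ specDom e lam) : ⟪B u v, v⟫_ℝ = 0 := by
  linarith [hB.inner_swap hu hv hv]

end IsConvection

/-- The right-hand side of the constrained equation. -/
def constrainedRHS (e : HilbertBasis ι ℝ E) (lam : ι → ℝ) (B : E → E → E) (f : E → E) (u : E) :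
    E :=
  -specOp e lam u - B u u + ⟪specOp e lam u, u⟫_ℝ • u + f u

namespace IsConvection

variable {f : E → E} {K : ℝ≥0}

/-- The estimate behind both uniqueness and convergence. With `w = u - v`, `B u u - B v v = B w u +
B v w`; the second term is orthogonal to `w`, and the first pairs with `w` to `-⟪B w w, u⟫`, so no
derivative of order higher than one falls on `w`. -/
theorem inner_constrainedRHS_sub_le (hB : IsConvection e lam B C) (hf : LipschitzWith K f)
    {R : ℝ} (hu : u ∈ specDom e lam) (hv : v ∈ specDom e lam) (hvR : ‖v‖ ≤ R) :
    2 * ⟪u - v, constrainedRHS e lam B f u - constrainedRHS e lam B f v⟫_ℝ ≤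
      (C ^ 2 + 2 + 2 * R + 2 * K) * (1 + ‖specOp e lam u‖ ^ 2 + ‖specOp e lam v‖ ^ 2)
        * ‖u - v‖ ^ 2 := by
  have hR : 0 ≤ R := (norm_nonneg v).trans hvR
  set w := u - v with hw_def
  have hw : w ∈ specDom e lam := sub_mem hu hv
  set a := ‖specOp e lam u‖
  set b := ‖specOp e lam v‖
  set y := ⟪specOp e lam w, w⟫_ℝ with hy
  have hdecomp : constrainedRHS e lam B f u - constrainedRHS e lam B f v =
      -specOp e lam w - (B w u + B v w) + (⟪specOp e lam u, u⟫_ℝ • w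
        + ⟪specOp e lam u + specOp e lam v, w⟫_ℝ • v) + (f u - f v) := by
    rw [hw_def, specOp_sub hu hv, hB.sub_left hu hv hu, hB.sub_right hv hu hv,
      ← energy_sub hu hv, constrainedRHS, constrainedRHS]
    module
  have h1 : ⟪w, B w u + B v w⟫_ℝ = -⟪B w w, u⟫_ℝ := by
    rw [inner_add_right, real_inner_comm, real_inner_comm (B v w), hB.inner_self hv hw,
      hB.inner_swap hw hu hw, add_zero]
  have h2 := hB.abs_inner_le hw hw hu
  have hy0 : 0 ≤ y := energy_nonneg hB.one_le hw
  -- Young's inequality: this uses `y` out of the available dissipation `2 * y`.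
  have h3 : 2 * ⟪B w w, u⟫_ℝ ≤ y + C ^ 2 * ‖w‖ ^ 2 * a ^ 2 := by
    have := (le_abs_self _).trans h2
    have hs := Real.sq_sqrt hy0
    nlinarith [sq_nonneg (√y - C * ‖w‖ * a)]
  have h4 : ⟪specOp e lam u, u⟫_ℝ ≤ a ^ 2 := energy_le_norm_sq hB.one_le hu
  have h5 : ⟪specOp e lam u + specOp e lam v, w⟫_ℝ * ⟪w, v⟫_ℝ ≤ (a + b) * ‖w‖ * (‖w‖ * R) := by
    refine (le_abs_self _).trans ?_
    rw [abs_mul]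
    refine mul_le_mul ?_ ?_ (abs_nonneg _) (by positivity)
    · refine (abs_real_inner_le_norm _ _).trans ?_
      gcongr
      exact norm_add_le _ _
    · refine (abs_real_inner_le_norm _ _).trans ?_
      gcongr
  have h6 : ⟪w, f u - f v⟫_ℝ ≤ K * ‖w‖ ^ 2 := by
    refine (real_inner_le_norm _ _).trans ?_
    have := hf.norm_sub_le u v
    rw [← hw_def] at this
    nlinarith [norm_nonneg w]
  rw [hdecomp, inner_add_right, inner_add_right, inner_sub_right, inner_neg_right, h1,
    inner_add_right, inner_smul_right, inner_smul_right, real_inner_self_eq_norm_sq,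
    real_inner_comm, ← hy]
  have hz : 0 ≤ ‖w‖ ^ 2 := sq_nonneg _
  have hK : (0 : ℝ) ≤ K := K.2
  have h7 : (a + b) * ‖w‖ * (‖w‖ * R) ≤ R * (1 + a ^ 2 + b ^ 2) * ‖w‖ ^ 2 := by
    have : (a + b) ≤ 1 + a ^ 2 + b ^ 2 := by nlinarith [sq_nonneg (a - 1), sq_nonneg (b - 1)]
    calc _ = R * (a + b) * ‖w‖ ^ 2 := by ring
      _ ≤ _ := by gcongr
  have h8 : ⟪specOp e lam u, u⟫_ℝ * ‖w‖ ^ 2 ≤ a ^ 2 * ‖w‖ ^ 2 := by gcongr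
  have h9 : C ^ 2 * ‖w‖ ^ 2 * a ^ 2 + 2 * (a ^ 2 * ‖w‖ ^ 2)
      + 2 * (R * (1 + a ^ 2 + b ^ 2) * ‖w‖ ^ 2) + 2 * (K * ‖w‖ ^ 2) ≤
      (C ^ 2 + 2 + 2 * R + 2 * K) * (1 + a ^ 2 + b ^ 2) * ‖w‖ ^ 2 := by
    have e1 : C ^ 2 * a ^ 2 + 2 * a ^ 2 + 2 * (R * (1 + a ^ 2 + b ^ 2)) + 2 * K ≤
        (C ^ 2 + 2 + 2 * R + 2 * K) * (1 + a ^ 2 + b ^ 2) := by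
      have : 0 ≤ C ^ 2 * (1 + b ^ 2) + 2 * (1 + b ^ 2) + 2 * K * (a ^ 2 + b ^ 2) := by positivity
      nlinarith
    nlinarith [mul_le_mul_of_nonneg_right e1 hz]
  linarith

/-- In a fixed coordinate the derivatives in the convection term can be moved onto the mode `e k`.
The bound is then linear in `‖u - v‖`, with a weight that is integrable in time along the
approximations; this is what passes the equation to the limit. -/
theorem exists_abs_coord_constrainedRHS_sub_le (hB : IsConvection e lam B C)
    (hf : LipschitzWith K f) (k : ι) :
    ∃ c, 0 ≤ c ∧ ∀ u ∈ specDom e lam, ∀ v ∈ specDom e lam, ‖u‖ ≤ 1 → ‖v‖ ≤ 1 →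
      |⟪e k, constrainedRHS e lam B f u - constrainedRHS e lam B f v⟫_ℝ| ≤
        c * (1 + ‖specOp e lam u‖ + ‖specOp e lam v‖) * ‖u - v‖ := by
  obtain ⟨c, hc⟩ := hB.basis_le k
  have hK : (0 : ℝ) ≤ K := K.2
  refine ⟨|lam k| + 2 * |c| + 2 + K, by positivity, fun u hu v hv hu1 hv1 => ?_⟩
  have hek : ‖e k‖ = 1 := e.orthonormal.1 k
  set w := u - v with hw_def
  have hw : w ∈ specDom e lam := sub_mem hu hv
  set a := ‖specOp e lam u‖ with ha
  set b := ‖specOp e lam v‖ with hb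
  have hdecomp : ⟪e k, constrainedRHS e lam B f u - constrainedRHS e lam B f v⟫_ℝ =
      -(lam k * ⟪e k, w⟫_ℝ) + (⟪B w (e k), u⟫_ℝ + ⟪B v (e k), w⟫_ℝ)
        + (⟪specOp e lam u, u⟫_ℝ * ⟪e k, w⟫_ℝ
          + ⟪specOp e lam u + specOp e lam v, w⟫_ℝ * ⟪e k, v⟫_ℝ) + ⟪e k, f u - f v⟫_ℝ := by
    have h1 : ∀ {u}, u ∈ specDom e lam → ⟪e k, B u u⟫_ℝ = -⟪B u (e k), u⟫_ℝ := by
      intro u hu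
      rw [real_inner_comm, hB.inner_swap hu hu (basis_mem_specDom k)]
    rw [hB.sub_left hu hv (basis_mem_specDom k), ← energy_sub hu hv, constrainedRHS,
      constrainedRHS]
    simp only [hw_def, inner_sub_right, inner_add_right, inner_neg_right, inner_smul_right,
      coord_specOp hu, coord_specOp hv, h1 hu, h1 hv, inner_sub_left]
    ring
  have hcw : ∀ x : E, |⟪e k, x⟫_ℝ| ≤ ‖x‖ := fun x => by
    simpa [hek] using abs_real_inner_le_norm (e k) x
  have h1 : |lam k * ⟪e k, w⟫_ℝ| ≤ |lam k| * ‖w‖ := by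
    rw [abs_mul]; gcongr; exact hcw w
  have h2 : |⟪B w (e k), u⟫_ℝ| ≤ |c| * ‖w‖ := by
    refine (hc hw hu).trans ?_
    calc c * ‖w‖ * ‖u‖ ≤ |c| * ‖w‖ * 1 := by gcongr; exact le_abs_self c
      _ = _ := mul_one _
  have h3 : |⟪B v (e k), w⟫_ℝ| ≤ |c| * ‖w‖ := by
    refine (hc hv hw).trans ?_
    calc c * ‖v‖ * ‖w‖ ≤ |c| * 1 * ‖w‖ := by gcongr; exact le_abs_self c
      _ = _ := by ring
  have h4 : |⟪specOp e lam u, u⟫_ℝ * ⟪e k, w⟫_ℝ| ≤ a * ‖w‖ := by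
    rw [abs_mul]
    refine mul_le_mul ?_ (hcw w) (abs_nonneg _) (norm_nonneg _)
    refine (abs_real_inner_le_norm _ _).trans ?_
    exact mul_le_of_le_one_right (norm_nonneg _) hu1
  have h5 : |⟪specOp e lam u + specOp e lam v, w⟫_ℝ * ⟪e k, v⟫_ℝ| ≤ (a + b) * ‖w‖ := by
    rw [abs_mul]
    calc _ ≤ ((a + b) * ‖w‖) * 1 := by
          refine mul_le_mul ?_ ((hcw v).trans hv1) (abs_nonneg _) (by positivity)
          refine (abs_real_inner_le_norm _ _).trans ?_
          gcongr
          exact norm_add_le _ _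
      _ = _ := mul_one _
  have h6 : |⟪e k, f u - f v⟫_ℝ| ≤ K * ‖w‖ := (hcw _).trans (hf.norm_sub_le u v)
  have h0 : |⟪e k, constrainedRHS e lam B f u - constrainedRHS e lam B f v⟫_ℝ| ≤
      (|lam k| + 2 * |c| + (2 * a + b) + K) * ‖w‖ := by
    rw [hdecomp]
    have e1 := abs_add_le (-(lam k * ⟪e k, w⟫_ℝ) + (⟪B w (e k), u⟫_ℝ + ⟪B v (e k), w⟫_ℝ)
        + (⟪specOp e lam u, u⟫_ℝ * ⟪e k, w⟫_ℝ
          + ⟪specOp e lam u + specOp e lam v, w⟫_ℝ * ⟪e k, v⟫_ℝ)) ⟪e k, f u - f v⟫_ℝ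
    have e2 := abs_add_le (-(lam k * ⟪e k, w⟫_ℝ) + (⟪B w (e k), u⟫_ℝ + ⟪B v (e k), w⟫_ℝ))
        (⟪specOp e lam u, u⟫_ℝ * ⟪e k, w⟫_ℝ
          + ⟪specOp e lam u + specOp e lam v, w⟫_ℝ * ⟪e k, v⟫_ℝ)
    have e3 := abs_add_le (-(lam k * ⟪e k, w⟫_ℝ)) (⟪B w (e k), u⟫_ℝ + ⟪B v (e k), w⟫_ℝ)
    have e4 := abs_add_le ⟪B w (e k), u⟫_ℝ ⟪B v (e k), w⟫_ℝ
    have e5 := abs_add_le (⟪specOp e lam u, u⟫_ℝ * ⟪e k, w⟫_ℝ)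
      (⟪specOp e lam u + specOp e lam v, w⟫_ℝ * ⟪e k, v⟫_ℝ)
    rw [abs_neg] at e3
    linarith
  refine h0.trans ?_
  gcongr
  have ha0 : 0 ≤ a := norm_nonneg _
  have hb0 : 0 ≤ b := norm_nonneg _
  nlinarith [abs_nonneg (lam k), abs_nonneg c, mul_nonneg (abs_nonneg (lam k)) ha0,
    mul_nonneg (abs_nonneg (lam k)) hb0, mul_nonneg (abs_nonneg c) ha0,
    mul_nonneg (abs_nonneg c) hb0, mul_nonneg hK ha0, mul_nonneg hK hb0]

/-- Once the energy is bounded this is affine in `‖A u‖`, so `A u ∈ L²` in time yields `du/dt ∈ L²`.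
-/
theorem norm_constrainedRHS_le (hB : IsConvection e lam B C) (hu : u ∈ specDom e lam) :
    ‖constrainedRHS e lam B f u‖ ≤ ‖specOp e lam u‖ + C * ‖specOp e lam u‖ *
      √⟪specOp e lam u, u⟫_ℝ + ⟪specOp e lam u, u⟫_ℝ * ‖u‖ + ‖f u‖ := by
  have h1 := hB.norm_le hu hu
  have h2 : ‖⟪specOp e lam u, u⟫_ℝ • u‖ = ⟪specOp e lam u, u⟫_ℝ * ‖u‖ := by
    rw [norm_smul, Real.norm_of_nonneg (energy_nonneg hB.one_le hu)]
  have h3 := norm_add_le (-specOp e lam u - B u u + ⟪specOp e lam u, u⟫_ℝ • u) (f u)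
  have h4 := norm_add_le (-specOp e lam u - B u u) (⟪specOp e lam u, u⟫_ℝ • u)
  have h5 := norm_sub_le (-specOp e lam u) (B u u)
  rw [norm_neg] at h5
  rw [constrainedRHS]
  linarith

end IsConvection

end Convection

/-! ### Galerkin approximations -/

section Galerkin

variable {ι E : Type*} [NormedAddCommGroup E] [InnerProductSpace ℝ E]

/-- The radial retraction onto the closed unit ball. -/
def retract (u : E) : E := (max 1 ‖u‖)⁻¹ • u

theorem norm_retract_le (u : E) : ‖retract u‖ ≤ 1 := by
  have h : 0 < max 1 ‖u‖ := lt_max_of_lt_left one_pos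
  rw [retract, norm_smul, norm_inv, Real.norm_of_nonneg h.le, inv_mul_le_iff₀ h, mul_one]
  exact le_max_right _ _

theorem retract_of_norm_le {u : E} (h : ‖u‖ ≤ 1) : retract u = u := by
  simp [retract, max_eq_left h]

theorem norm_retract_sub_le (u v : E) : ‖retract u - retract v‖ ≤ 2 * ‖u - v‖ := by
  set p := max 1 ‖u‖ with hp
  set q := max 1 ‖v‖ with hq
  have hp1 : 1 ≤ p := le_max_left _ _
  have hq1 : 1 ≤ q := le_max_left _ _
  have hpq : |q - p| ≤ ‖u - v‖ := by
    refine (abs_max_sub_max_le_max 1 ‖v‖ 1 ‖u‖).trans ?_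
    rw [sub_self, abs_zero, max_eq_right (abs_nonneg _), norm_sub_rev]
    exact abs_norm_sub_norm_le v u
  have hp0 : 0 < p := by linarith
  have hq0 : 0 < q := by linarith
  -- The two terms are the scaled difference and the change of scale; each has norm at most `‖u -
  -- v‖`.
  have hsplit : retract u - retract v = p⁻¹ • (u - v) + ((q - p) * p⁻¹ * q⁻¹) • v := by
    have : (q - p) * p⁻¹ * q⁻¹ = p⁻¹ - q⁻¹ := by field_simp
    rw [this, retract, retract, ← hp, ← hq]
    module
  have hpi : p⁻¹ ≤ 1 := inv_le_one_of_one_le₀ hp1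
  have h1 : ‖p⁻¹ • (u - v)‖ ≤ ‖u - v‖ := by
    rw [norm_smul, norm_inv, Real.norm_of_nonneg hp0.le]
    exact mul_le_of_le_one_left (norm_nonneg _) hpi
  have h2 : ‖((q - p) * p⁻¹ * q⁻¹) • v‖ ≤ ‖u - v‖ := by
    rw [norm_smul, norm_mul, norm_mul, norm_inv, norm_inv, Real.norm_of_nonneg hp0.le,
      Real.norm_of_nonneg hq0.le, Real.norm_eq_abs, mul_assoc (|q - p| * p⁻¹)]
    have h3 : q⁻¹ * ‖v‖ ≤ 1 := by
      rw [inv_mul_le_iff₀ hq0, mul_one]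
      exact le_max_right _ _
    have h4 : |q - p| * p⁻¹ ≤ ‖u - v‖ := by
      calc |q - p| * p⁻¹ ≤ ‖u - v‖ * 1 := by gcongr
        _ = _ := mul_one _
    calc _ ≤ ‖u - v‖ * 1 := mul_le_mul h4 h3 (by positivity) (norm_nonneg _)
      _ = _ := mul_one _
  rw [hsplit]
  refine (norm_add_le _ _).trans ?_
  linarith

variable {e : HilbertBasis ι ℝ E} {lam : ι → ℝ} {B : E → E → E} {C : ℝ} {f : E → E} {K : ℝ≥0}

namespace IsConvection

/-- On finitely many modes `A` is bounded, so on the unit ball the quadratic and cubic terms are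
Lipschitz. -/
theorem exists_norm_constrainedRHS_trunc_sub_le (hB : IsConvection e lam B C)
    (hf : LipschitzWith K f) (F : Finset ι) :
    ∃ c : ℝ, 0 ≤ c ∧ ∀ u v : E, ‖u‖ ≤ 1 → ‖v‖ ≤ 1 →
      ‖constrainedRHS e lam B f (trunc e F u) - constrainedRHS e lam B f (trunc e F v)‖
        ≤ c * ‖u - v‖ := by
  obtain ⟨L, hL0, hL⟩ := exists_norm_specOp_trunc_le e lam F
  have hC := hB.nonneg
  have hK : (0 : ℝ) ≤ K := K.2
  refine ⟨L + (C * L * L + C * L * L) + (L ^ 2 + 2 * L) + K, by positivity, fun u v hu hv => ?_⟩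
  have hp : trunc e F u ∈ specDom e lam := trunc_mem_specDom F u
  have hq : trunc e F v ∈ specDom e lam := trunc_mem_specDom F v
  have hpq : trunc e F (u - v) = trunc e F u - trunc e F v := map_sub _ _ _
  set p := trunc e F u with hp_def
  set q := trunc e F v with hq_def
  set d := ‖u - v‖
  have hd0 : 0 ≤ d := norm_nonneg _
  have hAp : ‖specOp e lam p‖ ≤ L := (hL u).trans (mul_le_of_le_one_right hL0 hu)
  have hAq : ‖specOp e lam q‖ ≤ L := (hL v).trans (mul_le_of_le_one_right hL0 hv)
  have hAd : ‖specOp e lam (p - q)‖ ≤ L * d := by rw [← hpq]; exact hL _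
  have hd : ‖p - q‖ ≤ d := by rw [← hpq]; exact norm_trunc_le e F _
  have hq1 : ‖q‖ ≤ 1 := (norm_trunc_le e F v).trans hv
  have hs : ∀ {x}, x ∈ specDom e lam → √⟪specOp e lam x, x⟫_ℝ ≤ ‖specOp e lam x‖ := fun hx =>
    (Real.sqrt_le_left (norm_nonneg _)).2 (energy_le_norm_sq hB.one_le hx)
  have hdecomp : constrainedRHS e lam B f p - constrainedRHS e lam B f q =
      -specOp e lam (p - q) - (B (p - q) p + B q (p - q)) + (⟪specOp e lam p, p⟫_ℝ • (p - q)
        + ⟪specOp e lam p + specOp e lam q, p - q⟫_ℝ • q) + (f p - f q) := by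
    rw [specOp_sub hp hq, hB.sub_left hp hq hp, hB.sub_right hq hp hq,
      ← energy_sub hp hq, constrainedRHS, constrainedRHS]
    module
  have h1 : ‖B (p - q) p‖ ≤ C * L * L * d := by
    refine (hB.norm_le (sub_mem hp hq) hp).trans ?_
    calc _ ≤ C * (L * d) * L := by gcongr; exact (hs hp).trans hAp
      _ = _ := by ring
  have h2 : ‖B q (p - q)‖ ≤ C * L * L * d := by
    refine (hB.norm_le hq (sub_mem hp hq)).trans ?_
    calc _ ≤ C * L * (L * d) := by gcongr; exact (hs (sub_mem hp hq)).trans hAd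
      _ = _ := by ring
  have h3 : ‖⟪specOp e lam p, p⟫_ℝ • (p - q)‖ ≤ L ^ 2 * d := by
    rw [norm_smul, Real.norm_of_nonneg (energy_nonneg hB.one_le hp)]
    gcongr
    exact (energy_le_norm_sq hB.one_le hp).trans (by gcongr)
  have h4 : ‖⟪specOp e lam p + specOp e lam q, p - q⟫_ℝ • q‖ ≤ 2 * L * d := by
    rw [norm_smul]
    calc _ ≤ ((L + L) * d) * 1 := by
          refine mul_le_mul ?_ hq1 (norm_nonneg _) (by positivity)
          refine (norm_inner_le_norm _ _).trans ?_
          gcongr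
          exact (norm_add_le _ _).trans (add_le_add hAp hAq)
      _ = _ := by ring
  have h5 : ‖f p - f q‖ ≤ K * d := (hf.norm_sub_le p q).trans (by gcongr)
  rw [hdecomp]
  refine (norm_add_le _ _).trans ?_
  have e1 := norm_add_le (-specOp e lam (p - q) - (B (p - q) p + B q (p - q)))
    (⟪specOp e lam p, p⟫_ℝ • (p - q) + ⟪specOp e lam p + specOp e lam q, p - q⟫_ℝ • q)
  have e2 := norm_sub_le (-specOp e lam (p - q)) (B (p - q) p + B q (p - q))
  have e3 := norm_add_le (B (p - q) p) (B q (p - q))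
  have e4 := norm_add_le (⟪specOp e lam p, p⟫_ℝ • (p - q))
    (⟪specOp e lam p + specOp e lam q, p - q⟫_ℝ • q)
  rw [norm_neg] at e2
  linarith

/-- The multiplier `|∇u|²` is exactly the one that cancels the radial part of `-A u` on the unit
sphere. -/
theorem inner_constrainedRHS_self (hB : IsConvection e lam B C) {u : E}
    (hu : u ∈ specDom e lam) :
    ⟪u, constrainedRHS e lam B f u⟫_ℝ
      = ⟪specOp e lam u, u⟫_ℝ * (‖u‖ ^ 2 - 1) + ⟪f u, u⟫_ℝ := by
  rw [constrainedRHS, inner_add_right, inner_add_right, inner_sub_right, inner_neg_right,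
    inner_smul_right, real_inner_self_eq_norm_sq, real_inner_comm, real_inner_comm (B u u),
    hB.inner_self hu hu, real_inner_comm (f u)]
  ring

/-- Compare `f u` with `f` at the radial projection of `u` to the sphere, at distance `1 - ‖u‖`,
where tangency kills the pairing. The sphere is shown to be invariant by a Grönwall argument, so
control off the sphere is needed. -/
theorem abs_inner_self_le_of_tangent (hf : LipschitzWith K f)
    (hfM : ∀ u, ‖u‖ = 1 → ⟪f u, u⟫_ℝ = 0) {u : E} (hu : ‖u‖ ≤ 1) :
    |⟪f u, u⟫_ℝ| ≤ K * (1 - ‖u‖ ^ 2) := by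
  have hK : (0 : ℝ) ≤ K := K.2
  rcases eq_or_ne u 0 with rfl | h0
  · simp
  have hn : 0 < ‖u‖ := norm_pos_iff.2 h0
  set v := ‖u‖⁻¹ • u with hv
  have hv1 : ‖v‖ = 1 := by rw [hv, norm_smul, norm_inv, norm_norm, inv_mul_cancel₀ hn.ne']
  have huv : u = ‖u‖ • v := by rw [hv, smul_smul, mul_inv_cancel₀ hn.ne', one_smul]
  have h1 : ⟪f v, u⟫_ℝ = 0 := by rw [huv, inner_smul_right, hfM v hv1, mul_zero]
  have h2 : ‖u - v‖ = 1 - ‖u‖ := by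
    have : u - v = (‖u‖ - 1) • v := by rw [sub_smul, ← huv, one_smul]
    rw [this, norm_smul, hv1, mul_one, Real.norm_eq_abs, abs_sub_comm, abs_of_nonneg (by linarith)]
  have h3 : ⟪f u, u⟫_ℝ = ⟪f u - f v, u⟫_ℝ := by rw [inner_sub_left, h1, sub_zero]
  rw [h3]
  refine (abs_real_inner_le_norm _ _).trans ?_
  have h4 := hf.norm_sub_le u v
  rw [h2] at h4
  have h5 : 0 ≤ (1 - ‖u‖) := by linarith
  calc _ ≤ K * (1 - ‖u‖) * ‖u‖ := by gcongr
    _ ≤ K * (1 - ‖u‖ ^ 2) := by rw [mul_assoc]; gcongr; nlinarith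

end IsConvection

/-- `u` solves the Galerkin system with modes in `F` on `[0, T]` and stays on the unit sphere. -/
structure IsGalerkin (e : HilbertBasis ι ℝ E) (lam : ι → ℝ) (B : E → E → E) (f : E → E)
    (F : Finset ι) (T : ℝ) (u : ℝ → E) : Prop where
  hasDerivAt : ∀ t ∈ Icc 0 T, HasDerivAt u (trunc e F (constrainedRHS e lam B f (u t))) t
  norm_eq : ∀ t ∈ Icc 0 T, ‖u t‖ = 1
  coord_eq : ∀ t ∈ Icc 0 T, ∀ k ∉ F, ⟪e k, u t⟫_ℝ = 0

namespace IsConvection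

/-- The Galerkin system has a solution on the unit sphere. -/
theorem exists_galerkin [CompleteSpace E] (hB : IsConvection e lam B C) (hf : LipschitzWith K f)
    (hfM : ∀ u, ‖u‖ = 1 → ⟪f u, u⟫_ℝ = 0) (F : Finset ι) {v₀ : E} (hv₀ : ‖v₀‖ = 1)
    (hv₀F : ∀ k ∉ F, ⟪e k, v₀⟫_ℝ = 0) {T : ℝ} (hT : 0 ≤ T) :
    ∃ u : ℝ → E, u 0 = v₀ ∧ IsGalerkin e lam B f F T u := by
  obtain ⟨c, hc0, hc⟩ := hB.exists_norm_constrainedRHS_trunc_sub_le hf F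
  -- The retraction makes the field bounded and globally Lipschitz, so Picard–Lindelöf covers the
  -- whole interval at once. It is the identity along the solution, which turns out to stay on the
  -- unit sphere.
  set X : E → E := fun u => trunc e F (constrainedRHS e lam B f (trunc e F (retract u))) with hX
  have hXlip : LipschitzWith (2 * c).toNNReal X := by
    refine LipschitzWith.of_dist_le_mul fun u v => ?_
    rw [dist_eq_norm, dist_eq_norm, Real.coe_toNNReal _ (by positivity)]
    simp only [hX]
    rw [← map_sub]
    refine (norm_trunc_le e F _).trans ((hc _ _ (norm_retract_le u) (norm_retract_le v)).trans ?_)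
    nlinarith [norm_retract_sub_le u v]
  set N : ℝ := ‖constrainedRHS e lam B f (trunc e F 0)‖ + c with hN
  have hN0 : 0 ≤ N := by positivity
  have hXbdd : ∀ u, ‖X u‖ ≤ N := by
    intro u
    refine (norm_trunc_le e F _).trans ?_
    have h1 := hc (retract u) 0 (norm_retract_le u) (by simp)
    rw [sub_zero] at h1
    have h2 := norm_le_norm_add_norm_sub' (constrainedRHS e lam B f (trunc e F (retract u)))
      (constrainedRHS e lam B f (trunc e F 0))
    nlinarith [norm_retract_le u]
  -- The interval is enlarged on both sides so that derivatives at `0` and `T` are two-sided.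
  have h0mem : (0 : ℝ) ∈ Icc (-1) (T + 1) := ⟨by norm_num, by linarith⟩
  have hPL : IsPicardLindelof (fun _ => X) (⟨0, h0mem⟩ : Icc (-1) (T + 1)) v₀
      (N * (T + 1)).toNNReal 0 N.toNNReal (2 * c).toNNReal := by
    refine ⟨fun t _ => hXlip.lipschitzOnWith, fun x _ => continuousOn_const, fun t _ x _ => ?_, ?_⟩
    · rw [Real.coe_toNNReal _ hN0]; exact hXbdd x
    · rw [Real.coe_toNNReal _ hN0, Real.coe_toNNReal _ (by positivity)]
      simp only [sub_zero, NNReal.coe_zero, zero_sub, neg_neg]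
      rw [max_eq_left (by linarith)]
  obtain ⟨u, hu0, hu⟩ := hPL.exists_eq_forall_mem_Icc_hasDerivWithinAt₀
  have hud : ∀ t ∈ Icc 0 T, HasDerivAt u (X (u t)) t := fun t ht =>
    (hu t ⟨by linarith [ht.1], by linarith [ht.2]⟩).hasDerivAt
      (Icc_mem_nhds (by linarith [ht.1]) (by linarith [ht.2]))
  have hcont : ContinuousOn u (Icc 0 T) := fun t ht => (hud t ht).continuousAt.continuousWithinAt
  have hcoord : ∀ t ∈ Icc 0 T, ∀ k ∉ F, ⟪e k, u t⟫_ℝ = 0 := by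
    intro t ht k hk
    have hd : ∀ s ∈ Icc 0 T, HasDerivAt (fun s => ⟪e k, u s⟫_ℝ) 0 s := by
      intro s hs
      have := (hasDerivAt_const s (e k)).inner ℝ (hud s hs)
      simpa [hX, coord_trunc_of_notMem _ hk] using this
    rw [constant_of_has_deriv_right_zero (f := fun s => ⟪e k, u s⟫_ℝ)
      (fun s hs => (hd s hs).continuousAt.continuousWithinAt)
      (fun s hs => (hd s (Ico_subset_Icc_self hs)).hasDerivWithinAt) t ht]
    change ⟪e k, u 0⟫_ℝ = 0
    rw [show u 0 = v₀ from hu0, hv₀F k hk]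
  obtain ⟨L, hL0, hL⟩ := exists_norm_specOp_trunc_le e lam F
  have hK : (0 : ℝ) ≤ K := K.2
  -- `‖u‖ ^ 2 - 1` starts at zero and its derivative is bounded by a multiple of itself, so it
  -- vanishes identically. Inside the ball this is the tangency estimate; outside, the retraction
  -- makes the field orthogonal to `u`.
  have hgrow : ∀ t ∈ Icc 0 T, |2 * ⟪u t, X (u t)⟫_ℝ| ≤ 2 * (L ^ 2 + K) * |‖u t‖ ^ 2 - 1| := by
    intro t ht
    set x := u t with hx
    have hPx : trunc e F x = x := trunc_eq_self (hcoord t ht)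
    have hPr : trunc e F (retract x) = retract x := by rw [retract, map_smul, hPx]
    have hxX : ⟪x, X x⟫_ℝ = ⟪x, constrainedRHS e lam B f (retract x)⟫_ℝ := by
      simp only [hX]
      rw [← trunc_symm, hPx, hPr]
    rcases le_total ‖x‖ 1 with h | h
    · have hxD : x ∈ specDom e lam := hPx ▸ trunc_mem_specDom F x
      rw [hxX, retract_of_norm_le h, hB.inner_constrainedRHS_self hxD]
      have h1 : ⟪specOp e lam x, x⟫_ℝ ≤ L ^ 2 := by
        refine (energy_le_norm_sq hB.one_le hxD).trans ?_
        have := hL x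
        rw [hPx] at this
        gcongr
        exact this.trans (mul_le_of_le_one_right hL0 h)
      have h2 := energy_nonneg hB.one_le hxD
      have h3 := abs_inner_self_le_of_tangent hf hfM h
      have h4 : ‖x‖ ^ 2 - 1 ≤ 0 := by nlinarith [norm_nonneg x]
      rw [abs_of_nonpos h4, abs_mul, abs_two]
      have h5 : |⟪specOp e lam x, x⟫_ℝ * (‖x‖ ^ 2 - 1)| ≤ L ^ 2 * -(‖x‖ ^ 2 - 1) := by
        rw [abs_mul, abs_of_nonneg h2, abs_of_nonpos h4]
        exact mul_le_mul_of_nonneg_right h1 (by linarith)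
      have h6 := abs_add_le (⟪specOp e lam x, x⟫_ℝ * (‖x‖ ^ 2 - 1)) ⟪f x, x⟫_ℝ
      nlinarith
    · have hr : retract x = ‖x‖⁻¹ • x := by rw [retract, max_eq_right h]
      have hx0 : 0 < ‖x‖ := by linarith
      have hr1 : ‖retract x‖ = 1 := by
        rw [hr, norm_smul, norm_inv, norm_norm, inv_mul_cancel₀ hx0.ne']
      have hxr : x = ‖x‖ • retract x := by rw [hr, smul_smul, mul_inv_cancel₀ hx0.ne', one_smul]
      have hrD : retract x ∈ specDom e lam := hPr ▸ trunc_mem_specDom F _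
      have h0 : ⟪x, X x⟫_ℝ = 0 := by
        rw [hxX]
        nth_rw 1 [hxr]
        rw [inner_smul_left, hB.inner_constrainedRHS_self hrD, hr1, hfM _ hr1]
        simp
      rw [h0]
      simp only [mul_zero, abs_zero]
      positivity
  have hnorm : ∀ t ∈ Icc 0 T, ‖u t‖ = 1 := by
    have hz := eq_zero_of_abs_deriv_le_mul_abs_self_of_eq_zero_right
      (f := fun t => ‖u t‖ ^ 2 - 1) (f' := fun t => 2 * ⟪u t, X (u t)⟫_ℝ)
      (K := 2 * (L ^ 2 + K)) (a := 0) (b := T) ((hcont.norm.pow 2).sub continuousOn_const)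
      (fun t ht => ((hud t (Ico_subset_Icc_self ht)).norm_sq.sub_const 1).hasDerivWithinAt)
      (by
        change ‖u 0‖ ^ 2 - 1 = 0
        rw [show u 0 = v₀ from hu0, hv₀]; norm_num)
      (fun t ht => hgrow t (Ico_subset_Icc_self ht))
    intro t ht
    have := hz t ht
    have h1 : ‖u t‖ ^ 2 = 1 := by simpa [sub_eq_zero] using this
    exact (pow_eq_one_iff_of_nonneg (norm_nonneg _) two_ne_zero).1 h1
  refine ⟨u, hu0, fun t ht => ?_, hnorm, hcoord⟩
  have := hud t ht
  simp only [hX] at this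
  rwa [retract_of_norm_le (hnorm t ht).le, trunc_eq_self (hcoord t ht)] at this

end IsConvection

end Galerkin

/-! ### Estimates for Galerkin approximations -/

section Estimates

variable {ι E : Type*} [NormedAddCommGroup E] [InnerProductSpace ℝ E]

/-- The diagonal operator restricted to finitely many modes. -/
def truncOp (e : HilbertBasis ι ℝ E) (lam : ι → ℝ) (F : Finset ι) : E →L[ℝ] E :=
  ∑ k ∈ F, lam k • (innerSL ℝ (e k)).smulRight (e k)

variable {e : HilbertBasis ι ℝ E} {lam : ι → ℝ} {B : E → E → E} {C : ℝ} {f : E → E} {K : ℝ≥0}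

theorem truncOp_apply (F : Finset ι) (u : E) :
    truncOp e lam F u = ∑ k ∈ F, (lam k * ⟪e k, u⟫_ℝ) • e k := by
  simp [truncOp, smul_smul]

theorem truncOp_symm (F : Finset ι) (u v : E) :
    ⟪truncOp e lam F u, v⟫_ℝ = ⟪u, truncOp e lam F v⟫_ℝ := by
  simp only [truncOp_apply, sum_inner, inner_sum, inner_smul_left, inner_smul_right,
    RCLike.conj_to_real]
  refine Finset.sum_congr rfl fun k _ => ?_
  rw [real_inner_comm (e k) u]
  ring

/-- Along finite-mode curves the unbounded operator agrees with a continuous linear map, so it may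
be composed with limits and derivatives. -/
theorem specOp_eq_truncOp {F : Finset ι} {u : E} (h : ∀ k ∉ F, ⟪e k, u⟫_ℝ = 0) :
    specOp e lam u = truncOp e lam F u := by
  classical
  refine ext_coord e fun k => ?_
  rw [coord_specOp (mem_specDom_of_finite h), truncOp_apply]
  simp only [inner_sum, inner_smul_right, inner_basis_basis, mul_ite, mul_one, mul_zero,
    Finset.sum_ite_eq]
  split_ifs with hk
  · rfl
  · rw [h k hk, mul_zero]

theorem trunc_specOp {F : Finset ι} {u : E} (h : ∀ k ∉ F, ⟪e k, u⟫_ℝ = 0) :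
    trunc e F (specOp e lam u) = specOp e lam u := by
  refine trunc_eq_self fun k hk => ?_
  rw [coord_specOp (mem_specDom_of_finite h), h k hk, mul_zero]

theorem inner_trunc_eq (F : Finset ι) (w z : E) :
    ⟪w, trunc e F z⟫_ℝ = ⟪w, z⟫_ℝ - ⟪w - trunc e F w, z⟫_ℝ := by
  rw [inner_sub_left, trunc_symm]
  ring

theorem _root_.LipschitzWith.norm_le_of_norm_eq_one {E : Type*} [NormedAddCommGroup E]
    {f : E → E} {K : ℝ≥0} (hf : LipschitzWith K f) {u : E} (hu : ‖u‖ = 1) : ‖f u‖ ≤ ‖f 0‖ + K := by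
  have h := hf.norm_sub_le u 0
  rw [sub_zero, hu, mul_one] at h
  linarith [norm_le_norm_add_norm_sub' (f u) (f 0)]

/-- Let `q = A u - y u`. On the unit sphere `‖q‖² = ‖A u‖² - y²`, the convection term is orthogonal
to `A u`, and tangency replaces `A u` by `q` in the pairing with `f u`. Young's inequality then
spends half of the dissipation `2‖q‖²`. -/
theorem IsConvection.inner_specOp_constrainedRHS_le (hB : IsConvection e lam B C)
    (hfM : ∀ u, ‖u‖ = 1 → ⟪f u, u⟫_ℝ = 0) {F : Finset ι} {u : E}
    (h : ∀ k ∉ F, ⟪e k, u⟫_ℝ = 0) (hu1 : ‖u‖ = 1) :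
    2 * ⟪specOp e lam u, constrainedRHS e lam B f u⟫_ℝ ≤
      ⟪specOp e lam u, u⟫_ℝ ^ 2 - ‖specOp e lam u‖ ^ 2 + ‖f u‖ ^ 2 := by
  set y := ⟪specOp e lam u, u⟫_ℝ with hy
  have h1 : ⟪specOp e lam u, constrainedRHS e lam B f u⟫_ℝ
      = -‖specOp e lam u‖ ^ 2 + y ^ 2 + ⟪specOp e lam u, f u⟫_ℝ := by
    rw [constrainedRHS, inner_add_right, inner_add_right, inner_sub_right, inner_neg_right,
      inner_smul_right, real_inner_self_eq_norm_sq, real_inner_comm (B u u), hB.inner_specOp h]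
    ring
  have h2 : ‖specOp e lam u - y • u‖ ^ 2 = ‖specOp e lam u‖ ^ 2 - y ^ 2 := by
    rw [norm_sub_sq_real, inner_smul_right, norm_smul, hu1, mul_one, Real.norm_eq_abs, sq_abs,
      ← hy]
    ring
  have h3 : ⟪specOp e lam u, f u⟫_ℝ = ⟪specOp e lam u - y • u, f u⟫_ℝ := by
    rw [inner_sub_left, inner_smul_left, real_inner_comm (f u) u, hfM u hu1]
    simp
  have h4 := real_inner_le_norm (specOp e lam u - y • u) (f u)
  rw [h1, h3]
  nlinarith [sq_nonneg (‖specOp e lam u - y • u‖ - ‖f u‖)]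

theorem energy_sq_le {u : E} (hu1 : ‖u‖ = 1) :
    ⟪specOp e lam u, u⟫_ℝ ^ 2 ≤ ‖specOp e lam u‖ ^ 2 := by
  have h := abs_real_inner_le_norm (specOp e lam u) u
  rw [hu1, mul_one] at h
  rw [← sq_abs]
  gcongr

namespace IsGalerkin

variable {F : Finset ι} {T : ℝ} {u : ℝ → E}

theorem continuousOn (hu : IsGalerkin e lam B f F T u) : ContinuousOn u (Icc 0 T) :=
  fun t ht => (hu.hasDerivAt t ht).continuousAt.continuousWithinAt

theorem mem_specDom (hu : IsGalerkin e lam B f F T u) {t : ℝ} (ht : t ∈ Icc 0 T) :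
    u t ∈ specDom e lam :=
  mem_specDom_of_finite (hu.coord_eq t ht)

theorem continuousOn_specOp (hu : IsGalerkin e lam B f F T u) :
    ContinuousOn (fun t => specOp e lam (u t)) (Icc 0 T) :=
  ((truncOp e lam F).continuous.comp_continuousOn hu.continuousOn).congr fun t ht =>
    specOp_eq_truncOp (hu.coord_eq t ht)

/-- Continuity of `B` is not part of `IsConvection`; it comes from the Lipschitz bound on finitely
many modes. -/
theorem continuousOn_rhs (hu : IsGalerkin e lam B f F T u) (hB : IsConvection e lam B C)
    (hf : LipschitzWith K f) :
    ContinuousOn (fun t => constrainedRHS e lam B f (u t)) (Icc 0 T) := by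
  obtain ⟨c, hc0, hc⟩ := hB.exists_norm_constrainedRHS_trunc_sub_le hf F
  have hlip : LipschitzOnWith c.toNNReal
      (fun x => constrainedRHS e lam B f (trunc e F x)) (Metric.closedBall 0 1) := by
    refine LipschitzOnWith.of_dist_le_mul fun x hx y hy => ?_
    rw [dist_eq_norm, dist_eq_norm, Real.coe_toNNReal _ hc0]
    exact hc x y (by simpa using hx) (by simpa using hy)
  refine (hlip.continuousOn.comp hu.continuousOn fun t ht => ?_).congr fun t ht => ?_
  · simp [hu.norm_eq t ht]
  · simp only [Function.comp]
    rw [trunc_eq_self (hu.coord_eq t ht)]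

theorem intervalIntegrable_of_continuousOn {X : Type*} [NormedAddCommGroup X] {h : ℝ → X}
    {t : ℝ} (hh : ContinuousOn h (Icc 0 T)) (ht : t ∈ Icc 0 T) :
    IntervalIntegrable h volume 0 t := by
  refine ContinuousOn.intervalIntegrable (hh.mono ?_)
  rw [uIcc_of_le ht.1]
  exact Icc_subset_Icc_right ht.2

theorem eq_add_integral [CompleteSpace E] (hu : IsGalerkin e lam B f F T u)
    (hB : IsConvection e lam B C)
    (hf : LipschitzWith K f) {t : ℝ} (ht : t ∈ Icc 0 T) :
    u t = u 0 + ∫ s in (0 : ℝ)..t, trunc e F (constrainedRHS e lam B f (u s)) := by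
  rw [intervalIntegral.integral_eq_sub_of_hasDerivAt (f := u)]
  · abel
  · intro s hs
    rw [uIcc_of_le ht.1] at hs
    exact hu.hasDerivAt s ⟨hs.1, hs.2.trans ht.2⟩
  · exact intervalIntegrable_of_continuousOn
      ((trunc e F).continuous.comp_continuousOn (hu.continuousOn_rhs hB hf)) ht

theorem energy_add_integral_le (hu : IsGalerkin e lam B f F T u) (hB : IsConvection e lam B C)
    (hf : LipschitzWith K f) (hfM : ∀ u, ‖u‖ = 1 → ⟪f u, u⟫_ℝ = 0) {t : ℝ}
    (ht : t ∈ Icc 0 T) :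
    ⟪specOp e lam (u t), u t⟫_ℝ
      + ∫ s in (0 : ℝ)..t, (‖specOp e lam (u s)‖ ^ 2 - ⟪specOp e lam (u s), u s⟫_ℝ ^ 2)
      ≤ ⟪specOp e lam (u 0), u 0⟫_ℝ + (‖f 0‖ + K) ^ 2 * t := by
  set Φ : ℝ → ℝ := fun t => ⟪truncOp e lam F (u t), u t⟫_ℝ with hΦ
  have h0 : (0 : ℝ) ∈ Icc 0 T := ⟨le_rfl, ht.1.trans ht.2⟩
  have hΦe : ∀ s ∈ Icc 0 T, ⟪specOp e lam (u s), u s⟫_ℝ = Φ s := fun s hs => by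
    rw [specOp_eq_truncOp (hu.coord_eq s hs)]
  have hd : ∀ s ∈ Icc 0 T, HasDerivAt Φ
      (2 * ⟪specOp e lam (u s), constrainedRHS e lam B f (u s)⟫_ℝ) s := by
    intro s hs
    have h1 := hu.hasDerivAt s hs
    have h2 := ((truncOp e lam F).hasFDerivAt.comp_hasDerivAt s h1).inner ℝ h1
    have e1 : ⟪truncOp e lam F (u s), trunc e F (constrainedRHS e lam B f (u s))⟫_ℝ
        = ⟪specOp e lam (u s), constrainedRHS e lam B f (u s)⟫_ℝ := by
      rw [← specOp_eq_truncOp (hu.coord_eq s hs), ← trunc_symm, trunc_specOp (hu.coord_eq s hs)]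
    have e2 : ⟪truncOp e lam F (trunc e F (constrainedRHS e lam B f (u s))), u s⟫_ℝ
        = ⟪specOp e lam (u s), constrainedRHS e lam B f (u s)⟫_ℝ := by
      rw [truncOp_symm, real_inner_comm, e1]
    refine h2.congr_deriv ?_
    rw [two_mul]
    exact congrArg₂ (· + ·) e1 e2
  have hcA := hu.continuousOn_specOp
  have hcN := hu.continuousOn_rhs hB hf
  have hsub : ∀ s ∈ uIcc 0 t, s ∈ Icc 0 T := fun s hs => by
    rw [uIcc_of_le ht.1] at hs
    exact ⟨hs.1, hs.2.trans ht.2⟩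
  have hi : IntervalIntegrable
      (fun s => 2 * ⟪specOp e lam (u s), constrainedRHS e lam B f (u s)⟫_ℝ) volume 0 t :=
    intervalIntegrable_of_continuousOn (continuousOn_const.mul (hcA.inner hcN)) ht
  have hFTC := intervalIntegral.integral_eq_sub_of_hasDerivAt
    (fun s hs => hd s (hsub s hs)) hi
  have hj : IntervalIntegrable (fun s => ‖specOp e lam (u s)‖ ^ 2
      - ⟪specOp e lam (u s), u s⟫_ℝ ^ 2) volume 0 t :=
    intervalIntegrable_of_continuousOn
      ((hcA.norm.pow 2).sub ((hcA.inner hu.continuousOn).pow 2)) ht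
  have hle : ∫ s in (0 : ℝ)..t, (2 * ⟪specOp e lam (u s), constrainedRHS e lam B f (u s)⟫_ℝ
      + (‖specOp e lam (u s)‖ ^ 2 - ⟪specOp e lam (u s), u s⟫_ℝ ^ 2))
      ≤ ∫ s in (0 : ℝ)..t, (‖f 0‖ + K) ^ 2 := by
    refine intervalIntegral.integral_mono_on ht.1 (hi.add hj) intervalIntegrable_const
      fun s hs => ?_
    have hs' : s ∈ Icc 0 T := ⟨hs.1, hs.2.trans ht.2⟩
    have h1 := hB.inner_specOp_constrainedRHS_le hfM (hu.coord_eq s hs') (hu.norm_eq s hs')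
    have h2 : ‖f (u s)‖ ^ 2 ≤ (‖f 0‖ + K) ^ 2 := by
      gcongr
      exact hf.norm_le_of_norm_eq_one (hu.norm_eq s hs')
    linarith
  rw [intervalIntegral.integral_add hi hj, hFTC, intervalIntegral.integral_const] at hle
  rw [hΦe t ht, hΦe 0 h0]
  simp only [sub_zero, smul_eq_mul] at hle
  linarith

/-- The dissipated quantity is nonnegative by Cauchy–Schwarz on the unit sphere, so the energy grows
at most linearly in time, uniformly in the modes used. -/
theorem energy_le (hu : IsGalerkin e lam B f F T u) (hB : IsConvection e lam B C)
    (hf : LipschitzWith K f) (hfM : ∀ u, ‖u‖ = 1 → ⟪f u, u⟫_ℝ = 0) {t : ℝ}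
    (ht : t ∈ Icc 0 T) :
    ⟪specOp e lam (u t), u t⟫_ℝ ≤ ⟪specOp e lam (u 0), u 0⟫_ℝ + (‖f 0‖ + K) ^ 2 * T := by
  have h1 := hu.energy_add_integral_le hB hf hfM ht
  have h2 : 0 ≤ ∫ s in (0 : ℝ)..t,
      (‖specOp e lam (u s)‖ ^ 2 - ⟪specOp e lam (u s), u s⟫_ℝ ^ 2) :=
    intervalIntegral.integral_nonneg ht.1 fun s hs =>
      sub_nonneg.2 (energy_sq_le (hu.norm_eq s ⟨hs.1, hs.2.trans ht.2⟩))
  have h3 : (‖f 0‖ + K) ^ 2 * t ≤ (‖f 0‖ + K) ^ 2 * T := by gcongr; exact ht.2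
  linarith

theorem integral_norm_specOp_sq_le (hu : IsGalerkin e lam B f F T u)
    (hB : IsConvection e lam B C) (hf : LipschitzWith K f)
    (hfM : ∀ u, ‖u‖ = 1 → ⟪f u, u⟫_ℝ = 0) (hT : 0 ≤ T) {Y : ℝ}
    (hY : ⟪specOp e lam (u 0), u 0⟫_ℝ + (‖f 0‖ + K) ^ 2 * T ≤ Y) :
    ∫ s in (0 : ℝ)..T, ‖specOp e lam (u s)‖ ^ 2 ≤ Y + T * Y ^ 2 := by
  have hTm : T ∈ Icc 0 T := ⟨hT, le_rfl⟩
  have h1 := hu.energy_add_integral_le hB hf hfM hTm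
  have h2 := energy_nonneg hB.one_le (hu.mem_specDom hTm)
  have hcA := hu.continuousOn_specOp
  have hi1 : IntervalIntegrable (fun s => ‖specOp e lam (u s)‖ ^ 2) volume 0 T :=
    intervalIntegrable_of_continuousOn (hcA.norm.pow 2) hTm
  have hi2 : IntervalIntegrable (fun s => ⟪specOp e lam (u s), u s⟫_ℝ ^ 2) volume 0 T :=
    intervalIntegrable_of_continuousOn ((hcA.inner hu.continuousOn).pow 2) hTm
  rw [intervalIntegral.integral_sub hi1 hi2] at h1
  -- The dissipation controls only `‖A u‖² - |∇u|⁴`; the subtracted quartic is restored from the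
  -- energy bound `Y`.
  have h3 : ∫ s in (0 : ℝ)..T, ⟪specOp e lam (u s), u s⟫_ℝ ^ 2 ≤ ∫ s in (0 : ℝ)..T, Y ^ 2 := by
    refine intervalIntegral.integral_mono_on hT hi2 intervalIntegrable_const fun s hs => ?_
    gcongr
    · exact energy_nonneg hB.one_le (hu.mem_specDom hs)
    · exact (hu.energy_le hB hf hfM hs).trans hY
  rw [intervalIntegral.integral_const, sub_zero, smul_eq_mul] at h3
  linarith

/-- The error made by projecting the right-hand side. As `u t` has modes in `F` only, the tail of `u
t - v` is minus that of `v`, of size `√Y / r`, and it is orthogonal to `u t` and `A (u t)`. Only `f`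
and `B` see it. -/
theorem abs_inner_tail_le (hu : IsGalerkin e lam B f F T u) (hB : IsConvection e lam B C)
    (hf : LipschitzWith K f) {t : ℝ} (ht : t ∈ Icc 0 T) {Y r : ℝ} (hr : 0 < r)
    (hY : ⟪specOp e lam (u t), u t⟫_ℝ ≤ Y) (hF : ∀ k ∉ F, r ^ 2 ≤ lam k) {v : E}
    (hv : v ∈ specDom e lam) (hvY : ⟪specOp e lam v, v⟫_ℝ ≤ Y) :
    |⟪(u t - v) - trunc e F (u t - v), constrainedRHS e lam B f (u t)⟫_ℝ| ≤
      r⁻¹ * (√Y * (C * √Y + ‖f 0‖ + K)) * (1 + ‖specOp e lam (u t)‖ ^ 2) := by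
  set x := u t with hx
  have hxF := hu.coord_eq t ht
  have hPx : trunc e F x = x := trunc_eq_self hxF
  set q := v - trunc e F v with hq
  have h1 : (x - v) - trunc e F (x - v) = -q := by rw [map_sub, hPx, hq]; abel
  have horth : ∀ z, trunc e F z = z → ⟪q, z⟫_ℝ = 0 := by
    intro z hz
    rw [hq, inner_sub_left, trunc_symm, hz, sub_self]
  have h2 : ⟪q, constrainedRHS e lam B f x⟫_ℝ = ⟪q, f x - B x x⟫_ℝ := by
    have : constrainedRHS e lam B f x
        = (⟪specOp e lam x, x⟫_ℝ • x - specOp e lam x) + (f x - B x x) := by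
      rw [constrainedRHS]; abel
    rw [this, inner_add_right, inner_sub_right, inner_smul_right, horth _ hPx,
      horth _ (trunc_specOp hxF)]
    simp
  have hqn : ‖q‖ ≤ r⁻¹ * √Y := by
    rw [inv_mul_eq_div, le_div_iff₀ hr]
    refine Real.le_sqrt_of_sq_le ?_
    rw [mul_pow, mul_comm]
    exact (tail_norm_sq_le hB.one_le hv hF).trans hvY
  have hxD := hu.mem_specDom ht
  have hC := hB.nonneg
  have h3 : ‖f x - B x x‖ ≤ (C * √Y + ‖f 0‖ + K) * (1 + ‖specOp e lam x‖ ^ 2) := by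
    have e1 := hf.norm_le_of_norm_eq_one (hu.norm_eq t ht)
    have e2 : ‖B x x‖ ≤ C * ‖specOp e lam x‖ * √Y := by
      refine (hB.norm_le hxD hxD).trans ?_
      gcongr
    have e3 : ‖specOp e lam x‖ ≤ 1 + ‖specOp e lam x‖ ^ 2 := by
      nlinarith [sq_nonneg (‖specOp e lam x‖ - 1)]
    have e4 : C * ‖specOp e lam x‖ * √Y ≤ C * √Y * (1 + ‖specOp e lam x‖ ^ 2) := by
      calc _ = C * √Y * ‖specOp e lam x‖ := by ring
        _ ≤ _ := by gcongr
    have e5 : 0 ≤ (‖f 0‖ + K) * ‖specOp e lam x‖ ^ 2 := by positivity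
    have e6 := norm_sub_le (f x) (B x x)
    linarith
  rw [h1, inner_neg_left, abs_neg, h2]
  refine (abs_real_inner_le_norm _ _).trans ?_
  calc _ ≤ (r⁻¹ * √Y) * ((C * √Y + ‖f 0‖ + K) * (1 + ‖specOp e lam x‖ ^ 2)) := by gcongr
    _ = _ := by ring

/-- Galerkin approximations with many modes are close to each other. -/
theorem norm_sub_sq_le [CompleteSpace E] (hu : IsGalerkin e lam B f F T u)
    (hB : IsConvection e lam B C) (hf : LipschitzWith K f)
    {G : Finset ι} {v : ℝ → E} (hv : IsGalerkin e lam B f G T v) {Y Z r : ℝ} (hr : 0 < r)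
    (huY : ∀ t ∈ Icc 0 T, ⟪specOp e lam (u t), u t⟫_ℝ ≤ Y)
    (hvY : ∀ t ∈ Icc 0 T, ⟪specOp e lam (v t), v t⟫_ℝ ≤ Y)
    (huZ : ∫ s in (0 : ℝ)..T, ‖specOp e lam (u s)‖ ^ 2 ≤ Z)
    (hvZ : ∫ s in (0 : ℝ)..T, ‖specOp e lam (v s)‖ ^ 2 ≤ Z)
    (hF : ∀ k ∉ F, r ^ 2 ≤ lam k) (hG : ∀ k ∉ G, r ^ 2 ≤ lam k) {t : ℝ} (ht : t ∈ Icc 0 T) :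
    ‖u t - v t‖ ^ 2 ≤ (‖u 0 - v 0‖ ^ 2 + r⁻¹) *
      Real.exp ((C ^ 2 + 4 + 2 * K + 4 * (√Y * (C * √Y + ‖f 0‖ + K))) * (T + 2 * Z)) := by
  have hT : 0 ≤ T := ht.1.trans ht.2
  have hTm : T ∈ Icc 0 T := ⟨hT, le_rfl⟩
  have hC := hB.nonneg
  have hK : (0 : ℝ) ≤ K := K.2
  set D' := √Y * (C * √Y + ‖f 0‖ + K) with hD'
  have hD'0 : 0 ≤ D' := by positivity
  -- `C ^ 2 + 4 + 2 * K` is the constant of `inner_constrainedRHS_sub_le` for `R = 1`; `4 * D'` pays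
  -- for the two truncation errors.
  set D := C ^ 2 + 4 + 2 * K + 4 * D' with hD
  have hD0 : 0 ≤ D := by positivity
  set g : ℝ → ℝ := fun s => D * (1 + ‖specOp e lam (u s)‖ ^ 2 + ‖specOp e lam (v s)‖ ^ 2) with hg
  have hiu : IntervalIntegrable (fun s => ‖specOp e lam (u s)‖ ^ 2) volume 0 T :=
    intervalIntegrable_of_continuousOn (hu.continuousOn_specOp.norm.pow 2) hTm
  have hiv : IntervalIntegrable (fun s => ‖specOp e lam (v s)‖ ^ 2) volume 0 T :=
    intervalIntegrable_of_continuousOn (hv.continuousOn_specOp.norm.pow 2) hTm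
  have hgi : IntervalIntegrable g volume 0 T :=
    ((intervalIntegrable_const.add hiu).add hiv).const_mul D
  have hgint : ∫ s in (0 : ℝ)..T, g s ≤ D * (T + 2 * Z) := by
    simp only [hg]
    rw [intervalIntegral.integral_const_mul, intervalIntegral.integral_add
      (intervalIntegrable_const.add hiu) hiv, intervalIntegral.integral_add
      intervalIntegrable_const hiu, intervalIntegral.integral_const]
    refine mul_le_mul_of_nonneg_left ?_ hD0
    simp only [sub_zero, smul_eq_mul, mul_one]
    linarith
  have hru : ContinuousOn (fun s => trunc e F (constrainedRHS e lam B f (u s))) (Icc 0 T) :=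
    (trunc e F).continuous.comp_continuousOn (hu.continuousOn_rhs hB hf)
  have hrv : ContinuousOn (fun s => trunc e G (constrainedRHS e lam B f (v s))) (Icc 0 T) :=
    (trunc e G).continuous.comp_continuousOn (hv.continuousOn_rhs hB hf)
  have hr0 : 0 ≤ r⁻¹ := inv_nonneg.2 hr.le
  -- The truncation errors are `r⁻¹` times the same weight as the main term, so the shift `ε = r⁻¹`
  -- absorbs them.
  have hmain := norm_sq_add_le_mul_exp (T := T) (w := fun s => u s - v s)
    (w' := fun s => trunc e F (constrainedRHS e lam B f (u s))
      - trunc e G (constrainedRHS e lam B f (v s))) (g := g) (ε := r⁻¹) hr0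
    (intervalIntegrable_of_continuousOn (hru.sub hrv) hTm)
    (fun s hs => by
      rw [intervalIntegral.integral_sub (intervalIntegrable_of_continuousOn hru hs)
        (intervalIntegrable_of_continuousOn hrv hs)]
      nth_rw 1 [hu.eq_add_integral hB hf hs, hv.eq_add_integral hB hf hs]
      abel)
    hgi (fun s => by positivity)
    (Filter.Eventually.of_forall fun s hs => by
      have hs' : s ∈ Icc 0 T := Ioo_subset_Icc_self hs
      have huD := hu.mem_specDom hs'
      have hvD := hv.mem_specDom hs'
      have h1 := hB.inner_constrainedRHS_sub_le hf huD hvD (hv.norm_eq s hs').le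
      have h2 := hu.abs_inner_tail_le hB hf hs' hr (huY s hs') hF hvD (hvY s hs')
      have h3 := hv.abs_inner_tail_le hB hf hs' hr (hvY s hs') hG huD (huY s hs')
      rw [← neg_sub (u s) (v s), map_neg, sub_neg_eq_add, ← sub_eq_neg_add, ← neg_sub,
        inner_neg_left, abs_neg] at h3
      rw [← hD'] at h2 h3
      set a := ‖specOp e lam (u s)‖
      set b := ‖specOp e lam (v s)‖
      set w := u s - v s
      have h4 : ⟪w, trunc e F (constrainedRHS e lam B f (u s))
          - trunc e G (constrainedRHS e lam B f (v s))⟫_ℝ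
          = ⟪w, constrainedRHS e lam B f (u s) - constrainedRHS e lam B f (v s)⟫_ℝ
            - ⟪w - trunc e F w, constrainedRHS e lam B f (u s)⟫_ℝ
            + ⟪w - trunc e G w, constrainedRHS e lam B f (v s)⟫_ℝ := by
        rw [inner_sub_right w, inner_sub_right w, inner_trunc_eq, inner_trunc_eq]
        ring
      rw [h4]
      have h5 := neg_le_of_abs_le h2
      have h6 := le_of_abs_le h3
      have h7 : 0 ≤ r⁻¹ * D' * a ^ 2 := by positivity
      have h8 : 0 ≤ r⁻¹ * D' * b ^ 2 := by positivity
      have h9 : 0 ≤ (C ^ 2 + 4 + 2 * K) * (1 + a ^ 2 + b ^ 2) * r⁻¹ := by positivity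
      have h10 : 0 ≤ 4 * D' * (1 + a ^ 2 + b ^ 2) * ‖w‖ ^ 2 := by positivity
      simp only [hg, hD]
      nlinarith) ht
  refine le_trans (by linarith) (hmain.trans ?_)
  gcongr

end IsGalerkin

end Estimates

/-! ### Strong solutions and passage to the limit -/

/-! ### Integrability over the time interval. -/

section TimeMeasure

instance (T : ℝ) : IsFiniteMeasure (timeMeasure T) := by
  unfold timeMeasure
  infer_instance

theorem timeMeasure_eq_restrict_Ioc (T : ℝ) : timeMeasure T = volume.restrict (Ioc 0 T) :=
  Measure.restrict_congr_set Ioo_ae_eq_Ioc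

theorem ae_timeMeasure_iff {T : ℝ} {p : ℝ → Prop} :
    (∀ᵐ t ∂timeMeasure T, p t) ↔ ∀ᵐ t, t ∈ Ioo 0 T → p t :=
  ae_restrict_iff' measurableSet_Ioo

theorem ae_timeMeasure_of_Icc {T : ℝ} {p : ℝ → Prop} (h : ∀ t ∈ Icc 0 T, p t) :
    ∀ᵐ t ∂timeMeasure T, p t :=
  ae_timeMeasure_iff.2 (Filter.Eventually.of_forall fun t ht => h t (Ioo_subset_Icc_self ht))

theorem integral_timeMeasure {E : Type*} [NormedAddCommGroup E] [NormedSpace ℝ E] {T : ℝ}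
    (hT : 0 ≤ T) (h : ℝ → E) : ∫ t, h t ∂timeMeasure T = ∫ t in (0 : ℝ)..T, h t := by
  rw [timeMeasure_eq_restrict_Ioc, intervalIntegral.integral_of_le hT]

variable {E : Type*} [NormedAddCommGroup E]

theorem integrable_timeMeasure_iff {T : ℝ} (hT : 0 ≤ T) {h : ℝ → E} :
    Integrable h (timeMeasure T) ↔ IntervalIntegrable h volume 0 T := by
  rw [timeMeasure_eq_restrict_Ioc, intervalIntegrable_iff_integrableOn_Ioc_of_le hT]
  rfl

theorem intervalIntegrable_of_memLp {T : ℝ} (hT : 0 ≤ T) {h : ℝ → E}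
    (hh : MemLp h 2 (timeMeasure T)) : IntervalIntegrable h volume 0 T :=
  (integrable_timeMeasure_iff hT).1 (hh.integrable one_le_two)

theorem aestronglyMeasurable_of_continuousOn {T : ℝ} {h : ℝ → E}
    (hh : ContinuousOn h (Icc 0 T)) : AEStronglyMeasurable h (timeMeasure T) :=
  (hh.mono Ioo_subset_Icc_self).aestronglyMeasurable measurableSet_Ioo

theorem memLp_of_continuousOn {T : ℝ} {h : ℝ → E} (hh : ContinuousOn h (Icc 0 T)) (p : ℝ≥0∞) :
    MemLp h p (timeMeasure T) := by
  obtain ⟨c, hc⟩ := isCompact_Icc.exists_bound_of_continuousOn hh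
  exact MemLp.of_bound (aestronglyMeasurable_of_continuousOn hh) c (ae_timeMeasure_of_Icc hc)

end TimeMeasure

/-! ### Strong solutions: uniqueness, and limits of Galerkin approximations. -/

section Limit

variable {ι E : Type*} [NormedAddCommGroup E] [InnerProductSpace ℝ E]

/-- A Hilbert space valued function is strongly measurable if its coordinates are. -/
theorem aestronglyMeasurable_of_coord [Countable ι] (e : HilbertBasis ι ℝ E) {α : Type*}
    [MeasurableSpace α] {μ : Measure α} {h : α → E}
    (hh : ∀ k, AEStronglyMeasurable (fun t => ⟪e k, h t⟫_ℝ) μ) : AEStronglyMeasurable h μ := by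
  refine aestronglyMeasurable_of_tendsto_ae (u := Filter.atTop)
    (f := fun (S : Finset ι) t => ∑ k ∈ S, ⟪e k, h t⟫_ℝ • e k) (fun S => ?_)
    (Filter.Eventually.of_forall fun t => ?_)
  · exact Finset.aestronglyMeasurable_fun_sum _ fun k _ => (hh k).smul_const (e k)
  · have := e.hasSum_repr (h t)
    simp only [HilbertBasis.repr_apply_apply] at this
    exact this

variable {e : HilbertBasis ι ℝ E} {lam : ι → ℝ} {B : E → E → E} {C : ℝ} {f : E → E} {K : ℝ≥0}

/-- Strong solutions of the constrained equation on `[0, T]`. -/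
structure IsStrongSolution (e : HilbertBasis ι ℝ E) (lam : ι → ℝ) (B : E → E → E) (f : E → E)
    (T : ℝ) (u : ℝ → E) : Prop where
  mem_specDom : ∀ᵐ t ∂timeMeasure T, u t ∈ specDom e lam
  memLp_specOp : MemLp (fun t => specOp e lam (u t)) 2 (timeMeasure T)
  memLp_rhs : MemLp (fun t => constrainedRHS e lam B f (u t)) 2 (timeMeasure T)
  eq_add_integral : ∀ t ∈ Icc 0 T, u t = u 0 + ∫ s in (0 : ℝ)..t, constrainedRHS e lam B f (u s)

theorem IsStrongSolution.continuousOn [CompleteSpace E] {T : ℝ} {u : ℝ → E}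
    (hu : IsStrongSolution e lam B f T u) (hT : 0 ≤ T) : ContinuousOn u (Icc 0 T) := by
  have h1 := intervalIntegrable_of_memLp hT hu.memLp_rhs
  have h2 := intervalIntegral.continuousOn_primitive_interval'
    (a := 0) (b₁ := 0) (b₂ := T) h1 left_mem_uIcc
  rw [uIcc_of_le hT] at h2
  exact (continuousOn_const.add h2).congr hu.eq_add_integral

/-- Grönwall with `ε = 0`. The bound `R` on `v` comes from its continuity, so competing solutions
need not be known to stay on the sphere. -/
theorem IsStrongSolution.eqOn [CompleteSpace E] (hB : IsConvection e lam B C)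
    (hf : LipschitzWith K f) {T : ℝ} (hT : 0 ≤ T) {u v : ℝ → E}
    (hu : IsStrongSolution e lam B f T u) (hv : IsStrongSolution e lam B f T v)
    (h0 : u 0 = v 0) : EqOn u v (Icc 0 T) := by
  intro t ht
  obtain ⟨R, hR⟩ := isCompact_Icc.exists_bound_of_continuousOn (hv.continuousOn hT)
  have hR0 : 0 ≤ R := (norm_nonneg _).trans (hR t ht)
  have hK : (0 : ℝ) ≤ K := K.2
  have hiu := intervalIntegrable_of_memLp hT hu.memLp_rhs
  have hiv := intervalIntegrable_of_memLp hT hv.memLp_rhs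
  have hsq : ∀ {u : ℝ → E}, IsStrongSolution e lam B f T u →
      IntervalIntegrable (fun t => ‖specOp e lam (u t)‖ ^ 2) volume 0 T := fun hu =>
    (integrable_timeMeasure_iff hT).1 hu.memLp_specOp.norm.integrable_sq
  have hmain := norm_sq_add_le_mul_exp (T := T) (w := fun s => u s - v s)
    (w' := fun s => constrainedRHS e lam B f (u s) - constrainedRHS e lam B f (v s))
    (g := fun s => (C ^ 2 + 2 + 2 * R + 2 * K) *
      (1 + ‖specOp e lam (u s)‖ ^ 2 + ‖specOp e lam (v s)‖ ^ 2)) (ε := 0) le_rfl (hiu.sub hiv)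
    (fun s hs => by
      have hs' : s ∈ uIcc 0 T := by rwa [uIcc_of_le hT]
      rw [intervalIntegral.integral_sub (hiu.zero_left hs') (hiv.zero_left hs')]
      nth_rw 1 [hu.eq_add_integral s hs, hv.eq_add_integral s hs]
      abel)
    (((intervalIntegrable_const.add (hsq hu)).add (hsq hv)).const_mul _)
    (fun s => by positivity)
    (by
      filter_upwards [ae_timeMeasure_iff.1 hu.mem_specDom, ae_timeMeasure_iff.1 hv.mem_specDom]
        with s h1 h2 hs
      rw [add_zero]
      exact hB.inner_constrainedRHS_sub_le hf (h1 hs) (h2 hs) (hR s (Ioo_subset_Icc_self hs))) ht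
  rw [h0, sub_self, norm_zero] at hmain
  have h1 : ‖u t - v t‖ ^ 2 ≤ 0 := by simpa using hmain
  have h2 : ‖u t - v t‖ = 0 := by
    have := le_antisymm h1 (sq_nonneg _)
    exact pow_eq_zero_iff two_ne_zero |>.1 this
  exact sub_eq_zero.1 (norm_eq_zero.1 h2)

theorem convection_eq_constrainedRHS (u : E) :
    B u u = -constrainedRHS e lam B f u - specOp e lam u + ⟪specOp e lam u, u⟫_ℝ • u + f u := by
  rw [constrainedRHS]
  abel

open Filter Topology in
/-- Uniform limits of Galerkin approximations with bounded energy and dissipation are strong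
solutions. -/
theorem IsConvection.isStrongSolution_of_tendsto [CompleteSpace E] [Countable ι]
    (hB : IsConvection e lam B C) (hf : LipschitzWith K f) {T : ℝ} (hT : 0 ≤ T)
    {F : ℕ → Finset ι} {un : ℕ → ℝ → E} {u : ℝ → E} {Y Z : ℝ}
    (hun : ∀ n, IsGalerkin e lam B f (F n) T (un n)) (hF : ∀ k, ∀ᶠ n in atTop, k ∈ F n)
    (hY : ∀ n, ∀ t ∈ Icc 0 T, ⟪specOp e lam (un n t), un n t⟫_ℝ ≤ Y)
    (hZ : ∀ n, ∫ s in (0 : ℝ)..T, ‖specOp e lam (un n s)‖ ^ 2 ≤ Z)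
    (hlim : TendstoUniformlyOn un u atTop (Icc 0 T)) :
    IsStrongSolution e lam B f T u ∧
      ∀ t ∈ Icc 0 T, ∀ S : Finset ι, ∑ k ∈ S, lam k * ⟪e k, u t⟫_ℝ ^ 2 ≤ Y := by
  have hpt : ∀ t ∈ Icc 0 T, Tendsto (fun n => un n t) atTop (𝓝 (u t)) := fun t ht =>
    hlim.tendsto_at ht
  have hcu : ContinuousOn u (Icc 0 T) :=
    hlim.continuousOn (Frequently.of_forall fun n => (hun n).continuousOn)
  have hnorm : ∀ t ∈ Icc 0 T, ‖u t‖ = 1 := fun t ht =>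
    tendsto_nhds_unique (hpt t ht).norm (by simp [fun n => (hun n).norm_eq t ht])
  have hct : ∀ t ∈ Icc 0 T, ∀ k, Tendsto (fun n => ⟪e k, un n t⟫_ℝ) atTop (𝓝 ⟪e k, u t⟫_ℝ) :=
    fun t ht k => tendsto_const_nhds.inner (hpt t ht)
  have hpart : ∀ t ∈ Icc 0 T, ∀ S : Finset ι, ∑ k ∈ S, lam k * ⟪e k, u t⟫_ℝ ^ 2 ≤ Y := by
    intro t ht S
    refine le_of_tendsto (tendsto_finsetSum S fun k _ => ((hct t ht k).pow 2).const_mul (lam k))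
      (Eventually.of_forall fun n => ?_)
    refine le_trans ?_ (hY n t ht)
    have h1 := hasSum_energy ((hun n).mem_specDom ht) (un n t)
    simp only [mul_assoc, ← sq] at h1
    exact sum_le_hasSum S (fun k _ => mul_nonneg (zero_le_one.trans (hB.one_le k))
      (sq_nonneg _)) h1
  refine ⟨?_, hpart⟩
  -- square-integrability of `A u`
  set θ : E → ℝ≥0∞ := fun x => ∑' k, ENNReal.ofReal ((lam k * ⟪e k, x⟫_ℝ) ^ 2) with hθ
  have hθD : ∀ {x}, x ∈ specDom e lam → θ x = ENNReal.ofReal (‖specOp e lam x‖ ^ 2) := by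
    intro x hx
    have h := hasSum_norm_specOp_sq hx
    rw [← h.tsum_eq, ENNReal.ofReal_tsum_of_nonneg (fun k => sq_nonneg _) h.summable]
  have hθm : ∀ {w : ℝ → E}, ContinuousOn w (Icc 0 T) →
      AEMeasurable (fun t => θ (w t)) (timeMeasure T) := by
    intro w hw
    refine AEMeasurable.tsum fun k => ?_
    refine AEMeasurable.ennreal_ofReal ?_
    exact (aestronglyMeasurable_of_continuousOn
      ((continuousOn_const.mul (continuousOn_const.inner hw)).pow 2)).aemeasurable
  -- Lower semicontinuity: each finite partial sum converges along the approximations, and `θ` is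
  -- the supremum of these sums.
  have hθle : ∀ t ∈ Icc 0 T, θ (u t) ≤ liminf (fun n => θ (un n t)) atTop := by
    intro t ht
    simp only [hθ]
    rw [ENNReal.tsum_eq_iSup_sum]
    refine iSup_le fun S => ?_
    have h1 : Tendsto (fun n => ∑ k ∈ S, ENNReal.ofReal ((lam k * ⟪e k, un n t⟫_ℝ) ^ 2)) atTop
        (𝓝 (∑ k ∈ S, ENNReal.ofReal ((lam k * ⟪e k, u t⟫_ℝ) ^ 2))) :=
      tendsto_finsetSum S fun k _ =>
        ENNReal.tendsto_ofReal (((hct t ht k).const_mul (lam k)).pow 2)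
    rw [← h1.liminf_eq]
    exact liminf_le_liminf (Eventually.of_forall fun n => ENNReal.sum_le_tsum S)
  -- Fatou's lemma. With values in `ℝ≥0∞` nothing has to be known beforehand about `u t` lying in
  -- the domain; finiteness a.e. then gives it.
  have hθint : ∫⁻ t, θ (u t) ∂timeMeasure T ≤ ENNReal.ofReal Z := by
    calc ∫⁻ t, θ (u t) ∂timeMeasure T
        ≤ ∫⁻ t, liminf (fun n => θ (un n t)) atTop ∂timeMeasure T :=
          lintegral_mono_ae (ae_timeMeasure_of_Icc hθle)
      _ ≤ liminf (fun n => ∫⁻ t, θ (un n t) ∂timeMeasure T) atTop :=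
          lintegral_liminf_le' fun n => hθm (hun n).continuousOn
      _ ≤ ENNReal.ofReal Z := by
          refine liminf_le_of_le (by isBoundedDefault) fun b hb => ?_
          obtain ⟨n, hn⟩ := hb.exists
          refine hn.trans ?_
          have h1 : Integrable (fun t => ‖specOp e lam (un n t)‖ ^ 2) (timeMeasure T) :=
            (integrable_timeMeasure_iff hT).2 (IsGalerkin.intervalIntegrable_of_continuousOn
              ((hun n).continuousOn_specOp.norm.pow 2) ⟨hT, le_rfl⟩)
          rw [lintegral_congr_ae (g := fun t => ENNReal.ofReal (‖specOp e lam (un n t)‖ ^ 2))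
            (ae_timeMeasure_of_Icc fun t ht => hθD ((hun n).mem_specDom ht)),
            ← ofReal_integral_eq_lintegral_ofReal h1 (Eventually.of_forall fun t => sq_nonneg _),
            integral_timeMeasure hT]
          exact ENNReal.ofReal_le_ofReal (hZ n)
  have hD : ∀ᵐ t ∂timeMeasure T, u t ∈ specDom e lam := by
    filter_upwards [ae_lt_top' (hθm hcu) (hθint.trans_lt ENNReal.ofReal_lt_top).ne] with t ht
    have h1 := ENNReal.summable_toReal ht.ne
    refine h1.congr fun k => ?_
    rw [ENNReal.toReal_ofReal (sq_nonneg _)]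
  have hAm : AEStronglyMeasurable (fun t => specOp e lam (u t)) (timeMeasure T) := by
    refine aestronglyMeasurable_of_coord e fun k => ?_
    refine (aestronglyMeasurable_of_continuousOn (h := fun t => lam k * ⟪e k, u t⟫_ℝ)
      (continuousOn_const.mul (continuousOn_const.inner hcu))).congr ?_
    filter_upwards [hD] with t ht
    rw [coord_specOp ht]
  have hA2 : MemLp (fun t => specOp e lam (u t)) 2 (timeMeasure T) := by
    rw [← memLp_norm_iff hAm, memLp_two_iff_integrable_sq hAm.norm]
    refine ⟨(hAm.norm.pow 2), ?_⟩
    rw [hasFiniteIntegral_iff_ofReal (Eventually.of_forall fun t => sq_nonneg _)]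
    refine lt_of_le_of_lt ?_ (hθint.trans_lt ENNReal.ofReal_lt_top)
    refine lintegral_mono_ae ?_
    filter_upwards [hD] with t ht
    rw [hθD ht]
  have hyY : ∀ᵐ t ∂timeMeasure T, ⟪specOp e lam (u t), u t⟫_ℝ ≤ Y := by
    filter_upwards [hD, ae_timeMeasure_of_Icc hpart] with t ht1 ht2
    have h1 := hasSum_energy ht1 (u t)
    simp only [mul_assoc, ← sq] at h1
    exact hasSum_le_of_sum_le h1 ht2
  have hcf : ContinuousOn (fun t => f (u t)) (Icc 0 T) := hf.continuous.comp_continuousOn hcu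
  -- measurability of the convection term
  have hBm : AEStronglyMeasurable (fun t => B (u t) (u t)) (timeMeasure T) := by
    refine aestronglyMeasurable_of_coord e fun k => ?_
    have hswap : ∀ {x}, x ∈ specDom e lam → ⟪e k, B x x⟫_ℝ = -⟪B x (e k), x⟫_ℝ := fun hx => by
      rw [real_inner_comm, hB.inner_swap hx hx (basis_mem_specDom k)]
    -- Each coordinate of `B (u t) (u t)` is an a.e. limit of continuous functions of time: after
    -- the swap, `basis_le` needs convergence in `E` only.
    refine aestronglyMeasurable_of_tendsto_ae (u := atTop)
      (f := fun n t => ⟪e k, B (un n t) (un n t)⟫_ℝ) (fun n => ?_) ?_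
    · refine aestronglyMeasurable_of_continuousOn (ContinuousOn.inner (𝕜 := ℝ) continuousOn_const ?_)
      have h1 := (hun n).continuousOn
      have h2 := (hun n).continuousOn_specOp
      have h3 := (hun n).continuousOn_rhs hB hf
      have h4 := hf.continuous.comp_continuousOn h1
      refine (((h3.neg.sub h2).add ((h2.inner (𝕜 := ℝ) h1).smul h1)).add h4).congr fun t _ => ?_
      exact convection_eq_constrainedRHS (e := e) (lam := lam) (f := f) (un n t)
    · filter_upwards [hD, ae_timeMeasure_of_Icc (p := fun t => t ∈ Icc 0 T) fun t ht => ht]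
        with t htD ht
      obtain ⟨c, hc⟩ := hB.basis_le k
      rw [tendsto_iff_norm_sub_tendsto_zero]
      have h0 : Tendsto (fun n => 2 * |c| * ‖un n t - u t‖) atTop (𝓝 0) := by
        simpa using (tendsto_iff_norm_sub_tendsto_zero.1 (hpt t ht)).const_mul (2 * |c|)
      refine squeeze_zero (fun n => norm_nonneg _) (fun n => ?_) h0
      have hnD := (hun n).mem_specDom ht
      have hdD := sub_mem hnD htD
      have h1 : ⟪e k, B (un n t) (un n t)⟫_ℝ - ⟪e k, B (u t) (u t)⟫_ℝ
          = -(⟪B (un n t - u t) (e k), un n t⟫_ℝ + ⟪B (u t) (e k), un n t - u t⟫_ℝ) := by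
        rw [hswap hnD, hswap htD, hB.sub_left hnD htD (basis_mem_specDom k), inner_sub_left,
          inner_sub_right]
        ring
      have h2 := hc hdD hnD
      have h3 := hc htD hdD
      rw [(hun n).norm_eq t ht, mul_one] at h2
      rw [hnorm t ht, mul_one] at h3
      rw [h1, norm_neg, Real.norm_eq_abs]
      have h4 := abs_add_le ⟪B (un n t - u t) (e k), un n t⟫_ℝ ⟪B (u t) (e k), un n t - u t⟫_ℝ
      have h5 : c * ‖un n t - u t‖ ≤ |c| * ‖un n t - u t‖ := by gcongr; exact le_abs_self c
      linarith
  have hum := aestronglyMeasurable_of_continuousOn hcu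
  have hNm : AEStronglyMeasurable (fun t => constrainedRHS e lam B f (u t)) (timeMeasure T) :=
    (((hAm.neg.sub hBm).add ((hAm.inner (𝕜 := ℝ) hum).smul hum)).add
      (aestronglyMeasurable_of_continuousOn hcf))
  have hN2 : MemLp (fun t => constrainedRHS e lam B f (u t)) 2 (timeMeasure T) := by
    have hg : MemLp (fun t => (1 + C * √Y) * ‖specOp e lam (u t)‖ + (Y + (‖f 0‖ + K))) 2
        (timeMeasure T) := (hA2.norm.const_mul _).add (memLp_const _)
    refine hg.of_le hNm ?_
    filter_upwards [hD, hyY, ae_timeMeasure_of_Icc hnorm] with t h1 h2 h3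
    refine le_trans ?_ (le_abs_self _)
    refine (hB.norm_constrainedRHS_le h1).trans ?_
    have h4 := hf.norm_le_of_norm_eq_one h3
    have hC := hB.nonneg
    have h5 : C * ‖specOp e lam (u t)‖ * √⟪specOp e lam (u t), u t⟫_ℝ
        ≤ C * ‖specOp e lam (u t)‖ * √Y := by gcongr
    rw [h3]
    linarith
  refine ⟨hD, hA2, hN2, fun t ht => ext_coord e fun k => ?_⟩
  -- the equation, coordinate by coordinate
  have hNi := intervalIntegrable_of_memLp hT hN2
  have ht' : t ∈ uIcc 0 T := by rwa [uIcc_of_le hT]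
  have hcoordint : ∀ {h : ℝ → E}, IntervalIntegrable h volume 0 t →
      ⟪e k, ∫ s in (0 : ℝ)..t, h s⟫_ℝ = ∫ s in (0 : ℝ)..t, ⟪e k, h s⟫_ℝ := fun hh =>
    ((innerSL ℝ (e k)).intervalIntegral_comp_comm hh).symm
  have hinner : ∀ {h : ℝ → E} {t : ℝ}, IntervalIntegrable h volume 0 t →
      IntervalIntegrable (fun s => ⟪e k, h s⟫_ℝ) volume 0 t := fun hh =>
    ⟨(innerSL ℝ (e k)).integrable_comp hh.1, (innerSL ℝ (e k)).integrable_comp hh.2⟩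
  have hNn : ∀ n, IntervalIntegrable (fun s => constrainedRHS e lam B f (un n s)) volume 0 T :=
    fun n => IsGalerkin.intervalIntegrable_of_continuousOn ((hun n).continuousOn_rhs hB hf)
      ⟨hT, le_rfl⟩
  obtain ⟨c, hc0, hc⟩ := hB.exists_abs_coord_constrainedRHS_sub_le hf k
  have hA1 : IntervalIntegrable (fun s => ‖specOp e lam (u s)‖) volume 0 T :=
    intervalIntegrable_of_memLp hT hA2.norm
  set W := ∫ s in (0 : ℝ)..T, ‖specOp e lam (u s)‖ with hW
  have hW0 : 0 ≤ W := intervalIntegral.integral_nonneg hT fun s _ => norm_nonneg _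
  -- Uniform convergence suffices because the weight `1 + ‖A uₙ‖ + ‖A u‖ ≤ 2 + ‖A uₙ‖² + ‖A u‖` has
  -- a time integral bounded independently of `n`.
  have hdiff : ∀ n, ∀ ε, 0 ≤ ε → (∀ s ∈ Icc 0 T, ‖un n s - u s‖ ≤ ε) →
      |(∫ s in (0 : ℝ)..t, ⟪e k, constrainedRHS e lam B f (un n s)⟫_ℝ)
        - ∫ s in (0 : ℝ)..t, ⟪e k, constrainedRHS e lam B f (u s)⟫_ℝ|
      ≤ ε * (c * (2 * T + Z + W)) := by
    intro n ε hε hclose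
    have hAn : IntervalIntegrable (fun s => ‖specOp e lam (un n s)‖ ^ 2) volume 0 T :=
      IsGalerkin.intervalIntegrable_of_continuousOn
        ((hun n).continuousOn_specOp.norm.pow 2) ⟨hT, le_rfl⟩
    have hgi : IntervalIntegrable (fun s => ε * (c * (2 + ‖specOp e lam (un n s)‖ ^ 2
        + ‖specOp e lam (u s)‖))) volume 0 T :=
      (((intervalIntegrable_const.add hAn).add hA1).const_mul c).const_mul ε
    rw [← intervalIntegral.integral_sub (hinner ((hNn n).zero_left ht'))
      (hinner (hNi.zero_left ht')), ← Real.norm_eq_abs]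
    calc _ ≤ ∫ s in (0 : ℝ)..t, ε * (c * (2 + ‖specOp e lam (un n s)‖ ^ 2
          + ‖specOp e lam (u s)‖)) := by
          refine intervalIntegral.norm_integral_le_of_norm_le ht.1 ?_ (hgi.zero_left ht')
          have hne : ∀ᵐ x : ℝ, x ≠ T := by simp [ae_iff]
          filter_upwards [ae_timeMeasure_iff.1 hD, hne] with s hs hsT hsI
          have hs1 : s ∈ Ioo 0 T := ⟨hsI.1, lt_of_le_of_ne (hsI.2.trans ht.2) hsT⟩
          have hs2 := Ioo_subset_Icc_self hs1
          have h1 := hc _ ((hun n).mem_specDom hs2) _ (hs hs1) ((hun n).norm_eq s hs2).le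
            (hnorm s hs2).le
          rw [inner_sub_right] at h1
          rw [Real.norm_eq_abs]
          refine h1.trans ?_
          have h2 : 1 + ‖specOp e lam (un n s)‖ + ‖specOp e lam (u s)‖
              ≤ 2 + ‖specOp e lam (un n s)‖ ^ 2 + ‖specOp e lam (u s)‖ := by
            nlinarith [sq_nonneg (‖specOp e lam (un n s)‖ - 1)]
          calc _ ≤ c * (2 + ‖specOp e lam (un n s)‖ ^ 2 + ‖specOp e lam (u s)‖) * ε := by
                gcongr
                exact hclose s hs2
            _ = _ := by ring
      _ ≤ ∫ s in (0 : ℝ)..T, ε * (c * (2 + ‖specOp e lam (un n s)‖ ^ 2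
          + ‖specOp e lam (u s)‖)) := by
          refine intervalIntegral.integral_mono_interval le_rfl ht.1 ht.2
            (Eventually.of_forall fun s => ?_) hgi
          simp only [Pi.zero_apply]
          positivity
      _ ≤ ε * (c * (2 * T + Z + W)) := by
          rw [intervalIntegral.integral_const_mul, intervalIntegral.integral_const_mul,
            intervalIntegral.integral_add (intervalIntegrable_const.add hAn) hA1,
            intervalIntegral.integral_add intervalIntegrable_const hAn,
            intervalIntegral.integral_const]
          refine mul_le_mul_of_nonneg_left (mul_le_mul_of_nonneg_left ?_ hc0) hε
          simp only [sub_zero, smul_eq_mul]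
          linarith [hZ n]
  have htend : Tendsto (fun n => ∫ s in (0 : ℝ)..t, ⟪e k, constrainedRHS e lam B f (un n s)⟫_ℝ)
      atTop (𝓝 (∫ s in (0 : ℝ)..t, ⟪e k, constrainedRHS e lam B f (u s)⟫_ℝ)) := by
    rw [Metric.tendsto_nhds]
    intro δ hδ
    set M := |c * (2 * T + Z + W)| + 1 with hM
    have hM0 : 0 < M := by positivity
    filter_upwards [Metric.tendstoUniformlyOn_iff.1 hlim (δ / M) (by positivity)] with n hn
    rw [Real.dist_eq]
    refine (hdiff n (δ / M) (by positivity) fun s hs => ?_).trans_lt ?_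
    · rw [← dist_eq_norm, dist_comm]
      exact (hn s hs).le
    · rw [div_mul_eq_mul_div, div_lt_iff₀ hM0]
      have := le_abs_self (c * (2 * T + Z + W))
      nlinarith
  have h0 : (0 : ℝ) ∈ Icc 0 T := ⟨le_rfl, hT⟩
  -- Once `k ∈ F n`, the Galerkin projection is invisible in coordinate `k`.
  have heq : ∀ᶠ n in atTop, ⟪e k, un n 0⟫_ℝ
      + ∫ s in (0 : ℝ)..t, ⟪e k, constrainedRHS e lam B f (un n s)⟫_ℝ = ⟪e k, un n t⟫_ℝ := by
    filter_upwards [hF k] with n hn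
    rw [(hun n).eq_add_integral hB hf ht, inner_add_right, hcoordint]
    · simp only [coord_trunc_of_mem _ hn]
    · exact IsGalerkin.intervalIntegrable_of_continuousOn
        ((trunc e (F n)).continuous.comp_continuousOn ((hun n).continuousOn_rhs hB hf)) ht
  rw [inner_add_right, hcoordint (hNi.zero_left ht')]
  exact tendsto_nhds_unique (hct t ht k)
    ((((hct 0 h0 k).add htend)).congr' heq)

end Limit

/-! ### Global existence of strong solutions -/

section Existence

variable {ι E : Type*} [NormedAddCommGroup E] [InnerProductSpace ℝ E]
  {e : HilbertBasis ι ℝ E} {lam : ι → ℝ} {B : E → E → E} {C : ℝ} {f : E → E} {K : ℝ≥0}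

/-- Approximation of a unit vector of finite energy by unit vectors with finitely many modes. -/
theorem exists_finite_mode_approx (hlam : ∀ k, 1 ≤ lam k) {u₀ : E} (hu₀ : ‖u₀‖ = 1) {y₀ : ℝ}
    (hy₀ : HasSum (fun k => lam k * ⟪e k, u₀⟫_ℝ ^ 2) y₀) {F : Finset ι} {r : ℝ}
    (hr : 0 < r) (hyr : 2 * √y₀ ≤ r) (hF : ∀ k ∉ F, r ^ 2 ≤ lam k) :
    ∃ v : E, ‖v‖ = 1 ∧ (∀ k ∉ F, ⟪e k, v⟫_ℝ = 0) ∧ ⟪specOp e lam v, v⟫_ℝ ≤ 4 * y₀ ∧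
      ‖v - u₀‖ ≤ 2 * √y₀ * r⁻¹ := by
  classical
  have hy0 : 0 ≤ y₀ := hy₀.nonneg fun k => mul_nonneg (zero_le_one.trans (hlam k)) (sq_nonneg _)
  set p := trunc e F u₀ with hp
  have htail : ‖u₀ - p‖ ≤ √y₀ * r⁻¹ := by
    rw [← div_eq_mul_inv, le_div_iff₀ hr]
    refine Real.le_sqrt_of_sq_le ?_
    rw [mul_pow, mul_comm]
    refine hasSum_le (fun k => ?_) ((hasSum_coord_sq e _).mul_left (r ^ 2)) hy₀
    rw [inner_sub_right, hp, coord_trunc]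
    have := sq_nonneg ⟪e k, u₀⟫_ℝ
    split_ifs with hk
    · simpa using mul_nonneg (zero_le_one.trans (hlam k)) this
    · rw [sub_zero]
      exact mul_le_mul_of_nonneg_right (hF k hk) this
  have hep : ⟪specOp e lam p, p⟫_ℝ ≤ y₀ := by
    refine hasSum_le (fun k => ?_) (hasSum_energy (trunc_mem_specDom F u₀) _) hy₀
    rw [coord_trunc, mul_assoc, ← sq]
    refine mul_le_mul_of_nonneg_left ?_ (zero_le_one.trans (hlam k))
    split_ifs
    · rfl
    · simpa using sq_nonneg _
  -- The condition `2 * √y₀ ≤ r` leaves the truncation with norm at least `1 / 2`, so normalising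
  -- multiplies its energy by at most `4`.
  have hhalf : √y₀ * r⁻¹ ≤ 1 / 2 := by
    rw [← div_eq_mul_inv, div_le_iff₀ hr]
    linarith
  have hpn : 1 / 2 ≤ ‖p‖ := by
    have h1 := norm_le_norm_add_norm_sub' u₀ p
    rw [hu₀] at h1
    linarith
  have hpos : 0 < ‖p‖ := by linarith
  refine ⟨‖p‖⁻¹ • p, ?_, fun k hk => ?_, ?_, ?_⟩
  · rw [norm_smul, norm_inv, norm_norm, inv_mul_cancel₀ hpos.ne']
  · rw [inner_smul_right, hp, coord_trunc_of_notMem _ hk, mul_zero]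
  · rw [specOp_smul _ (trunc_mem_specDom F u₀), inner_smul_left, inner_smul_right,
      RCLike.conj_to_real, ← mul_assoc]
    have h2 : ‖p‖⁻¹ ≤ 2 := by
      rw [inv_le_comm₀ hpos (by norm_num)]
      linarith
    have h3 : ‖p‖⁻¹ * ‖p‖⁻¹ ≤ 4 := by nlinarith [inv_pos.2 hpos]
    calc _ ≤ ‖p‖⁻¹ * ‖p‖⁻¹ * y₀ := by gcongr
      _ ≤ 4 * y₀ := by gcongr
  · have h1 : ‖‖p‖⁻¹ • p - p‖ ≤ ‖u₀ - p‖ := by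
      have h2 : ‖p‖⁻¹ • p - p = ((1 - ‖p‖) * ‖p‖⁻¹) • p := by
        have : (1 - ‖p‖) * ‖p‖⁻¹ = ‖p‖⁻¹ - 1 := by field_simp
        rw [this, sub_smul, one_smul]
      rw [h2, norm_smul, norm_mul, norm_inv, norm_norm, mul_assoc, inv_mul_cancel₀ hpos.ne',
        mul_one, ← hu₀]
      exact abs_norm_sub_norm_le u₀ p
    have h3 := norm_sub_le_norm_sub_add_norm_sub (‖p‖⁻¹ • p) p u₀
    rw [norm_sub_rev p u₀] at h3
    linarith

-- The Galerkin solutions for growing cut-offs form a uniform Cauchy sequence, so completeness of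
-- `E` replaces a compactness argument and no subsequence is extracted.
open Filter Topology in
theorem IsConvection.exists_isStrongSolution [CompleteSpace E] [Countable ι]
    (hB : IsConvection e lam B C) (hf : LipschitzWith K f)
    (hfM : ∀ u, ‖u‖ = 1 → ⟪f u, u⟫_ℝ = 0) {u₀ : E} (hu₀ : ‖u₀‖ = 1)
    (hV : Summable fun k => lam k * ⟪e k, u₀⟫_ℝ ^ 2) {T : ℝ} (hT : 0 ≤ T) :
    ∃ (u : ℝ → E) (Y : ℝ), u 0 = u₀ ∧ IsStrongSolution e lam B f T u ∧
      ∀ t ∈ Icc 0 T, ∀ S : Finset ι, ∑ k ∈ S, lam k * ⟪e k, u t⟫_ℝ ^ 2 ≤ Y := by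
  obtain ⟨y₀, hy₀⟩ := hV
  have hy0 : 0 ≤ y₀ := hy₀.nonneg fun k =>
    mul_nonneg (zero_le_one.trans (hB.one_le k)) (sq_nonneg _)
  -- Positive, increasing to infinity, and at least `2 * √y₀` as `exists_finite_mode_approx`
  -- requires.
  set r : ℕ → ℝ := fun n => n + 1 + 2 * √y₀ with hr
  have hrpos : ∀ n, 0 < r n := fun n => by positivity
  have hrmono : ∀ {m n}, m ≤ n → r m ≤ r n := fun h => by
    simp only [hr]
    gcongr
  have hrtop : Tendsto r atTop atTop := by
    simp only [hr, add_assoc]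
    exact tendsto_atTop_add_const_right _ _ tendsto_natCast_atTop_atTop
  have hrinv : Tendsto (fun n => (r n)⁻¹) atTop (𝓝 0) := tendsto_inv_atTop_zero.comp hrtop
  choose F hF using fun n => hB.tail (r n ^ 2)
  have hFm : ∀ {m n}, m ≤ n → ∀ k ∉ F n, r m ^ 2 ≤ lam k := fun h k hk =>
    (pow_le_pow_left₀ (hrpos _).le (hrmono h) 2).trans (hF _ k hk)
  choose v hv1 hvF hvE hvd using fun n => exists_finite_mode_approx hB.one_le hu₀ hy₀ (hrpos n)
    (by simp only [hr]; linarith [Nat.cast_nonneg (α := ℝ) n]) (hF n)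
  choose un hun0 hun using fun n => hB.exists_galerkin hf hfM (F n) (hv1 n) (hvF n) hT
  set Y := 4 * y₀ + (‖f 0‖ + K) ^ 2 * T with hY
  set Z := Y + T * Y ^ 2 with hZ
  have h0Y : ∀ n, ⟪specOp e lam (un n 0), un n 0⟫_ℝ + (‖f 0‖ + K) ^ 2 * T ≤ Y := fun n => by
    rw [hun0 n, hY]
    linarith [hvE n]
  have hunY : ∀ n, ∀ t ∈ Icc 0 T, ⟪specOp e lam (un n t), un n t⟫_ℝ ≤ Y := fun n t ht =>
    ((hun n).energy_le hB hf hfM ht).trans (h0Y n)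
  have hunZ : ∀ n, ∫ s in (0 : ℝ)..T, ‖specOp e lam (un n s)‖ ^ 2 ≤ Z := fun n =>
    (hun n).integral_norm_specOp_sq_le hB hf hfM hT (h0Y n)
  set D := Real.exp ((C ^ 2 + 4 + 2 * K + 4 * (√Y * (C * √Y + ‖f 0‖ + K))) * (T + 2 * Z)) with hD
  have hCauchy : UniformCauchySeqOn un atTop (Icc 0 T) := by
    rw [Metric.uniformCauchySeqOn_iff]
    intro ε hε
    -- Two initial errors of size `2 * √y₀ * r⁻¹` each make up the factor `4`.
    have hlim : Tendsto (fun n => ((4 * √y₀ * (r n)⁻¹) ^ 2 + (r n)⁻¹) * D) atTop (𝓝 0) := by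
      have := (((hrinv.const_mul (4 * √y₀)).pow 2).add hrinv).mul_const D
      simpa using this
    obtain ⟨N, hN⟩ := (hlim.eventually (gt_mem_nhds (pow_pos hε 2))).exists
    refine ⟨N, fun m hm n hn t ht => ?_⟩
    rw [dist_eq_norm]
    refine lt_of_pow_lt_pow_left₀ 2 hε.le (lt_of_le_of_lt ?_ hN)
    refine ((hun m).norm_sub_sq_le hB hf (hun n) (hrpos N) (hunY m) (hunY n) (hunZ m) (hunZ n)
      (hFm hm) (hFm hn) ht).trans ?_
    rw [← hD]
    gcongr
    rw [hun0, hun0]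
    have hle : ∀ n, N ≤ n → ‖v n - u₀‖ ≤ 2 * √y₀ * (r N)⁻¹ := fun n hn =>
      (hvd n).trans (by gcongr; exact hrmono hn)
    have h1 := norm_sub_le_norm_sub_add_norm_sub (v m) u₀ (v n)
    rw [norm_sub_rev u₀ (v n)] at h1
    linarith [hle m hm, hle n hn]
  have hex : ∀ t, ∃ x, t ∈ Icc 0 T → Tendsto (fun n => un n t) atTop (𝓝 x) := by
    intro t
    by_cases ht : t ∈ Icc 0 T
    · obtain ⟨x, hx⟩ := cauchySeq_tendsto_of_complete (hCauchy.cauchySeq ht)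
      exact ⟨x, fun _ => hx⟩
    · exact ⟨0, fun h => absurd h ht⟩
  choose u hu using hex
  have hlim := hCauchy.tendstoUniformlyOn_of_tendsto fun t ht => hu t ht
  have hFk : ∀ k, ∀ᶠ n in atTop, k ∈ F n := by
    intro k
    have h2 : Tendsto (fun n => r n ^ 2) atTop atTop :=
      (tendsto_pow_atTop two_ne_zero).comp hrtop
    filter_upwards [h2.eventually_gt_atTop (lam k)] with n hn
    by_contra hk
    exact absurd (hF n k hk) (not_le.2 hn)
  obtain ⟨hs, hb⟩ := hB.isStrongSolution_of_tendsto hf hT hun hFk hunY hunZ hlim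
  refine ⟨u, Y, ?_, hs, hb⟩
  have hv : Tendsto v atTop (𝓝 u₀) := by
    rw [tendsto_iff_norm_sub_tendsto_zero]
    refine squeeze_zero (fun n => norm_nonneg _) hvd ?_
    simpa using hrinv.const_mul (2 * √y₀)
  have h0 := hu 0 ⟨le_rfl, hT⟩
  simp only [hun0] at h0
  exact tendsto_nhds_unique h0 hv

theorem timeMeasure_mono {T T' : ℝ} (h : T' ≤ T) : timeMeasure T' ≤ timeMeasure T :=
  Measure.restrict_mono (Ioo_subset_Ioo_right h) le_rfl

theorem IsStrongSolution.mono {T T' : ℝ} {u : ℝ → E} (hu : IsStrongSolution e lam B f T u)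
    (h : T' ≤ T) : IsStrongSolution e lam B f T' u where
  mem_specDom := ae_mono (timeMeasure_mono h) hu.mem_specDom
  memLp_specOp := hu.memLp_specOp.mono_measure (timeMeasure_mono h)
  memLp_rhs := hu.memLp_rhs.mono_measure (timeMeasure_mono h)
  eq_add_integral t ht := hu.eq_add_integral t ⟨ht.1, ht.2.trans h⟩

theorem IsStrongSolution.congr {T : ℝ} {u v : ℝ → E} (hu : IsStrongSolution e lam B f T u)
    (h : EqOn v u (Icc 0 T)) : IsStrongSolution e lam B f T v where
  mem_specDom := by
    filter_upwards [hu.mem_specDom, ae_timeMeasure_of_Icc h] with t h1 h2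
    rwa [h2]
  memLp_specOp := (memLp_congr_ae (ae_timeMeasure_of_Icc fun t ht => by rw [h ht])).1
    hu.memLp_specOp
  memLp_rhs := (memLp_congr_ae (ae_timeMeasure_of_Icc fun t ht => by rw [h ht])).1 hu.memLp_rhs
  eq_add_integral t ht := by
    rw [h ht, h ⟨le_rfl, ht.1.trans ht.2⟩, hu.eq_add_integral t ht]
    congr 1
    refine intervalIntegral.integral_congr fun s hs => ?_
    rw [uIcc_of_le ht.1] at hs
    rw [h ⟨hs.1, hs.2.trans ht.2⟩]

theorem IsConvection.exists_global_isStrongSolution [CompleteSpace E] [Countable ι]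
    (hB : IsConvection e lam B C) (hf : LipschitzWith K f)
    (hfM : ∀ u, ‖u‖ = 1 → ⟪f u, u⟫_ℝ = 0) {u₀ : E} (hu₀ : ‖u₀‖ = 1)
    (hV : Summable fun k => lam k * ⟪e k, u₀⟫_ℝ ^ 2) :
    ∃ u : ℝ → E, u 0 = u₀ ∧ ∀ T, 0 ≤ T → IsStrongSolution e lam B f T u ∧
      ∃ Y, ∀ t ∈ Icc 0 T, ∀ S : Finset ι, ∑ k ∈ S, lam k * ⟪e k, u t⟫_ℝ ^ 2 ≤ Y := by
  choose U Y hU0 hU hUY using fun n : ℕ =>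
    hB.exists_isStrongSolution hf hfM hu₀ hV (Nat.cast_nonneg (α := ℝ) n)
  have hcoh : ∀ {m n : ℕ}, m ≤ n → EqOn (U m) (U n) (Icc 0 m) := fun {m n} h =>
    (hU m).eqOn hB hf (Nat.cast_nonneg m) ((hU n).mono (Nat.cast_le.2 h)) (by rw [hU0, hU0])
  -- Uniqueness makes the solutions on `[0, n]` agree, so at time `t` the one on the first
  -- sufficient integer interval may be used.
  have hglue : ∀ n : ℕ, EqOn (fun t => U ⌈t⌉₊ t) (U n) (Icc 0 n) := fun n t ht =>
    hcoh (Nat.ceil_le.2 ht.2) ⟨ht.1, Nat.le_ceil t⟩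
  refine ⟨fun t => U ⌈t⌉₊ t, by simp [hU0], fun T hT => ?_⟩
  have hsub : Icc 0 T ⊆ Icc 0 (⌈T⌉₊ : ℝ) := Icc_subset_Icc_right (Nat.le_ceil T)
  refine ⟨((hU ⌈T⌉₊).congr (hglue _)).mono (Nat.le_ceil T), Y ⌈T⌉₊, fun t ht S => ?_⟩
  have h := hglue ⌈T⌉₊ (hsub ht)
  rw [h]
  exact hUY _ t (hsub ht) S

end Existence

/-! ### Test functions on the torus -/

section TestFunctions

theorem proj_surjective : Function.Surjective proj := isOpenQuotientMap_proj.surjective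

theorem proj_add_single (y : Fin 2 → ℝ) (i : Fin 2) (s : ℝ) :
    proj y + Pi.single i (s : UnitAddCircle) = proj (y + s • (Pi.single i 1 : Fin 2 → ℝ)) := by
  funext j
  by_cases h : j = i
  · subst h; simp [proj]
  · simp [proj, h]

theorem single_add_coe (i : Fin 2) (s t : ℝ) :
    (Pi.single i ((s + t : ℝ) : UnitAddCircle) : T2)
      = Pi.single i (s : UnitAddCircle) + Pi.single i (t : UnitAddCircle) := by
  rw [← Pi.single_add, AddCircle.coe_add]

theorem IsTest.continuous {φ : T2 → ℝ} (hφ : IsTest φ) : Continuous φ := by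
  rw [isOpenQuotientMap_proj.isQuotientMap.continuous_iff]
  exact ContDiff.continuous hφ

theorem IsTest.const (c : ℝ) : IsTest fun _ => c := contDiff_const

theorem IsTest.add {φ ψ : T2 → ℝ} (hφ : IsTest φ) (hψ : IsTest ψ) : IsTest fun x => φ x + ψ x :=
  ContDiff.add hφ hψ

theorem IsTest.mul {φ ψ : T2 → ℝ} (hφ : IsTest φ) (hψ : IsTest ψ) : IsTest fun x => φ x * ψ x :=
  ContDiff.mul hφ hψ

theorem IsTest.sum {ι : Type*} {φ : ι → T2 → ℝ} (F : Finset ι) (hφ : ∀ k ∈ F, IsTest (φ k)) :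
    IsTest fun x => ∑ k ∈ F, φ k x :=
  ContDiff.sum hφ

theorem IsTest.hasDerivAt {φ : T2 → ℝ} (hφ : IsTest φ) (i : Fin 2) (x : T2) :
    HasDerivAt (fun s : ℝ => φ (x + Pi.single i (s : UnitAddCircle))) (pderiv i φ x) 0 := by
  obtain ⟨y, rfl⟩ := proj_surjective x
  unfold pderiv
  simp only [proj_add_single]
  refine DifferentiableAt.hasDerivAt ?_
  have h1 : Differentiable ℝ (fun y : Fin 2 → ℝ => φ (proj y)) := hφ.differentiable (by simp)
  exact (h1.comp (g := fun y : Fin 2 → ℝ => φ (proj y))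
    (f := fun s : ℝ => y + s • (Pi.single i 1 : Fin 2 → ℝ)) (by fun_prop)).differentiableAt

theorem IsTest.hasDerivAt_shift {φ : T2 → ℝ} (hφ : IsTest φ) (i : Fin 2) (x : T2) (s : ℝ) :
    HasDerivAt (fun s : ℝ => φ (x + Pi.single i (s : UnitAddCircle)))
      (pderiv i φ (x + Pi.single i (s : UnitAddCircle))) s := by
  have h := hφ.hasDerivAt i (x + Pi.single i (s : UnitAddCircle))
  rw [← sub_self s] at h
  refine (h.comp_sub_const s s).congr_of_eventuallyEq (Filter.Eventually.of_forall fun t => ?_)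
  simp only
  rw [add_assoc, ← single_add_coe, add_sub_cancel]

theorem pderiv_eq_of_hasDerivAt {φ : T2 → ℝ} {i : Fin 2} {x : T2} {c : ℝ}
    (h : HasDerivAt (fun s : ℝ => φ (x + Pi.single i (s : UnitAddCircle))) c 0) :
    pderiv i φ x = c := h.deriv

theorem pderiv_mul {φ ψ : T2 → ℝ} (hφ : IsTest φ) (hψ : IsTest ψ) (i : Fin 2) (x : T2) :
    pderiv i (fun x => φ x * ψ x) x = pderiv i φ x * ψ x + φ x * pderiv i ψ x := by
  refine pderiv_eq_of_hasDerivAt ?_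
  exact ((hφ.hasDerivAt i x).mul (hψ.hasDerivAt i x)).congr_deriv (by simp)

theorem pderiv_add {φ ψ : T2 → ℝ} (hφ : IsTest φ) (hψ : IsTest ψ) (i : Fin 2) (x : T2) :
    pderiv i (fun x => φ x + ψ x) x = pderiv i φ x + pderiv i ψ x :=
  pderiv_eq_of_hasDerivAt ((hφ.hasDerivAt i x).add (hψ.hasDerivAt i x))

theorem pderiv_const_mul {φ : T2 → ℝ} (hφ : IsTest φ) (c : ℝ) (i : Fin 2) (x : T2) :
    pderiv i (fun x => c * φ x) x = c * pderiv i φ x :=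
  pderiv_eq_of_hasDerivAt ((hφ.hasDerivAt i x).const_mul c)

theorem pderiv_sum {ι : Type*} {φ : ι → T2 → ℝ} (F : Finset ι) (hφ : ∀ k ∈ F, IsTest (φ k))
    (i : Fin 2) (x : T2) :
    pderiv i (fun x => ∑ k ∈ F, φ k x) x = ∑ k ∈ F, pderiv i (φ k) x := by
  refine pderiv_eq_of_hasDerivAt ?_
  have h := HasDerivAt.sum fun k hk => (hφ k hk).hasDerivAt i x
  refine h.congr_of_eventuallyEq (Filter.Eventually.of_forall fun s => ?_)
  simp

theorem integrable_of_continuous {E : Type*} [NormedAddCommGroup E] {h : T2 → E}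
    (hh : Continuous h) : Integrable h torusMeasure :=
  hh.integrable_of_hasCompactSupport (HasCompactSupport.of_compactSpace h)

/-- By translation invariance the integral of `φ` shifted by `s` does not depend on `s`;
differentiate under the integral at `s = 0`. -/
theorem integral_pderiv {φ : T2 → ℝ} (hφ : IsTest φ) (i : Fin 2) :
    ∫ x, pderiv i φ x ∂torusMeasure = 0 := by
  obtain ⟨c, hc⟩ := (isCompact_range (continuous_pderiv i hφ)).isBounded.exists_norm_le
  have hshift : ∀ s : ℝ, Continuous fun x : T2 => x + Pi.single i (s : UnitAddCircle) := fun s =>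
    continuous_id.add continuous_const
  let Φ : ℝ → T2 → ℝ := fun s x => φ (x + Pi.single i (s : UnitAddCircle))
  let Φ' : ℝ → T2 → ℝ := fun s x => pderiv i φ (x + Pi.single i (s : UnitAddCircle))
  have hΦ : ∀ s, Continuous (Φ s) := fun s => hφ.continuous.comp (hshift s)
  have hΦ' : ∀ s, Continuous (Φ' s) := fun s => (continuous_pderiv i hφ).comp (hshift s)
  have h : HasDerivAt (fun s => ∫ x, Φ s x ∂torusMeasure) (∫ x, Φ' 0 x ∂torusMeasure) 0 :=
    (hasDerivAt_integral_of_dominated_loc_of_deriv_le (μ := torusMeasure) (F := Φ) (x₀ := (0 : ℝ))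
    (F' := Φ') (s := univ) (bound := fun _ => c) Filter.univ_mem
    (Filter.Eventually.of_forall fun s => (hΦ s).aestronglyMeasurable)
    (integrable_of_continuous (hΦ 0)) (hΦ' 0).aestronglyMeasurable
    (Filter.Eventually.of_forall fun x s _ => hc _ (mem_range_self _))
    (integrable_const c)
    (Filter.Eventually.of_forall fun x s _ => hφ.hasDerivAt_shift i x s)).2
  have h1 : (fun s => ∫ x, Φ s x ∂torusMeasure) = fun _ => ∫ x, φ x ∂torusMeasure := by
    funext s
    exact integral_add_right_eq_self φ _
  rw [h1] at h
  have h3 := h.unique (hasDerivAt_const (0 : ℝ) _)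
  simpa [Φ'] using h3

theorem integral_mul_pderiv {φ ψ : T2 → ℝ} (hφ : IsTest φ) (hψ : IsTest ψ) (i : Fin 2) :
    ∫ x, ψ x * pderiv i φ x ∂torusMeasure = -∫ x, pderiv i ψ x * φ x ∂torusMeasure := by
  have h := integral_pderiv (hψ.mul hφ) i
  simp only [pderiv_mul hψ hφ] at h
  rw [integral_add] at h
  · linarith
  · exact integrable_of_continuous ((continuous_pderiv i hψ).mul hφ.continuous)
  · exact integrable_of_continuous (hψ.continuous.mul (continuous_pderiv i hφ))

end TestFunctions

/-! ### The Hartley functions `cos (2π k·x) + sin (2π k·x)` -/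

section Hartley

open UnitAddTorus

/-- The Hartley function `cos (2π k·x) + sin (2π k·x)` on the torus. -/
def hart (k : Fin 2 → ℤ) (x : T2) : ℝ := (mFourier k x).re + (mFourier k x).im

theorem continuous_hart (k : Fin 2 → ℤ) : Continuous (hart k) :=
  (Complex.continuous_re.comp (mFourier k).continuous).add
    (Complex.continuous_im.comp (mFourier k).continuous)

theorem abs_hart_le (k : Fin 2 → ℤ) (x : T2) : |hart k x| ≤ 2 := by
  have h : ‖mFourier k x‖ ≤ 1 := ((mFourier k).norm_coe_le_norm x).trans mFourier_norm.le
  have h1 := (Complex.abs_re_le_norm (mFourier k x)).trans h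
  have h2 := (Complex.abs_im_le_norm (mFourier k x)).trans h
  exact (abs_add_le _ _).trans (by linarith)

theorem hart_neg (k : Fin 2 → ℤ) (x : T2) :
    hart (-k) x = (mFourier k x).re - (mFourier k x).im := by
  simp [hart, mFourier_neg, sub_eq_add_neg]

/-- The cosine of the difference plus the sine of the sum. Integrating, the first gives the
Kronecker delta and the second always gives zero, so these real functions are orthonormal with one
function per frequency. -/
theorem hart_mul_hart (k l : Fin 2 → ℤ) (x : T2) :
    hart k x * hart l x = (mFourier (k + -l) x).re + (mFourier (k + l) x).im := by
  rw [mFourier_add, mFourier_add, mFourier_neg]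
  simp only [hart, Complex.mul_re, Complex.mul_im, Complex.conj_re, Complex.conj_im]
  ring

theorem mFourier_proj (k : Fin 2 → ℤ) (y : Fin 2 → ℝ) :
    mFourier k (proj y) = Complex.exp (∑ j, 2 * Real.pi * Complex.I * k j * y j) := by
  simp only [mFourier, ContinuousMap.coe_mk, proj, fourier_coe_apply, Complex.exp_sum,
    Complex.ofReal_one, div_one]

theorem isTest_hart (k : Fin 2 → ℤ) : IsTest (hart k) := by
  have h : ContDiff ℝ ∞ fun y : Fin 2 → ℝ =>
      Complex.exp (∑ j, 2 * Real.pi * Complex.I * k j * y j) := by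
    refine ContDiff.cexp (ContDiff.sum fun j _ => contDiff_const.mul ?_)
    exact Complex.ofRealCLM.contDiff.comp (contDiff_apply ℝ ℝ j)
  unfold IsTest hart
  simp only [mFourier_proj]
  exact (Complex.reCLM.contDiff.comp h).add (Complex.imCLM.contDiff.comp h)

theorem mFourier_add_single (k : Fin 2 → ℤ) (x : T2) (i : Fin 2) (s : ℝ) :
    mFourier k (x + Pi.single i (s : UnitAddCircle))
      = mFourier k x * Complex.exp (2 * Real.pi * Complex.I * k i * s) := by
  obtain ⟨y, rfl⟩ := proj_surjective x
  rw [proj_add_single, mFourier_proj, mFourier_proj, ← Complex.exp_add]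
  congr 1
  simp only [Pi.add_apply, Pi.smul_apply, smul_eq_mul, Complex.ofReal_add, mul_add,
    Finset.sum_add_distrib]
  congr 1
  rw [Finset.sum_eq_single i]
  · simp
  · intro j _ hj
    simp [hj]
  · simp

/-- Differentiating cosine plus sine gives cosine minus sine, that is, the reflected frequency. This
is the source of every `-k` in the formulas for weak derivatives. -/
theorem pderiv_hart (k : Fin 2 → ℤ) (i : Fin 2) (x : T2) :
    pderiv i (hart k) x = 2 * Real.pi * k i * hart (-k) x := by
  refine pderiv_eq_of_hasDerivAt ?_
  have h1 : HasDerivAt (fun s : ℝ => mFourier k (x + Pi.single i (s : UnitAddCircle)))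
      (mFourier k x * (2 * Real.pi * Complex.I * k i)) 0 := by
    simp only [mFourier_add_single]
    have h2 : HasDerivAt (fun s : ℝ => 2 * Real.pi * Complex.I * k i * (s : ℂ))
        (2 * Real.pi * Complex.I * k i * 1) 0 :=
      (Complex.ofRealCLM.hasDerivAt (x := (0 : ℝ))).const_mul _
    have h3 := h2.cexp.const_mul (mFourier k x)
    simpa using h3
  have hre := Complex.reCLM.hasFDerivAt.comp_hasDerivAt (0 : ℝ) h1
  have him := Complex.imCLM.hasFDerivAt.comp_hasDerivAt (0 : ℝ) h1
  refine (hre.add him).congr_deriv ?_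
  rw [hart_neg]
  simp
  ring

theorem integral_mFourier (k : Fin 2 → ℤ) :
    ∫ x, mFourier k x ∂torusMeasure = if k = 0 then 1 else 0 := by
  have h := orthonormal_iff_ite.1 (orthonormal_mFourier (d := Fin 2)) 0 k
  simp only [ContinuousMap.inner_toLp, mFourier_zero, ContinuousMap.one_apply, map_one,
    mul_one] at h
  exact h.trans (if_congr eq_comm rfl rfl)

theorem integral_hart_mul_hart (k l : Fin 2 → ℤ) :
    ∫ x, hart k x * hart l x ∂torusMeasure = if k = l then 1 else 0 := by
  have hi : ∀ k : Fin 2 → ℤ, Integrable (fun x => mFourier k x) torusMeasure := fun k =>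
    integrable_of_continuous (mFourier k).continuous
  have hre : ∀ k : Fin 2 → ℤ, Integrable (fun x => (mFourier k x).re) torusMeasure := fun k =>
    (hi k).re
  have him : ∀ k : Fin 2 → ℤ, Integrable (fun x => (mFourier k x).im) torusMeasure := fun k =>
    (hi k).im
  simp only [hart_mul_hart]
  rw [integral_add (hre _) (him _)]
  have h1 := integral_re (hi (k + -l))
  have h2 := integral_im (hi (k + l))
  simp only [RCLike.re_to_complex, RCLike.im_to_complex] at h1 h2
  refine (congrArg₂ (· + ·) h1 h2).trans ?_
  rw [integral_mFourier, integral_mFourier]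
  have h3 : k + -l = 0 ↔ k = l := by rw [← sub_eq_add_neg, sub_eq_zero]
  simp only [h3]
  split_ifs <;> simp

/-- The Hartley functions are complete. -/
theorem ae_eq_zero_of_integral_hart {g : T2 → ℝ} (hg : MemLp g 2 torusMeasure)
    (h : ∀ k, ∫ x, hart k x * g x ∂torusMeasure = 0) : g =ᵐ[torusMeasure] 0 := by
  have hi : Integrable g torusMeasure := hg.integrable one_le_two
  have hgC : MemLp (fun x => (g x : ℂ)) 2 torusMeasure := hg.ofReal
  have hbd : ∀ k, Integrable (fun x => hart k x * g x) torusMeasure := fun k =>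
    hi.bdd_mul (continuous_hart k).aestronglyMeasurable
      (Filter.Eventually.of_forall (abs_hart_le k))
  -- Each character is a complex combination of `hart k` and `hart (-k)`, so the complex Fourier
  -- coefficients vanish as well.
  have hcoef : ∀ k, ∫ x, mFourier (-k) x • (g x : ℂ) ∂torusMeasure = 0 := by
    intro k
    have hrw : ∀ x, mFourier (-k) x • (g x : ℂ)
        = ((hart k x * g x : ℝ) : ℂ) * ((1 - Complex.I) / 2)
          + ((hart (-k) x * g x : ℝ) : ℂ) * ((1 + Complex.I) / 2) := by
      intro x
      rw [mFourier_neg, hart_neg, hart, smul_eq_mul]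
      apply Complex.ext
      · simp [Complex.mul_re]
        ring
      · simp [Complex.mul_im]
        ring
    simp only [hrw]
    rw [integral_add ((hbd k).ofReal.mul_const _) ((hbd (-k)).ofReal.mul_const _),
      integral_mul_const, integral_mul_const, integral_complex_ofReal, integral_complex_ofReal,
      h, h]
    simp
  set G : Lp ℂ 2 torusMeasure := hgC.toLp _ with hG
  have hGg : (G : T2 → ℂ) =ᵐ[torusMeasure] fun x => (g x : ℂ) := hgC.coeFn_toLp
  have hrepr : ∀ k, (mFourierBasis (d := Fin 2)).repr G k = 0 := by
    intro k
    rw [mFourierBasis_repr]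
    refine Eq.trans (integral_congr_ae ?_) (hcoef k)
    filter_upwards [hGg] with x hx
    rw [hx]
  have hG0 : G = 0 := by
    apply (mFourierBasis (d := Fin 2)).repr.injective
    ext k
    rw [hrepr k, map_zero]
    rfl
  filter_upwards [hGg, Lp.coeFn_zero ℂ 2 torusMeasure] with x h1 h2
  rw [hG0, h2] at h1
  simpa using h1.symm

end Hartley

/-! ### Fourier analysis of vector fields -/

section FourierL2

theorem memLp_component (u : L2) (j : Fin 2) : MemLp (fun x => u x j) 2 torusMeasure :=
  (EuclideanSpace.proj (𝕜 := ℝ) j).comp_memLp' (Lp.memLp u)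

theorem integrable_component (u : L2) (j : Fin 2) :
    Integrable (fun x => u x j) torusMeasure :=
  (memLp_component u j).integrable one_le_two

theorem integrable_mul_component (u : L2) (j : Fin 2) {φ : T2 → ℝ} (hφ : Continuous φ) :
    Integrable (fun x => φ x * u x j) torusMeasure := by
  obtain ⟨c, hc⟩ := (isCompact_range hφ).isBounded.exists_norm_le
  exact (integrable_component u j).bdd_mul (c := c) hφ.aestronglyMeasurable
    (Filter.Eventually.of_forall fun x => hc _ (mem_range_self x))

theorem integrable_smul_field (u : L2) {φ : T2 → ℝ} (hφ : Continuous φ) :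
    Integrable (fun x => φ x • u x) torusMeasure := by
  obtain ⟨c, hc⟩ := (isCompact_range hφ).isBounded.exists_norm_le
  exact ((Lp.memLp u).integrable (by norm_num)).bdd_smul c hφ.aestronglyMeasurable
    (Filter.Eventually.of_forall fun x => hc _ (mem_range_self x))

theorem integral_apply {h : T2 → R2} (hh : Integrable h torusMeasure) (j : Fin 2) :
    (∫ x, h x ∂torusMeasure) j = ∫ x, h x j ∂torusMeasure :=
  ((EuclideanSpace.proj (𝕜 := ℝ) j).integral_comp_comm hh).symm

theorem integral_smul_field_apply (u : L2) {φ : T2 → ℝ} (hφ : Continuous φ) (j : Fin 2) :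
    (∫ x, φ x • u x ∂torusMeasure) j = ∫ x, φ x * u x j ∂torusMeasure := by
  rw [integral_apply (integrable_smul_field u hφ)]
  simp

/-- The field with `j`-th component `φ` and the other component zero. -/
def compField (j : Fin 2) (φ : T2 → ℝ) (hφ : Continuous φ) : L2 :=
  ContinuousMap.toLp 2 torusMeasure ℝ
    ⟨fun x => EuclideanSpace.single j (φ x), by
      refine (PiLp.continuous_toLp 2 _).comp (continuous_pi fun l => ?_)
      by_cases h : l = j
      · subst h; simpa using hφ
      · simpa [h] using continuous_const⟩

theorem coeFn_compField (j : Fin 2) {φ : T2 → ℝ} (hφ : Continuous φ) :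
    compField j φ hφ =ᵐ[torusMeasure] fun x => EuclideanSpace.single j (φ x) :=
  ContinuousMap.coeFn_toLp torusMeasure _

theorem inner_compField (j : Fin 2) {φ : T2 → ℝ} (hφ : Continuous φ) (u : L2) :
    ⟪compField j φ hφ, u⟫_ℝ = ∫ x, φ x * u x j ∂torusMeasure := by
  rw [L2.inner_def]
  refine integral_congr_ae ?_
  filter_upwards [coeFn_compField j hφ] with x hx
  rw [hx, EuclideanSpace.inner_single_left]
  simp

/-- The Hartley coefficients of a vector field. -/
def coef (u : L2) (k : Fin 2 → ℤ) (j : Fin 2) : ℝ := ∫ x, hart k x * u x j ∂torusMeasure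

theorem coef_compField (j : Fin 2) {φ : T2 → ℝ} (hφ : Continuous φ) (k : Fin 2 → ℤ) (m : Fin 2) :
    coef (compField j φ hφ) k m = if m = j then ∫ x, hart k x * φ x ∂torusMeasure else 0 := by
  have h : coef (compField j φ hφ) k m
      = ∫ x, hart k x * (EuclideanSpace.single j (φ x) : R2) m ∂torusMeasure := by
    refine integral_congr_ae ?_
    filter_upwards [coeFn_compField j hφ] with x hx
    rw [hx]
  rw [h]
  split_ifs with hm
  · subst hm; simp
  · simp [hm]

theorem orthonormal_compField_hart : Orthonormal ℝ
    fun p : (Fin 2 → ℤ) × Fin 2 => compField p.2 (hart p.1) (continuous_hart p.1) := by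
  rw [orthonormal_iff_ite]
  rintro ⟨k, j⟩ ⟨l, m⟩
  rw [inner_compField]
  refine (coef_compField m (continuous_hart l) k j).trans ?_
  rw [integral_hart_mul_hart]
  simp only [Prod.mk.injEq, ← ite_and, and_comm]

theorem eq_zero_of_coef {u : L2} (h : ∀ k j, coef u k j = 0) : u = 0 := by
  have h0 : ∀ j, (fun x => u x j) =ᵐ[torusMeasure] 0 := fun j =>
    ae_eq_zero_of_integral_hart (memLp_component u j) fun k => h k j
  refine Lp.ext ?_
  filter_upwards [h0 0, h0 1, Lp.coeFn_zero R2 2 torusMeasure] with x h1 h2 h3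
  rw [h3]
  ext j
  fin_cases j
  · exact h1
  · exact h2

theorem orthogonal_span_hart : (Submodule.span ℝ (range
    fun p : (Fin 2 → ℤ) × Fin 2 => compField p.2 (hart p.1) (continuous_hart p.1)))ᗮ = ⊥ := by
  rw [Submodule.eq_bot_iff]
  intro u hu
  refine eq_zero_of_coef fun k j => ?_
  have := (Submodule.mem_orthogonal _ u).1 hu _ (Submodule.subset_span ⟨(k, j), rfl⟩)
  rwa [inner_compField] at this

/-- The Hartley basis of `L²(𝕋², ℝ²)`. -/
def basisL2 : HilbertBasis ((Fin 2 → ℤ) × Fin 2) ℝ L2 :=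
  HilbertBasis.mkOfOrthogonalEqBot orthonormal_compField_hart orthogonal_span_hart

theorem inner_basisL2 (p : (Fin 2 → ℤ) × Fin 2) (u : L2) :
    ⟪basisL2 p, u⟫_ℝ = coef u p.1 p.2 := by
  rw [basisL2, HilbertBasis.coe_mkOfOrthogonalEqBot, inner_compField]
  rfl

theorem ext_coef {u v : L2} (h : ∀ k j, coef u k j = coef v k j) : u = v :=
  ext_coord basisL2 fun p => by rw [inner_basisL2, inner_basisL2, h]

theorem hasSum_coef_mul (u v : L2) :
    HasSum (fun p : (Fin 2 → ℤ) × Fin 2 => coef u p.1 p.2 * coef v p.1 p.2) ⟪u, v⟫_ℝ := by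
  simpa only [inner_basisL2] using hasSum_coord_mul basisL2 u v

theorem hasSum_coef_sq (u : L2) :
    HasSum (fun p : (Fin 2 → ℤ) × Fin 2 => coef u p.1 p.2 ^ 2) (‖u‖ ^ 2) := by
  simpa only [inner_basisL2] using hasSum_coord_sq basisL2 u

theorem exists_coef_eq {c : (Fin 2 → ℤ) → Fin 2 → ℝ}
    (hc : Summable fun p : (Fin 2 → ℤ) × Fin 2 => c p.1 p.2 ^ 2) :
    ∃ u : L2, ∀ k j, coef u k j = c k j := by
  obtain ⟨u, hu⟩ := exists_coord_eq basisL2 (c := fun p => c p.1 p.2) hc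
  exact ⟨u, fun k j => by rw [← inner_basisL2 (k, j), hu]⟩

theorem coef_add (u v : L2) (k : Fin 2 → ℤ) (j : Fin 2) :
    coef (u + v) k j = coef u k j + coef v k j := by
  simp only [← inner_basisL2 (k, j), inner_add_right]

theorem coef_neg (u : L2) (k : Fin 2 → ℤ) (j : Fin 2) : coef (-u) k j = -coef u k j := by
  simp only [← inner_basisL2 (k, j), inner_neg_right]

theorem coef_smul (c : ℝ) (u : L2) (k : Fin 2 → ℤ) (j : Fin 2) :
    coef (c • u) k j = c * coef u k j := by
  simp only [← inner_basisL2 (k, j), inner_smul_right]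

theorem coef_sum {ι : Type*} (F : Finset ι) (u : ι → L2) (k : Fin 2 → ℤ) (j : Fin 2) :
    coef (∑ i ∈ F, u i) k j = ∑ i ∈ F, coef (u i) k j := by
  simp only [← inner_basisL2 (k, j), inner_sum]

/-- Parseval's identity against a scalar function. -/
theorem hasSum_integral_mul_component (u : L2) (j : Fin 2) {φ : T2 → ℝ} (hφ : Continuous φ) :
    HasSum (fun k => (∫ x, hart k x * φ x ∂torusMeasure) * coef u k j)
      (∫ x, φ x * u x j ∂torusMeasure) := by
  have h := hasSum_coef_mul (compField j φ hφ) u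
  rw [inner_compField] at h
  have hinj : Function.Injective fun k : Fin 2 → ℤ => (k, j) := fun k l hkl => by
    simpa using hkl
  rw [← hinj.hasSum_iff] at h
  · simpa only [Function.comp_def, coef_compField, if_true] using h
  · rintro ⟨k, m⟩ hm
    have : m ≠ j := fun hmj => hm ⟨k, by rw [hmj]⟩
    simp [coef_compField, this]

/-- Reflection of the frequency. -/
def negFreq : (Fin 2 → ℤ) × Fin 2 ≃ (Fin 2 → ℤ) × Fin 2 :=
  (Equiv.neg _).prodCongr (Equiv.refl _)

/-- One direction tests with `hart k`. For the other, Parseval expands both integrals, and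
integration by parts matches the terms after reflecting the frequency. -/
theorem isWeakPartial_iff (i : Fin 2) (u g : L2) :
    IsWeakPartial i u g ↔ ∀ k j, coef g k j = -(2 * Real.pi * k i * coef u (-k) j) := by
  constructor
  · intro h k j
    have h1 := congrArg (fun v : R2 => v j) (h (hart k) (isTest_hart k))
    simp only [PiLp.neg_apply] at h1
    rw [integral_smul_field_apply u (continuous_pderiv i (isTest_hart k)),
      integral_smul_field_apply g (continuous_hart k)] at h1
    simp only [pderiv_hart, mul_assoc] at h1
    rw [integral_const_mul, integral_const_mul, integral_const_mul] at h1
    simp only [coef]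
    linarith
  · intro h φ hφ
    ext j
    rw [PiLp.neg_apply, integral_smul_field_apply u (continuous_pderiv i hφ),
      integral_smul_field_apply g hφ.continuous]
    have h1 := hasSum_integral_mul_component u j (continuous_pderiv i hφ)
    have h2 := (hasSum_integral_mul_component g j hφ.continuous).neg
    rw [← (Equiv.neg (Fin 2 → ℤ)).hasSum_iff] at h2
    refine h1.unique (h2.congr_fun fun k => ?_)
    simp only [Function.comp, Equiv.neg_apply, h, neg_neg]
    rw [integral_mul_pderiv hφ (isTest_hart k)]
    simp only [pderiv_hart, mul_assoc]
    rw [integral_const_mul, integral_const_mul, integral_const_mul]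
    simp only [Pi.neg_apply, Int.cast_neg]
    ring

theorem exists_isWeakPartial_iff (i : Fin 2) (u : L2) : (∃ g, IsWeakPartial i u g) ↔
    Summable fun p : (Fin 2 → ℤ) × Fin 2 => (2 * Real.pi * p.1 i * coef u p.1 p.2) ^ 2 := by
  rw [← negFreq.summable_iff]
  constructor
  · rintro ⟨g, hg⟩
    rw [isWeakPartial_iff] at hg
    refine (hasSum_coef_sq g).summable.congr fun p => ?_
    rw [hg]
    simp [negFreq]
  · intro h
    obtain ⟨g, hg⟩ := exists_coef_eq (c := fun k j => -(2 * Real.pi * k i * coef u (-k) j))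
      (h.congr fun p => by simp [negFreq])
    exact ⟨g, (isWeakPartial_iff i u g).2 hg⟩

theorem coef_wpartial {i : Fin 2} {u : L2} (h : ∃ g, IsWeakPartial i u g) (k : Fin 2 → ℤ)
    (j : Fin 2) : coef (wpartial i u) k j = -(2 * Real.pi * k i * coef u (-k) j) := by
  rw [wpartial, dif_pos h]
  exact (isWeakPartial_iff i u _).1 h.choose_spec k j

theorem wpartial_eq {i : Fin 2} {u g : L2} (h : IsWeakPartial i u g) : wpartial i u = g :=
  ext_coef fun k j => by rw [coef_wpartial ⟨g, h⟩, (isWeakPartial_iff i u g).1 h]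

theorem hasSum_norm_wpartial_sq {i : Fin 2} {u : L2} (h : ∃ g, IsWeakPartial i u g) :
    HasSum (fun p : (Fin 2 → ℤ) × Fin 2 => (2 * Real.pi * p.1 i * coef u p.1 p.2) ^ 2)
      (‖wpartial i u‖ ^ 2) := by
  rw [← negFreq.hasSum_iff]
  refine (hasSum_coef_sq (wpartial i u)).congr_fun fun p => ?_
  rw [coef_wpartial h]
  simp [negFreq]

end FourierL2

/-! ### The space `H` in Fourier variables -/

section SpaceH

theorem hart_zero (x : T2) : hart 0 x = 1 := by
  simp [hart, UnitAddTorus.mFourier_zero]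

/-- The mean is the coefficient at frequency zero. Testing the divergence with `hart (-k)`, whose
gradient is proportional to `k` times `hart k`, isolates one frequency; Parseval gives the converse.
-/
theorem mem_H_iff (u : L2) :
    u ∈ H ↔ (∀ j, coef u 0 j = 0) ∧ ∀ k, ∑ i, (k i : ℝ) * coef u k i = 0 := by
  have hmean : ∀ j, coef u 0 j = (∫ x, u x ∂torusMeasure) j := fun j => by
    rw [integral_apply ((Lp.memLp u).integrable (by norm_num))]
    simp only [coef, hart_zero, one_mul]
  have hint : ∀ φ : T2 → ℝ, IsTest φ → ∫ x, ∑ i, pderiv i φ x * u x i ∂torusMeasure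
      = ∑ i, ∫ x, pderiv i φ x * u x i ∂torusMeasure := fun φ hφ =>
    integral_finsetSum _ fun i _ => integrable_mul_component u i (continuous_pderiv i hφ)
  constructor
  · rintro ⟨h0, hdiv⟩
    refine ⟨fun j => by rw [hmean, h0]; rfl, fun k => ?_⟩
    have h := hdiv _ (isTest_hart (-k))
    rw [hint _ (isTest_hart (-k))] at h
    simp only [pderiv_hart, neg_neg, mul_assoc] at h
    simp only [integral_const_mul, ← Finset.mul_sum] at h
    simp only [Pi.neg_apply, Int.cast_neg, neg_mul, Finset.sum_neg_distrib, mul_neg,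
      neg_eq_zero] at h
    simpa only [coef, mul_eq_zero, two_ne_zero, Real.pi_pos.ne', false_or] using h
  · rintro ⟨h0, hdiv⟩
    refine ⟨?_, fun φ hφ => ?_⟩
    · ext j
      rw [← hmean, h0]
      rfl
    · rw [hint φ hφ]
      have h := hasSum_sum (s := Finset.univ) fun i _ =>
        hasSum_integral_mul_component u i (continuous_pderiv i hφ)
      refine h.unique ?_
      convert hasSum_zero with k
      calc ∑ i, (∫ x, hart k x * pderiv i φ x ∂torusMeasure) * coef u k i
          = ∑ i, -(2 * Real.pi * ∫ x, hart (-k) x * φ x ∂torusMeasure) * (k i * coef u k i) := by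
            refine Finset.sum_congr rfl fun i _ => ?_
            rw [integral_mul_pderiv hφ (isTest_hart k)]
            simp only [pderiv_hart, mul_assoc]
            rw [integral_const_mul, integral_const_mul, integral_const_mul]
            ring
        _ = 0 := by rw [← Finset.mul_sum, hdiv, mul_zero]

theorem isClosed_H : IsClosed (H : Set L2) := by
  have hc : ∀ k j, Continuous fun u : L2 => coef u k j := fun k j => by
    simp only [← inner_basisL2 (k, j)]
    fun_prop
  have h : (H : Set L2)
      = (⋂ j, {u | coef u 0 j = 0}) ∩ ⋂ k, {u | ∑ i, (k i : ℝ) * coef u k i = 0} := by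
    ext u
    simpa using mem_H_iff u
  rw [h]
  refine (isClosed_iInter fun j => isClosed_eq (hc 0 j) continuous_const).inter
    (isClosed_iInter fun k => isClosed_eq ?_ continuous_const)
  exact continuous_finsetSum _ fun i _ => continuous_const.mul (hc k i)

instance : CompleteSpace H := isClosed_H.completeSpace_coe

/-- Nonzero frequencies. -/
abbrev Freq : Type := {k : Fin 2 → ℤ // k ≠ 0}

/-- The eigenvalues of `-Δ`. -/
def eig (k : Fin 2 → ℤ) : ℝ := (2 * Real.pi) ^ 2 * ((k 0 : ℝ) ^ 2 + (k 1 : ℝ) ^ 2)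

theorem one_le_freq_sq {k : Fin 2 → ℤ} (hk : k ≠ 0) : (1 : ℝ) ≤ (k 0 : ℝ) ^ 2 + (k 1 : ℝ) ^ 2 := by
  have h : (1 : ℤ) ≤ k 0 ^ 2 + k 1 ^ 2 := by
    by_contra hlt
    have h0 : k 0 = 0 := by nlinarith [sq_nonneg (k 0), sq_nonneg (k 1), sq_nonneg (k 0 - 1)]
    have h1 : k 1 = 0 := by nlinarith [sq_nonneg (k 0), sq_nonneg (k 1)]
    refine hk (funext fun i => ?_)
    fin_cases i
    · exact h0
    · exact h1
  exact_mod_cast h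

theorem one_le_eig {k : Fin 2 → ℤ} (hk : k ≠ 0) : 1 ≤ eig k := by
  have h := one_le_freq_sq hk
  have hpi : (1 : ℝ) ≤ (2 * Real.pi) ^ 2 := by nlinarith [Real.pi_gt_three]
  unfold eig
  nlinarith

theorem eig_nonneg (k : Fin 2 → ℤ) : 0 ≤ eig k := by
  unfold eig
  positivity

theorem sq_le_eig (k : Fin 2 → ℤ) (i : Fin 2) : (2 * Real.pi * k i) ^ 2 ≤ eig k := by
  have h0 := sq_nonneg (2 * Real.pi * k 0)
  have h1 := sq_nonneg (2 * Real.pi * k 1)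
  unfold eig
  fin_cases i
  · simp only [Fin.zero_eta]
    nlinarith
  · simp only [Fin.mk_one]
    nlinarith

theorem sum_sq_eq_eig (k : Fin 2 → ℤ) : ∑ i, (2 * Real.pi * k i) ^ 2 = eig k := by
  rw [Fin.sum_univ_two, eig]
  ring

theorem exists_le_eig (r : ℝ) : ∃ F : Finset Freq, ∀ k ∉ F, r ≤ eig (k : Fin 2 → ℤ) := by
  have hfin : {k : Freq | eig (k : Fin 2 → ℤ) < r}.Finite := by
    obtain ⟨n, hn⟩ := exists_nat_gt r
    refine Set.Finite.of_finite_image (f := Subtype.val) ?_ Subtype.val_injective.injOn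
    refine (Set.finite_Icc (fun _ => -(n : ℤ) : Fin 2 → ℤ) fun _ => (n : ℤ)).subset ?_
    rintro _ ⟨k, hk, rfl⟩
    have habs : ∀ i, |k.1 i| ≤ (n : ℤ) := by
      intro i
      by_contra hlt
      have h1 : (1 : ℤ) ≤ |k.1 i| := by omega
      have h2 : ((n : ℤ) : ℝ) < |(k.1 i : ℝ)| := by exact_mod_cast not_le.1 hlt
      have h3 : (1 : ℝ) ≤ |(k.1 i : ℝ)| := by exact_mod_cast h1
      have h4 := sq_le_eig k.1 i
      have h5 : |(k.1 i : ℝ)| ≤ (2 * Real.pi * k.1 i) ^ 2 := by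
        rw [mul_pow, ← sq_abs (k.1 i : ℝ)]
        have hpi : (1 : ℝ) ≤ (2 * Real.pi) ^ 2 := by nlinarith [Real.pi_gt_three]
        nlinarith [mul_le_mul hpi h3 zero_le_one (by positivity)]
      have h6 : eig k.1 < r := hk
      push_cast at h2
      linarith
    exact ⟨fun i => (abs_le.1 (habs i)).1, fun i => (abs_le.1 (habs i)).2⟩
  refine ⟨hfin.toFinset, fun k hk => ?_⟩
  simpa using hk

/-- The unit vector orthogonal to the frequency `k`. -/
def polar (k : Fin 2 → ℤ) : Fin 2 → ℝ :=
  ![-(k 1 : ℝ) / √((k 0 : ℝ) ^ 2 + (k 1 : ℝ) ^ 2), (k 0 : ℝ) / √((k 0 : ℝ) ^ 2 + (k 1 : ℝ) ^ 2)]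

theorem sum_polar_sq {k : Fin 2 → ℤ} (hk : k ≠ 0) : ∑ j, polar k j ^ 2 = 1 := by
  have h := one_le_freq_sq hk
  simp only [Fin.sum_univ_two, polar, Matrix.cons_val_zero, Matrix.cons_val_one, div_pow]
  rw [Real.sq_sqrt (by linarith)]
  field_simp
  ring

theorem abs_polar_le {k : Fin 2 → ℤ} (hk : k ≠ 0) (j : Fin 2) : |polar k j| ≤ 1 := by
  rw [← sq_le_one_iff_abs_le_one, ← sum_polar_sq hk]
  exact Finset.single_le_sum (f := fun j => polar k j ^ 2) (fun _ _ => sq_nonneg _)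
    (Finset.mem_univ j)

theorem sum_mul_polar (k : Fin 2 → ℤ) : ∑ i, (k i : ℝ) * polar k i = 0 := by
  simp only [Fin.sum_univ_two, polar, Matrix.cons_val_zero, Matrix.cons_val_one]
  ring

/-- In the plane the vectors orthogonal to `k` form a line, so a divergence-free field has one
scalar coefficient per frequency. -/
theorem eq_mul_polar {k : Fin 2 → ℤ} (hk : k ≠ 0) {c : Fin 2 → ℝ}
    (hc : ∑ i, (k i : ℝ) * c i = 0) (j : Fin 2) : c j = (∑ m, polar k m * c m) * polar k j := by
  have h := one_le_freq_sq hk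
  rw [Fin.sum_univ_two] at hc
  have hs : √((k 0 : ℝ) ^ 2 + (k 1 : ℝ) ^ 2) ≠ 0 := (Real.sqrt_pos.2 (by linarith)).ne'
  have hs2 := Real.sq_sqrt (show (0 : ℝ) ≤ (k 0 : ℝ) ^ 2 + (k 1 : ℝ) ^ 2 by linarith)
  rw [Fin.sum_univ_two]
  fin_cases j
  · simp only [Fin.zero_eta, polar, Matrix.cons_val_zero, Matrix.cons_val_one]
    field_simp
    rw [hs2]
    linear_combination (k 0 : ℝ) * hc
  · simp only [Fin.mk_one, polar, Matrix.cons_val_zero, Matrix.cons_val_one]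
    field_simp
    rw [hs2]
    linear_combination (k 1 : ℝ) * hc

theorem coef_basisL2 (p : (Fin 2 → ℤ) × Fin 2) (l : Fin 2 → ℤ) (m : Fin 2) :
    coef (basisL2 p) l m = if l = p.1 ∧ m = p.2 then 1 else 0 := by
  rw [← inner_basisL2 (l, m), inner_basis_basis]
  simp [Prod.ext_iff]

/-- The field `hart k` in the direction `polar k`. -/
def modeField (k : Fin 2 → ℤ) : L2 := ∑ j, polar k j • basisL2 (k, j)

theorem coef_modeField (k l : Fin 2 → ℤ) (j : Fin 2) :
    coef (modeField k) l j = if l = k then polar k j else 0 := by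
  simp only [modeField, coef_sum, coef_smul, coef_basisL2]
  by_cases h : l = k <;> simp [h]

theorem modeField_mem {k : Fin 2 → ℤ} (hk : k ≠ 0) : modeField k ∈ H := by
  rw [mem_H_iff]
  refine ⟨fun j => by rw [coef_modeField, if_neg hk.symm], fun l => ?_⟩
  simp only [coef_modeField]
  split_ifs with h
  · rw [h]
    exact sum_mul_polar k
  · simp

theorem inner_modeField (k : Fin 2 → ℤ) (u : L2) :
    ⟪modeField k, u⟫_ℝ = ∑ j, polar k j * coef u k j := by
  simp only [modeField, sum_inner, real_inner_smul_left, inner_basisL2]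

theorem orthonormal_modeField :
    Orthonormal ℝ fun k : Freq => (⟨modeField k, modeField_mem k.2⟩ : H) := by
  classical
  rw [orthonormal_iff_ite]
  intro k l
  rw [Submodule.coe_inner]
  simp only [inner_modeField, coef_modeField]
  by_cases h : k = l
  · subst h
    simpa [sq] using sum_polar_sq k.2
  · have h' : (k : Fin 2 → ℤ) ≠ l := fun hkl => h (Subtype.ext hkl)
    simp [h, h']

theorem coef_eq_inner_modeField (u : H) {k : Fin 2 → ℤ} (hk : k ≠ 0) (j : Fin 2) :
    coef u k j = ⟪modeField k, (u : L2)⟫_ℝ * polar k j := by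
  rw [inner_modeField]
  exact eq_mul_polar hk (((mem_H_iff _).1 u.2).2 k) j

theorem orthogonal_span_modeField : (Submodule.span ℝ (range
    fun k : Freq => (⟨modeField k, modeField_mem k.2⟩ : H)))ᗮ = ⊥ := by
  rw [Submodule.eq_bot_iff]
  intro u hu
  refine Subtype.ext (eq_zero_of_coef fun k j => ?_)
  by_cases hk : k = 0
  · rw [hk]
    exact ((mem_H_iff _).1 u.2).1 j
  · have := (Submodule.mem_orthogonal _ u).1 hu _ (Submodule.subset_span ⟨⟨k, hk⟩, rfl⟩)
    rw [Submodule.coe_inner] at this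
    rw [coef_eq_inner_modeField u hk, this, zero_mul]

/-- The basis of `H` of eigenfields of the Stokes operator. -/
def basisH : HilbertBasis Freq ℝ H :=
  HilbertBasis.mkOfOrthogonalEqBot orthonormal_modeField orthogonal_span_modeField

theorem coe_basisH (k : Freq) : (basisH k : L2) = modeField k := by
  rw [basisH, HilbertBasis.coe_mkOfOrthogonalEqBot]

theorem coef_eq (u : H) (k : Freq) (j : Fin 2) :
    coef u k j = ⟪basisH k, u⟫_ℝ * polar k j := by
  rw [coef_eq_inner_modeField u k.2, Submodule.coe_inner, coe_basisH]

theorem coef_zero (u : H) (j : Fin 2) : coef u 0 j = 0 := ((mem_H_iff _).1 u.2).1 j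

/-- Translates weighted sums of Hartley coefficients into coordinates of `H`: the two components
collapse because `polar k` is a unit vector, and frequency zero is absent. Nonnegativity allows the
regrouping. -/
theorem hasSum_weight_iff {w : (Fin 2 → ℤ) → ℝ} (hw : ∀ k, 0 ≤ w k) (u : H) (S : ℝ) :
    HasSum (fun p : (Fin 2 → ℤ) × Fin 2 => w p.1 * coef u p.1 p.2 ^ 2) S
      ↔ HasSum (fun k : Freq => w k * ⟪basisH k, u⟫_ℝ ^ 2) S := by
  have h1 : HasSum (fun k : Freq => w k * ⟪basisH k, u⟫_ℝ ^ 2) S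
      ↔ HasSum (fun k => ∑ j, w k * coef u k j ^ 2) S := by
    have hsupp : Function.support (fun k => ∑ j, w k * coef u k j ^ 2) ⊆ {k | k ≠ 0} := by
      intro k hk h0
      apply hk
      subst h0
      simp [coef_zero]
    rw [← hasSum_subtype_iff_of_support_subset hsupp]
    refine iff_of_eq (congrArg (fun f => HasSum f S) (funext fun k => ?_))
    simp only [Function.comp_def]
    rw [← Finset.mul_sum]
    have : ∀ j, coef u (k : Fin 2 → ℤ) j ^ 2 = ⟪basisH k, u⟫_ℝ ^ 2 * polar k j ^ 2 := fun j => by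
      rw [coef_eq, mul_pow]
    rw [Finset.sum_congr rfl fun j _ => this j, ← Finset.mul_sum, sum_polar_sq k.2, mul_one]
  rw [h1]
  have hfwd : ∀ S, HasSum (fun p : (Fin 2 → ℤ) × Fin 2 => w p.1 * coef u p.1 p.2 ^ 2) S →
      HasSum (fun k => ∑ j, w k * coef u k j ^ 2) S := fun S h =>
    h.prod_fiberwise fun k => hasSum_fintype _
  refine ⟨hfwd S, fun h => ?_⟩
  have hs : Summable (fun p : (Fin 2 → ℤ) × Fin 2 => w p.1 * coef u p.1 p.2 ^ 2) := by
    rw [summable_prod_of_nonneg fun p => mul_nonneg (hw _) (sq_nonneg _)]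
    refine ⟨fun k => (hasSum_fintype _).summable, ?_⟩
    simpa only [tsum_fintype] using h.summable
  have := h.unique (hfwd _ hs.hasSum)
  rw [this]
  exact hs.hasSum

theorem summable_weight_iff {w : (Fin 2 → ℤ) → ℝ} (hw : ∀ k, 0 ≤ w k) (u : H) :
    Summable (fun p : (Fin 2 → ℤ) × Fin 2 => w p.1 * coef u p.1 p.2 ^ 2)
      ↔ Summable fun k : Freq => w k * ⟪basisH k, u⟫_ℝ ^ 2 :=
  exists_congr fun S => hasSum_weight_iff hw u S

theorem exists_isWeakPartial_iff_of_H (i : Fin 2) (u : H) : (∃ g, IsWeakPartial i u g) ↔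
    Summable fun k : Freq => (2 * Real.pi * k.1 i) ^ 2 * ⟪basisH k, u⟫_ℝ ^ 2 := by
  rw [exists_isWeakPartial_iff,
    ← summable_weight_iff (w := fun k => (2 * Real.pi * k i) ^ 2) (fun k => sq_nonneg _)]
  simp only [mul_pow]

theorem mem_V_iff (u : H) :
    u ∈ V ↔ Summable fun k : Freq => eig k * ⟪basisH k, u⟫_ℝ ^ 2 := by
  constructor
  · intro h
    have h' := summable_sum (s := Finset.univ) fun i _ =>
      (exists_isWeakPartial_iff_of_H i u).1 (h i)
    simpa only [← Finset.sum_mul, sum_sq_eq_eig] using h'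
  · intro h i
    refine (exists_isWeakPartial_iff_of_H i u).2 (Summable.of_nonneg_of_le
      (fun k => mul_nonneg (sq_nonneg _) (sq_nonneg _)) (fun k => ?_) h)
    exact mul_le_mul_of_nonneg_right (sq_le_eig _ i) (sq_nonneg _)

theorem hasSum_norm_wpartial_sq_of_H {u : H} (hu : u ∈ V) (i : Fin 2) :
    HasSum (fun k : Freq => (2 * Real.pi * k.1 i) ^ 2 * ⟪basisH k, u⟫_ℝ ^ 2)
      (‖wpartial i u‖ ^ 2) := by
  rw [← hasSum_weight_iff (w := fun k => (2 * Real.pi * k i) ^ 2) (fun k => sq_nonneg _)]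
  simpa only [mul_pow] using hasSum_norm_wpartial_sq (hu i)

theorem hasSum_gradSq {u : H} (hu : u ∈ V) :
    HasSum (fun k : Freq => eig k * ⟪basisH k, u⟫_ℝ ^ 2) (gradSq u) := by
  have h := hasSum_sum (s := Finset.univ) fun i _ => hasSum_norm_wpartial_sq_of_H hu i
  unfold gradSq
  simpa only [← Finset.sum_mul, sum_sq_eq_eig] using h

/-- Two frequency reflections cancel, so second derivatives, and with them the Stokes operator, are
diagonal. -/
theorem coef_wpartial_wpartial {u : L2} {i j : Fin 2} (hi : ∃ g, IsWeakPartial i u g)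
    (hj : ∃ g, IsWeakPartial j (wpartial i u) g) (k : Fin 2 → ℤ) (m : Fin 2) :
    coef (wpartial j (wpartial i u)) k m
      = -(2 * Real.pi * k j * (2 * Real.pi * k i) * coef u k m) := by
  rw [coef_wpartial hj, coef_wpartial hi, neg_neg, Pi.neg_apply]
  push_cast
  ring

theorem exists_second_iff {u : H} (hu : u ∈ V) (i j : Fin 2) :
    (∃ g, IsWeakPartial j (wpartial i u) g) ↔ Summable fun k : Freq =>
      (2 * Real.pi * k.1 j * (2 * Real.pi * k.1 i)) ^ 2 * ⟪basisH k, u⟫_ℝ ^ 2 := by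
  rw [exists_isWeakPartial_iff, ← negFreq.summable_iff, ← summable_weight_iff
    (w := fun k => (2 * Real.pi * k j * (2 * Real.pi * k i)) ^ 2) (fun k => sq_nonneg _)]
  refine summable_congr fun p => ?_
  simp only [Function.comp_def, coef_wpartial (hu i)]
  simp [negFreq]
  ring

theorem hasSum_norm_second_sq {u : H} (hu : u ∈ DA) (i j : Fin 2) :
    HasSum (fun k : Freq => (2 * Real.pi * k.1 j * (2 * Real.pi * k.1 i)) ^ 2
      * ⟪basisH k, u⟫_ℝ ^ 2) (‖wpartial j (wpartial i u)‖ ^ 2) := by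
  rw [← hasSum_weight_iff
    (w := fun k => (2 * Real.pi * k j * (2 * Real.pi * k i)) ^ 2) (fun k => sq_nonneg _)]
  refine (hasSum_coef_sq (wpartial j (wpartial i u))).congr_fun fun p => ?_
  rw [coef_wpartial_wpartial (hu.1 i) (hu.2 i j)]
  ring

theorem sq_mul_le_eig_sq (k : Fin 2 → ℤ) (i j : Fin 2) :
    (2 * Real.pi * k j * (2 * Real.pi * k i)) ^ 2 ≤ eig k ^ 2 := by
  rw [mul_pow, sq (eig k)]
  exact mul_le_mul (sq_le_eig k j) (sq_le_eig k i) (sq_nonneg _) (eig_nonneg k)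

/-- The Stokes eigenvalues, indexed by the nonzero frequencies. -/
def eigH (k : Freq) : ℝ := eig k

theorem mem_V_of_mem_specDom {u : H} (hu : u ∈ specDom basisH eigH) : u ∈ V := by
  rw [mem_V_iff]
  refine Summable.of_nonneg_of_le (fun k => mul_nonneg (eig_nonneg _) (sq_nonneg _))
    (fun k => ?_) hu
  have h := one_le_eig k.2
  rw [mul_pow, eigH]
  exact mul_le_mul_of_nonneg_right (by nlinarith) (sq_nonneg _)

/-- Summed over `i` and `j`, the squared symbols of the second derivatives give the square of the
eigenvalue; conversely each is at most that square. -/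
theorem mem_DA_iff (u : H) : u ∈ DA ↔ u ∈ specDom basisH eigH := by
  constructor
  · intro h
    have h' := summable_sum (s := Finset.univ) fun i _ =>
      summable_sum (s := Finset.univ) fun j _ => (exists_second_iff h.1 i j).1 (h.2 i j)
    refine h'.congr fun k => ?_
    simp only [mul_pow (2 * Real.pi * _) (2 * Real.pi * _), ← Finset.sum_mul, ← Finset.mul_sum,
      sum_sq_eq_eig, eigH]
    ring
  · intro h
    have hV := mem_V_of_mem_specDom h
    refine ⟨hV, fun i j => (exists_second_iff hV i j).2 (Summable.of_nonneg_of_le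
      (fun k => mul_nonneg (sq_nonneg _) (sq_nonneg _)) (fun k => ?_) h)⟩
    rw [mul_pow (eigH k)]
    exact mul_le_mul_of_nonneg_right (sq_mul_le_eig_sq _ i j) (sq_nonneg _)

theorem coef_specOp {u : H} (hu : u ∈ specDom basisH eigH) (k : Fin 2 → ℤ) (j : Fin 2) :
    coef (specOp basisH eigH u : H) k j = eig k * coef u k j := by
  by_cases hk : k = 0
  · subst hk
    simp [coef_zero]
  · rw [coef_eq _ ⟨k, hk⟩, coef_eq u ⟨k, hk⟩, coord_specOp hu, eigH]
    ring

theorem stokesA_eq {u : H} (hu : u ∈ DA) : stokesA u = (specOp basisH eigH u : H) := by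
  refine ext_coef fun k j => ?_
  rw [coef_specOp ((mem_DA_iff u).1 hu), stokesA, coef_neg, coef_sum, ← sum_sq_eq_eig,
    Finset.sum_mul, ← Finset.sum_neg_distrib]
  refine Finset.sum_congr rfl fun i _ => ?_
  rw [coef_wpartial_wpartial (hu.1 i) (hu.2 i i)]
  ring

theorem gradSq_eq {u : H} (hu : u ∈ specDom basisH eigH) :
    gradSq u = ⟪specOp basisH eigH u, u⟫_ℝ := by
  refine (hasSum_gradSq (mem_V_of_mem_specDom hu)).unique ?_
  refine (hasSum_energy hu u).congr_fun fun k => ?_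
  rw [eigH]
  ring

theorem norm_wpartial_sq_le_gradSq (i : Fin 2) (u : L2) : ‖wpartial i u‖ ^ 2 ≤ gradSq u :=
  Finset.single_le_sum (f := fun i => ‖wpartial i u‖ ^ 2) (fun _ _ => sq_nonneg _)
    (Finset.mem_univ i)

theorem norm_second_le {u : H} (hu : u ∈ specDom basisH eigH) (i j : Fin 2) :
    ‖wpartial j (wpartial i u)‖ ≤ ‖specOp basisH eigH u‖ := by
  refine abs_le_of_sq_le_sq' ?_ (norm_nonneg _) |>.2
  refine hasSum_le (fun k => ?_) (hasSum_norm_second_sq ((mem_DA_iff u).2 hu) i j)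
    (hasSum_norm_specOp_sq hu)
  rw [mul_pow (eigH k)]
  exact mul_le_mul_of_nonneg_right (sq_mul_le_eig_sq _ i j) (sq_nonneg _)

end SpaceH

/-! ### The trilinear form -/

/-! ### Boundedness of fields in `D(A)`. -/

section SupBound

theorem norm_sq_le_eig (k : Fin 2 → ℤ) : ‖k‖ ^ 2 ≤ eig k := by
  have h : ∀ i, |(k i : ℝ)| ≤ √(eig k) := fun i => by
    refine Real.abs_le_sqrt (le_trans ?_ (sq_le_eig k i))
    rw [mul_pow]
    have hpi : (1 : ℝ) ≤ (2 * Real.pi) ^ 2 := by nlinarith [Real.pi_gt_three]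
    exact le_mul_of_one_le_left (sq_nonneg _) hpi
  have h2 : ‖k‖ ≤ √(eig k) := (pi_norm_le_iff_of_nonneg (Real.sqrt_nonneg _)).2 fun i => by
    simpa [Int.norm_eq_abs] using h i
  calc ‖k‖ ^ 2 ≤ √(eig k) ^ 2 := pow_le_pow_left₀ (norm_nonneg _) h2 2
    _ = eig k := Real.sq_sqrt (eig_nonneg k)

/-- The lattice sum of `‖k‖⁻⁴` over `ℤ²` converges since `4 > 2`; the dimension matters here. -/
theorem summable_eigH_inv_sq : Summable fun k : Freq => ((eigH k)⁻¹) ^ 2 := by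
  have h : Summable fun k : Fin 2 → ℤ => ‖k‖ ^ (-(4 : ℝ)) :=
    EisensteinSeries.summable_one_div_norm_rpow (by norm_num)
  refine Summable.of_nonneg_of_le (fun k => sq_nonneg _) (fun k => ?_)
    (h.comp_injective Subtype.val_injective)
  have hk : 0 < ‖(k : Fin 2 → ℤ)‖ := norm_pos_iff.2 k.2
  have h4 : (‖(k : Fin 2 → ℤ)‖) ^ (-(4 : ℝ)) = ((‖(k : Fin 2 → ℤ)‖ ^ 2)⁻¹) ^ 2 := by
    rw [Real.rpow_neg hk.le, inv_pow, ← pow_mul]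
    norm_cast
  simp only [Function.comp_apply]
  rw [h4, eigH]
  exact pow_le_pow_left₀ (inv_nonneg.2 (eig_nonneg _))
    (inv_anti₀ (by positivity) (norm_sq_le_eig _)) 2

/-- Cauchy–Schwarz applied to the sequences `λ⁻¹` and `λ |û|`, realised as vectors `z` and `w` of
`H`. -/
theorem exists_sum_abs_coord_le : ∃ C, 0 ≤ C ∧ ∀ u ∈ specDom basisH eigH,
    ∃ S, S ≤ C * ‖specOp basisH eigH u‖ ∧ HasSum (fun k : Freq => |⟪basisH k, u⟫_ℝ|) S := by
  obtain ⟨z, hz⟩ := exists_coord_eq basisH summable_eigH_inv_sq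
  refine ⟨‖z‖, norm_nonneg _, fun u hu => ?_⟩
  obtain ⟨w, hw⟩ := exists_coord_eq basisH (c := fun k => |eigH k * ⟪basisH k, u⟫_ℝ|) (by
    simp only [sq_abs]
    exact hu)
  have hnorm : ‖w‖ ≤ 1 * ‖specOp basisH eigH u‖ :=
    norm_le_of_abs_coord_le basisH zero_le_one fun k => by
      rw [hw, coord_specOp hu, abs_abs, one_mul]
  refine ⟨⟪z, w⟫_ℝ, ?_, ?_⟩
  · refine (real_inner_le_norm _ _).trans ?_
    rw [one_mul] at hnorm
    gcongr
  · refine (hasSum_coord_mul basisH z w).congr_fun fun k => ?_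
    have hk : 0 < eigH k := zero_lt_one.trans_le (one_le_eig k.2)
    rw [hz, hw, abs_mul, abs_of_pos hk, inv_mul_cancel_left₀ hk.ne']

/-- The Hartley series converges uniformly to a continuous `g` with the same coefficients, hence
equal to the component a.e. The factor `2` is the bound on `|hart|`. -/
theorem ae_abs_le_of_hasSum {u : H} {S : ℝ}
    (h : HasSum (fun k : Freq => |⟪basisH k, u⟫_ℝ|) S) (j : Fin 2) :
    ∀ᵐ x ∂torusMeasure, |(u : L2) x j| ≤ 2 * S := by
  have hterm : ∀ (k : Freq) (x : T2), ‖coef u k j * hart k x‖ ≤ 2 * |⟪basisH k, u⟫_ℝ| := by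
    intro k x
    rw [coef_eq, Real.norm_eq_abs, abs_mul, abs_mul]
    nlinarith [mul_le_mul (abs_polar_le k.2 j) (abs_hart_le k x) (abs_nonneg _) zero_le_one,
      abs_nonneg ⟪basisH k, u⟫_ℝ]
  let g : T2 → ℝ := fun x => ∑' k : Freq, coef u k j * hart k x
  have hg : Continuous g := continuous_tsum (fun k => continuous_const.mul (continuous_hart k))
    (h.mul_left 2).summable hterm
  have hgle : ∀ x, |g x| ≤ 2 * S := fun x =>
    tsum_of_norm_bounded (h.mul_left 2) fun k => hterm k x
  have hgL : MemLp g 2 torusMeasure :=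
    MemLp.of_bound hg.aestronglyMeasurable (2 * S) (Filter.Eventually.of_forall hgle)
  have hzero : (fun x => (u : L2) x j - g x) =ᵐ[torusMeasure] 0 := by
    refine ae_eq_zero_of_integral_hart ((memLp_component (u : L2) j).sub hgL) fun l => ?_
    have hgint : HasSum (fun k : Freq => coef u k j * ∫ x, hart l x * hart k x ∂torusMeasure)
        (∫ x, hart l x * g x ∂torusMeasure) := by
      have := hasSum_integral_of_summable_integral_norm (μ := torusMeasure)
        (F := fun (k : Freq) x => hart l x * (coef u k j * hart k x))
        (fun k => integrable_of_continuous
          ((continuous_hart l).mul (continuous_const.mul (continuous_hart k)))) (by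
        refine Summable.of_nonneg_of_le (fun k => integral_nonneg fun x => norm_nonneg _)
          (fun k => ?_) ((h.mul_left 2).mul_left 2).summable
        calc ∫ x, ‖hart l x * (coef u k j * hart k x)‖ ∂torusMeasure
            ≤ ∫ _, 2 * (2 * |⟪basisH k, u⟫_ℝ|) ∂torusMeasure := by
              refine integral_mono (integrable_of_continuous ((continuous_hart l).mul
                (continuous_const.mul (continuous_hart k))).norm) (integrable_const _) fun x => ?_
              simp only
              rw [norm_mul]
              exact mul_le_mul (abs_hart_le l x) (hterm k x) (norm_nonneg _) zero_le_two
          _ = 2 * (2 * |⟪basisH k, u⟫_ℝ|) := by simp)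
      simp only [tsum_mul_left] at this
      refine this.congr_fun fun k => ?_
      rw [← integral_const_mul]
      exact integral_congr_ae (Filter.Eventually.of_forall fun x => by simp only; ring)
    have hval : ∫ x, hart l x * g x ∂torusMeasure = coef u l j := by
      simp only [integral_hart_mul_hart] at hgint
      by_cases hl : l = 0
      · subst hl
        rw [coef_zero]
        refine hgint.unique ?_
        convert hasSum_zero with k
        rw [if_neg k.2.symm, mul_zero]
      · refine hgint.unique ?_
        convert hasSum_single (⟨l, hl⟩ : Freq) _ using 1
        · simp
        · intro k hk
          rw [if_neg (fun h => hk (Subtype.ext h.symm)), mul_zero]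
    simp only [mul_sub]
    have hi : Integrable (fun x => hart l x * g x) torusMeasure :=
      integrable_of_continuous ((continuous_hart l).mul hg)
    rw [integral_sub (integrable_mul_component _ j (continuous_hart l)) hi, hval]
    exact sub_self _
  filter_upwards [hzero] with x hx
  have : (u : L2) x j = g x := sub_eq_zero.1 hx
  rw [this]
  exact hgle x

/-- The embedding of `D(A)` into the bounded fields. -/
theorem exists_ae_abs_le : ∃ C, 0 ≤ C ∧ ∀ u ∈ specDom basisH eigH, ∀ j,
    ∀ᵐ x ∂torusMeasure, |(u : L2) x j| ≤ C * ‖specOp basisH eigH u‖ := by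
  obtain ⟨C, hC, h⟩ := exists_sum_abs_coord_le
  refine ⟨2 * C, by positivity, fun u hu j => ?_⟩
  obtain ⟨S, hS, hsum⟩ := h u hu
  filter_upwards [ae_abs_le_of_hasSum hsum j] with x hx
  linarith

end SupBound

/-! ### Bounds and linearity of the trilinear form. -/

section Trilinear

theorem integral_norm_mul_norm_le (g w : L2) :
    Integrable (fun x => ‖g x‖ * ‖w x‖) torusMeasure
      ∧ ∫ x, ‖g x‖ * ‖w x‖ ∂torusMeasure ≤ ‖g‖ * ‖w‖ := by
  have hg := (Lp.memLp g).norm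
  have hw := (Lp.memLp w).norm
  refine ⟨hg.integrable_mul hw, ?_⟩
  have h := real_inner_le_norm (hw.toLp _) (hg.toLp _)
  rw [Lp.norm_toLp, Lp.norm_toLp, eLpNorm_norm, eLpNorm_norm, ← Lp.norm_def, ← Lp.norm_def,
    L2.inner_def, mul_comm] at h
  refine le_of_eq_of_le (integral_congr_ae ?_) h
  filter_upwards [hg.coeFn_toLp, hw.coeFn_toLp] with x h1 h2
  rw [h1, h2]
  simp

theorem integrable_and_abs_integral_le {F : T2 → ℝ} {g w : L2} {c : ℝ}
    (hFm : AEStronglyMeasurable F torusMeasure) (hc : 0 ≤ c)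
    (hF : ∀ᵐ x ∂torusMeasure, |F x| ≤ c * (‖g x‖ * ‖w x‖)) :
    Integrable F torusMeasure ∧ |∫ x, F x ∂torusMeasure| ≤ c * (‖g‖ * ‖w‖) := by
  obtain ⟨hi, hle⟩ := integral_norm_mul_norm_le g w
  refine ⟨(hi.const_mul c).mono' hFm hF, ?_⟩
  calc |∫ x, F x ∂torusMeasure| ≤ ∫ x, c * (‖g x‖ * ‖w x‖) ∂torusMeasure :=
        (Real.norm_eq_abs _).symm.trans_le (norm_integral_le_of_norm_le (hi.const_mul c) hF)
    _ ≤ c * (‖g‖ * ‖w‖) := by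
        rw [integral_const_mul]
        gcongr

theorem aestronglyMeasurable_triple (u g w : L2) (i j : Fin 2) :
    AEStronglyMeasurable (fun x => u x i * g x j * w x j) torusMeasure :=
  ((memLp_component u i).1.mul (memLp_component g j).1).mul (memLp_component w j).1

theorem abs_apply_le_norm (y : R2) (j : Fin 2) : |y j| ≤ ‖y‖ := PiLp.norm_apply_le y j

/-- One bounded factor and two square-integrable ones. The variants differ in which factor is
bounded: the advecting field, the test field, or the gradient of a basis field. -/
theorem triple_left {u : L2} {c : ℝ} (hc : 0 ≤ c)
    (hu : ∀ i, ∀ᵐ x ∂torusMeasure, |u x i| ≤ c) (g w : L2) (i j : Fin 2) :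
    Integrable (fun x => u x i * g x j * w x j) torusMeasure
      ∧ |∫ x, u x i * g x j * w x j ∂torusMeasure| ≤ c * (‖g‖ * ‖w‖) := by
  refine integrable_and_abs_integral_le (aestronglyMeasurable_triple u g w i j) hc ?_
  filter_upwards [hu i] with x hx
  rw [abs_mul, abs_mul, mul_assoc]
  exact mul_le_mul hx (mul_le_mul (abs_apply_le_norm _ j) (abs_apply_le_norm _ j) (abs_nonneg _)
    (norm_nonneg _)) (by positivity) hc

theorem triple_right {w : L2} {c : ℝ} (hc : 0 ≤ c)
    (hw : ∀ i, ∀ᵐ x ∂torusMeasure, |w x i| ≤ c) (u g : L2) (i j : Fin 2) :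
    Integrable (fun x => u x i * g x j * w x j) torusMeasure
      ∧ |∫ x, u x i * g x j * w x j ∂torusMeasure| ≤ c * (‖u‖ * ‖g‖) := by
  refine integrable_and_abs_integral_le (aestronglyMeasurable_triple u g w i j) hc ?_
  filter_upwards [hw j] with x hx
  rw [abs_mul, abs_mul, mul_comm]
  exact mul_le_mul hx (mul_le_mul (abs_apply_le_norm _ i) (abs_apply_le_norm _ j) (abs_nonneg _)
    (norm_nonneg _)) (by positivity) hc

theorem triple_middle {g : L2} {c : ℝ} (hc : 0 ≤ c)
    (hg : ∀ i, ∀ᵐ x ∂torusMeasure, |g x i| ≤ c) (u w : L2) (i j : Fin 2) :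
    Integrable (fun x => u x i * g x j * w x j) torusMeasure
      ∧ |∫ x, u x i * g x j * w x j ∂torusMeasure| ≤ c * (‖u‖ * ‖w‖) := by
  refine integrable_and_abs_integral_le (aestronglyMeasurable_triple u g w i j) hc ?_
  filter_upwards [hg j] with x hx
  rw [abs_mul, abs_mul, mul_comm |u x i|, mul_assoc]
  exact mul_le_mul hx (mul_le_mul (abs_apply_le_norm _ i) (abs_apply_le_norm _ j) (abs_nonneg _)
    (norm_nonneg _)) (by positivity) hc

theorem abs_bForm_le {u v w : L2} {r : ℝ}
    (h : ∀ i j, |∫ x, u x i * wpartial i v x j * w x j ∂torusMeasure| ≤ r) :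
    |bForm u v w| ≤ 4 * r := by
  unfold bForm
  refine (Finset.abs_sum_le_sum_abs _ _).trans ?_
  calc ∑ i, |∑ j, ∫ x, u x i * wpartial i v x j * w x j ∂torusMeasure|
      ≤ ∑ i : Fin 2, ∑ j : Fin 2, r := Finset.sum_le_sum fun i _ =>
        (Finset.abs_sum_le_sum_abs _ _).trans (Finset.sum_le_sum fun j _ => h i j)
    _ = 4 * r := by simp; ring

theorem norm_wpartial_le_sqrt (i : Fin 2) (v : L2) : ‖wpartial i v‖ ≤ √(gradSq v) :=
  Real.le_sqrt_of_sq_le (norm_wpartial_sq_le_gradSq i v)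

theorem coeFn_comp_add (u v : L2) : ∀ᵐ x ∂torusMeasure, ∀ j, (u + v) x j = u x j + v x j := by
  filter_upwards [Lp.coeFn_add u v] with x hx j
  rw [hx]
  rfl

theorem coeFn_comp_smul (c : ℝ) (u : L2) : ∀ᵐ x ∂torusMeasure, ∀ j, (c • u) x j = c * u x j := by
  filter_upwards [Lp.coeFn_smul c u] with x hx j
  rw [hx]
  rfl

theorem wpartial_add {v w : H} (hv : v ∈ V) (hw : w ∈ V) (i : Fin 2) :
    wpartial i ((v + w : H) : L2) = wpartial i v + wpartial i w := by
  refine wpartial_eq ((isWeakPartial_iff i _ _).2 fun k j => ?_)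
  rw [coef_add, coef_wpartial (hv i), coef_wpartial (hw i), Submodule.coe_add, coef_add]
  ring

theorem wpartial_smul (c : ℝ) {v : H} (hv : v ∈ V) (i : Fin 2) :
    wpartial i ((c • v : H) : L2) = c • wpartial i v := by
  refine wpartial_eq ((isWeakPartial_iff i _ _).2 fun k j => ?_)
  rw [coef_smul, coef_wpartial (hv i), Submodule.coe_smul, coef_smul]
  ring

theorem exists_bound {u : H} (hu : u ∈ specDom basisH eigH) :
    ∃ c, 0 ≤ c ∧ ∀ i, ∀ᵐ x ∂torusMeasure, |(u : L2) x i| ≤ c := by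
  obtain ⟨C, hC, h⟩ := exists_ae_abs_le
  exact ⟨_, mul_nonneg hC (norm_nonneg _), h u hu⟩

theorem integrable_triple {u : H} (hu : u ∈ specDom basisH eigH) (g w : L2) (i j : Fin 2) :
    Integrable (fun x => (u : L2) x i * g x j * w x j) torusMeasure := by
  obtain ⟨c, hc, h⟩ := exists_bound hu
  exact (triple_left hc h g w i j).1

theorem bForm_add_right {u : H} (hu : u ∈ specDom basisH eigH) (v w z : L2) :
    bForm u v (w + z) = bForm u v w + bForm u v z := by
  simp only [bForm, ← Finset.sum_add_distrib]
  refine Finset.sum_congr rfl fun i _ => Finset.sum_congr rfl fun j _ => ?_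
  rw [← integral_add (integrable_triple hu _ _ i j) (integrable_triple hu _ _ i j)]
  refine integral_congr_ae ?_
  filter_upwards [coeFn_comp_add w z] with x hx
  rw [hx]
  ring

theorem bForm_smul_right (c : ℝ) (u v w : L2) : bForm u v (c • w) = c * bForm u v w := by
  simp only [bForm, Finset.mul_sum, ← integral_const_mul]
  refine Finset.sum_congr rfl fun i _ => Finset.sum_congr rfl fun j _ => integral_congr_ae ?_
  filter_upwards [coeFn_comp_smul c w] with x hx
  rw [hx]
  ring

theorem bForm_add_left {u v : H} (hu : u ∈ specDom basisH eigH) (hv : v ∈ specDom basisH eigH)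
    (w z : L2) : bForm ((u + v : H) : L2) w z = bForm u w z + bForm v w z := by
  simp only [bForm, ← Finset.sum_add_distrib]
  refine Finset.sum_congr rfl fun i _ => Finset.sum_congr rfl fun j _ => ?_
  rw [← integral_add (integrable_triple hu _ _ i j) (integrable_triple hv _ _ i j)]
  refine integral_congr_ae ?_
  filter_upwards [coeFn_comp_add (u : L2) v] with x hx
  rw [Submodule.coe_add, hx]
  ring

theorem bForm_add_middle {u v w : H} (hu : u ∈ specDom basisH eigH) (hv : v ∈ V) (hw : w ∈ V)
    (z : L2) : bForm u ((v + w : H) : L2) z = bForm u v z + bForm u w z := by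
  simp only [bForm, ← Finset.sum_add_distrib]
  refine Finset.sum_congr rfl fun i _ => Finset.sum_congr rfl fun j _ => ?_
  rw [← integral_add (integrable_triple hu _ _ i j) (integrable_triple hu _ _ i j)]
  refine integral_congr_ae ?_
  filter_upwards [coeFn_comp_add (wpartial i v) (wpartial i w)] with x hx
  rw [wpartial_add hv hw, hx]
  ring

theorem bForm_smul_middle (c : ℝ) (u : L2) {v : H} (hv : v ∈ V) (z : L2) :
    bForm u ((c • v : H) : L2) z = c * bForm u v z := by
  simp only [bForm, Finset.mul_sum, ← integral_const_mul]
  refine Finset.sum_congr rfl fun i _ => Finset.sum_congr rfl fun j _ => integral_congr_ae ?_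
  filter_upwards [coeFn_comp_smul c (wpartial i v)] with x hx
  rw [wpartial_smul c hv, hx]
  ring

theorem abs_bForm_le_left {u : L2} {c : ℝ} (hc : 0 ≤ c)
    (hu : ∀ i, ∀ᵐ x ∂torusMeasure, |u x i| ≤ c) (v w : L2) :
    |bForm u v w| ≤ 4 * c * √(gradSq v) * ‖w‖ := by
  refine (abs_bForm_le (r := c * (√(gradSq v) * ‖w‖)) fun i j => ?_).trans_eq (by ring)
  refine (triple_left hc hu _ _ i j).2.trans ?_
  gcongr
  exact norm_wpartial_le_sqrt i v

theorem abs_bForm_le_right {w : L2} {c : ℝ} (hc : 0 ≤ c)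
    (hw : ∀ i, ∀ᵐ x ∂torusMeasure, |w x i| ≤ c) (u v : L2) :
    |bForm u v w| ≤ 4 * c * ‖u‖ * √(gradSq v) := by
  refine (abs_bForm_le (r := c * (‖u‖ * √(gradSq v))) fun i j => ?_).trans_eq (by ring)
  refine (triple_right hc hw _ _ i j).2.trans ?_
  gcongr
  exact norm_wpartial_le_sqrt i v

/-- A field `u` in `D(A)` is bounded, so the form is continuous in `w` and Riesz representation
applies. The default value in `opB` therefore never occurs for such `u`. -/
theorem inner_opB {u : H} (hu : u ∈ specDom basisH eigH) (v w : H) :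
    ⟪opB u v, w⟫_ℝ = bForm u v w := by
  have hex : ∃ z : H, ∀ w : H, ⟪z, w⟫_ℝ = bForm u v w := by
    obtain ⟨c, hc, h⟩ := exists_bound hu
    let L : H →ₗ[ℝ] ℝ :=
      { toFun := fun w => bForm u v w
        map_add' := fun w z => bForm_add_right hu v w z
        map_smul' := fun c w => bForm_smul_right c u v w }
    let Lc : H →L[ℝ] ℝ := L.mkContinuous (4 * c * √(gradSq v)) fun w =>
      abs_bForm_le_left hc h v w
    exact ⟨(InnerProductSpace.toDual ℝ H).symm Lc, fun w =>
      InnerProductSpace.toDual_symm_apply⟩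
  rw [opB, dif_pos hex]
  exact hex.choose_spec w

end Trilinear

/-! ### Trigonometric polynomials and the convection term -/

section TrigPoly

variable {ι : Type*}

/-- A combination of finitely many Hartley functions. -/
def trigPoly (F : Finset ι) (κ : ι → Fin 2 → ℤ) (c : ι → ℝ) (x : T2) : ℝ :=
  ∑ k ∈ F, c k * hart (κ k) x

theorem isTest_trigPoly (F : Finset ι) (κ : ι → Fin 2 → ℤ) (c : ι → ℝ) :
    IsTest (trigPoly F κ c) :=
  IsTest.sum F fun k _ => (IsTest.const (c k)).mul (isTest_hart (κ k))

theorem pderiv_trigPoly (F : Finset ι) (κ : ι → Fin 2 → ℤ) (c : ι → ℝ) (i : Fin 2) (x : T2) :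
    pderiv i (trigPoly F κ c) x
      = trigPoly F (fun k => -κ k) (fun k => 2 * Real.pi * κ k i * c k) x := by
  refine (pderiv_sum F (fun k _ => (IsTest.const (c k)).mul (isTest_hart (κ k))) i x).trans ?_
  refine Finset.sum_congr rfl fun k _ => ?_
  rw [pderiv_const_mul (isTest_hart _), pderiv_hart]
  ring

/-- Equality of Hartley coefficients identifies a finite-mode component with a smooth function, so
that classical calculus applies to it. -/
theorem ae_eq_trigPoly {F : Finset ι} {κ : ι → Fin 2 → ℤ} {c : ι → ℝ} {u : L2} {j : Fin 2}
    (h : ∀ l, coef u l j = ∑ k ∈ F, if l = κ k then c k else 0) :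
    ∀ᵐ x ∂torusMeasure, u x j = trigPoly F κ c x := by
  have hcont := (isTest_trigPoly F κ c).continuous
  have hzero : (fun x => u x j - trigPoly F κ c x) =ᵐ[torusMeasure] 0 := by
    obtain ⟨r, hr⟩ := (isCompact_range hcont).isBounded.exists_norm_le
    refine ae_eq_zero_of_integral_hart ((memLp_component u j).sub (MemLp.of_bound
      hcont.aestronglyMeasurable r (Filter.Eventually.of_forall fun x =>
        hr _ (mem_range_self x)))) fun l => ?_
    have hi : Integrable (fun x => hart l x * trigPoly F κ c x) torusMeasure :=
      integrable_of_continuous ((continuous_hart l).mul hcont)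
    simp only [mul_sub]
    rw [integral_sub (integrable_mul_component u j (continuous_hart l)) hi, sub_eq_zero]
    refine (h l).trans ?_
    simp only [trigPoly, Finset.mul_sum]
    have hk : ∀ k, Integrable (fun x => hart l x * (c k * hart (κ k) x)) torusMeasure := fun k =>
      integrable_of_continuous
        ((continuous_hart l).mul (continuous_const.mul (continuous_hart (κ k))))
    rw [integral_finsetSum _ fun k _ => hk k]
    refine Finset.sum_congr rfl fun k _ => ?_
    simp only [mul_left_comm (hart l _)]
    rw [integral_const_mul, integral_hart_mul_hart]
    split_ifs <;> simp
  filter_upwards [hzero] with x hx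
  exact sub_eq_zero.1 hx

end TrigPoly

/-! ### Finite-mode fields: enstrophy balance, antisymmetry and bounds on basis fields. -/

section FiniteModes

variable {u : H} {F : Finset Freq}

theorem coef_of_finite (h : ∀ k ∉ F, ⟪basisH k, u⟫_ℝ = 0) (l : Fin 2 → ℤ) (j : Fin 2) :
    coef u l j = ∑ k ∈ F, if l = k then ⟪basisH k, u⟫_ℝ * polar k j else 0 := by
  by_cases hl : l = 0
  · subst hl
    rw [coef_zero, Finset.sum_eq_zero]
    intro k _
    rw [if_neg k.2.symm]
  · rw [Finset.sum_eq_single (⟨l, hl⟩ : Freq)]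
    · rw [if_pos rfl, coef_eq u ⟨l, hl⟩]
    · intro k _ hk
      rw [if_neg fun h => hk (Subtype.ext h.symm)]
    · intro hk
      rw [if_pos rfl, h _ hk, zero_mul]

theorem ae_eq_of_finite (h : ∀ k ∉ F, ⟪basisH k, u⟫_ℝ = 0) (j : Fin 2) :
    ∀ᵐ x ∂torusMeasure, (u : L2) x j
      = trigPoly F Subtype.val (fun k => ⟪basisH k, u⟫_ℝ * polar k j) x :=
  ae_eq_trigPoly fun l => coef_of_finite h l j

theorem wpartial_ae_eq_of_finite (h : ∀ k ∉ F, ⟪basisH k, u⟫_ℝ = 0) (i j : Fin 2) :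
    ∀ᵐ x ∂torusMeasure, wpartial i u x j
      = pderiv i (trigPoly F Subtype.val fun k => ⟪basisH k, u⟫_ℝ * polar k j) x := by
  simp only [pderiv_trigPoly]
  refine ae_eq_trigPoly fun l => ?_
  rw [coef_wpartial (mem_V_of_mem_specDom (mem_specDom_of_finite h) i), coef_of_finite h,
    Finset.mul_sum, ← Finset.sum_neg_distrib]
  refine Finset.sum_congr rfl fun k _ => ?_
  by_cases hk : l = -(k : Fin 2 → ℤ)
  · rw [if_pos (by rw [hk, neg_neg]), if_pos hk, hk, Pi.neg_apply]
    push_cast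
    ring
  · rw [if_neg (fun h => hk (by rw [← h, neg_neg])), if_neg hk]
    simp

theorem basisH_finite (k : Freq) : ∀ l ∉ ({k} : Finset Freq), ⟪basisH l, basisH k⟫_ℝ = 0 := by
  intro l hl
  rw [inner_basis_basis, if_neg (by simpa using hl)]

/-- The enstrophy balance of a trigonometric polynomial. -/
theorem bForm_specOp_of_finite (h : ∀ k ∉ F, ⟪basisH k, u⟫_ℝ = 0) :
    bForm u u (specOp basisH eigH u : H) = 0 := by
  have hu : u ∈ specDom basisH eigH := mem_specDom_of_finite h
  have hA : ∀ k ∉ F, ⟪basisH k, specOp basisH eigH u⟫_ℝ = 0 := fun k hk => by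
    rw [coord_specOp hu, h k hk, mul_zero]
  set c : Fin 2 → Freq → ℝ := fun j k => ⟪basisH k, u⟫_ℝ * polar k j with hc
  set U : Fin 2 → T2 → ℝ := fun j => trigPoly F Subtype.val (c j) with hU
  set W : Fin 2 → T2 → ℝ := fun j => trigPoly F Subtype.val fun k =>
    ⟪basisH k, specOp basisH eigH u⟫_ℝ * polar k j with hW
  -- The vorticity; its frequencies are reflected because it consists of first derivatives.
  set η : T2 → ℝ := trigPoly F (fun k => -k.1) fun k =>
    2 * Real.pi * k.1 0 * c 1 k - 2 * Real.pi * k.1 1 * c 0 k with hη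
  have hUt : ∀ j, IsTest (U j) := fun j => isTest_trigPoly _ _ _
  have hWt : ∀ j, IsTest (W j) := fun j => isTest_trigPoly _ _ _
  have hηt : IsTest η := isTest_trigPoly _ _ _
  have hcurl : ∀ x, η x = pderiv 0 (U 1) x - pderiv 1 (U 0) x := fun x => by
    simp only [hη, hU, pderiv_trigPoly, trigPoly, ← Finset.sum_sub_distrib, sub_mul]
  -- For divergence-free fields `-Δu` is the rotated gradient of the vorticity.
  have hη1 : ∀ x, pderiv 1 η x = W 0 x := fun x => by
    simp only [hη, hW, pderiv_trigPoly, trigPoly, neg_neg, coord_specOp hu]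
    refine Finset.sum_congr rfl fun k _ => ?_
    simp only [hc, polar, eigH, eig, Matrix.cons_val_zero, Matrix.cons_val_one, Pi.neg_apply]
    push_cast
    ring
  have hη0 : ∀ x, pderiv 0 η x = -W 1 x := fun x => by
    simp only [hη, hW, pderiv_trigPoly, trigPoly, neg_neg, coord_specOp hu,
      ← Finset.sum_neg_distrib]
    refine Finset.sum_congr rfl fun k _ => ?_
    simp only [hc, polar, eigH, eig, Matrix.cons_val_zero, Matrix.cons_val_one, Pi.neg_apply]
    push_cast
    ring
  have hqt : IsTest fun x => U 0 x * U 0 x + U 1 x * U 1 x :=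
    ((hUt 0).mul (hUt 0)).add ((hUt 1).mul (hUt 1))
  have hηηt : IsTest fun x => η x * η x := hηt.mul hηt
  have hI1 : ∫ x, ∑ j, pderiv j (fun x => U 0 x * U 0 x + U 1 x * U 1 x) x * W j x
      ∂torusMeasure = 0 := by
    rw [← (specOp basisH eigH u).2.2 _ hqt]
    refine integral_congr_ae ?_
    filter_upwards [ae_all_iff.2 (ae_eq_of_finite hA)] with x hx
    simp only [hx, hW]
  have hI2 : ∫ x, ∑ j, pderiv j (fun x => η x * η x) x * U j x ∂torusMeasure = 0 := by
    rw [← u.2.2 _ hηηt]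
    refine integral_congr_ae ?_
    filter_upwards [ae_all_iff.2 (ae_eq_of_finite h)] with x hx
    simp only [hx, hU, hc]
  have hint : ∀ {φ : T2 → ℝ} {Z : Fin 2 → T2 → ℝ}, IsTest φ → (∀ j, IsTest (Z j)) →
      Integrable (fun x => ∑ j, pderiv j φ x * Z j x) torusMeasure := fun hφ hZ =>
    integrable_finsetSum _ fun j _ =>
      integrable_of_continuous ((continuous_pderiv j hφ).mul (hZ j).continuous)
  have hterm : ∀ i j, Integrable (fun x => U i x * pderiv i (U j) x * W j x) torusMeasure :=
    fun i j => integrable_of_continuous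
      (((hUt i).continuous.mul (continuous_pderiv i (hUt j))).mul (hWt j).continuous)
  calc bForm u u (specOp basisH eigH u : H)
      = ∑ i, ∑ j, ∫ x, U i x * pderiv i (U j) x * W j x ∂torusMeasure := by
        refine Finset.sum_congr rfl fun i _ => Finset.sum_congr rfl fun j _ =>
          integral_congr_ae ?_
        filter_upwards [ae_eq_of_finite h i, wpartial_ae_eq_of_finite h i j,
          ae_eq_of_finite hA j] with x h1 h2 h3
        rw [h1, h2, h3]
    _ = ∫ x, ∑ i, ∑ j, U i x * pderiv i (U j) x * W j x ∂torusMeasure := by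
        rw [integral_finsetSum _ fun i _ => integrable_finsetSum _ fun j _ => hterm i j]
        exact Finset.sum_congr rfl fun i _ => (integral_finsetSum _ fun j _ => hterm i j).symm
    -- From `(u·∇)u = ½∇|u|² + η u^⊥` and `Au = (∂₁η, -∂₀η)`, the integrand is `½∇|u|²·Au -
    -- ½u·∇(η²)`. Both gradients are tested against divergence-free fields.
    _ = ∫ x, ((1 / 2) * (∑ j, pderiv j (fun x => U 0 x * U 0 x + U 1 x * U 1 x) x * W j x)
          - (1 / 2) * ∑ j, pderiv j (fun x => η x * η x) x * U j x) ∂torusMeasure := by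
        refine integral_congr_ae (Filter.Eventually.of_forall fun x => ?_)
        simp only [Fin.sum_univ_two, pderiv_mul hηt hηt, hη0, hη1,
          pderiv_add ((hUt 0).mul (hUt 0)) ((hUt 1).mul (hUt 1)), pderiv_mul (hUt 0) (hUt 0),
          pderiv_mul (hUt 1) (hUt 1)]
        rw [hcurl]
        ring
    _ = 0 := by
        rw [integral_sub ((hint hqt hWt).const_mul _) ((hint hηηt hUt).const_mul _),
          integral_const_mul, integral_const_mul, hI1, hI2]
        ring

/-- The sum of the two forms is the integral of `u·∇(e_k·e_l)`. The product is smooth, so the weak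
divergence condition on `u ∈ H` suffices. -/
theorem bForm_basisH_antisymm (u : H) (k l : Freq) :
    bForm u (basisH k) (basisH l) = -bForm u (basisH l) (basisH k) := by
  set P : Freq → Fin 2 → T2 → ℝ := fun k j => trigPoly {k} Subtype.val
    fun m => ⟪basisH m, basisH k⟫_ℝ * polar m j with hP
  have hPt : ∀ k j, IsTest (P k j) := fun k j => isTest_trigPoly _ _ _
  have hval : ∀ k l : Freq, bForm u (basisH k) (basisH l)
      = ∑ i, ∑ j, ∫ x, pderiv i (P k j) x * P l j x * (u : L2) x i ∂torusMeasure := fun k l => by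
    refine Finset.sum_congr rfl fun i _ => Finset.sum_congr rfl fun j _ => integral_congr_ae ?_
    filter_upwards [ae_eq_of_finite (basisH_finite l) j,
      wpartial_ae_eq_of_finite (basisH_finite k) i j] with x h1 h2
    rw [h1, h2]
    ring
  have hint : ∀ k l i j, Integrable (fun x => pderiv i (P k j) x * P l j x * (u : L2) x i)
      torusMeasure := fun k l i j => integrable_mul_component u i
    ((continuous_pderiv i (hPt k j)).mul (hPt l j).continuous)
  have hφ : IsTest fun x => ∑ j, P k j x * P l j x :=
    IsTest.sum _ fun j _ => (hPt k j).mul (hPt l j)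
  rw [eq_neg_iff_add_eq_zero, ← u.2.2 _ hφ, hval, hval, ← Finset.sum_add_distrib,
    integral_finsetSum _ fun i _ => integrable_mul_component u i (continuous_pderiv i hφ)]
  refine Finset.sum_congr rfl fun i _ => ?_
  rw [← Finset.sum_add_distrib]
  calc ∑ j, (∫ x, pderiv i (P k j) x * P l j x * (u : L2) x i ∂torusMeasure
        + ∫ x, pderiv i (P l j) x * P k j x * (u : L2) x i ∂torusMeasure)
      = ∑ j, ∫ x, (pderiv i (P k j) x * P l j x * (u : L2) x i
        + pderiv i (P l j) x * P k j x * (u : L2) x i) ∂torusMeasure :=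
        Finset.sum_congr rfl fun j _ => (integral_add (hint k l i j) (hint l k i j)).symm
    _ = ∫ x, ∑ j, (pderiv i (P k j) x * P l j x * (u : L2) x i
        + pderiv i (P l j) x * P k j x * (u : L2) x i) ∂torusMeasure :=
        (integral_finsetSum _ fun j _ => (hint k l i j).add (hint l k i j)).symm
    _ = ∫ x, pderiv i (fun x => ∑ j, P k j x * P l j x) x * (u : L2) x i ∂torusMeasure := by
        refine integral_congr_ae (Filter.Eventually.of_forall fun x => ?_)
        simp only [pderiv_sum _ fun j _ => (hPt k j).mul (hPt l j), pderiv_mul (hPt k _) (hPt l _),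
          Finset.sum_mul]
        refine Finset.sum_congr rfl fun j _ => ?_
        ring

/-- The gradient of a basis field is bounded, so no regularity of `u` or `w` is used. -/
theorem exists_abs_bForm_basisH_le (k : Freq) :
    ∃ c, ∀ u w : L2, |bForm u (basisH k) w| ≤ c * ‖u‖ * ‖w‖ := by
  have hb : ∀ i j, ∃ c, 0 ≤ c ∧ ∀ᵐ x ∂torusMeasure, |wpartial i (basisH k) x j| ≤ c := by
    intro i j
    obtain ⟨c, hc⟩ := (isCompact_range (continuous_pderiv i (isTest_trigPoly {k} Subtype.val
      fun m : Freq => ⟪basisH m, basisH k⟫_ℝ * polar m j))).isBounded.exists_norm_le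
    refine ⟨c, (norm_nonneg _).trans (hc _ (mem_range_self 0)), ?_⟩
    filter_upwards [wpartial_ae_eq_of_finite (basisH_finite k) i j] with x hx
    rw [hx]
    exact hc _ (mem_range_self x)
  choose c hc0 hc using hb
  set r := ∑ i, ∑ j, c i j with hr
  have hle : ∀ i j, c i j ≤ r := fun i j =>
    (Finset.single_le_sum (f := fun j => c i j) (fun j _ => hc0 i j) (Finset.mem_univ j)).trans
      (Finset.single_le_sum (f := fun i => ∑ j, c i j)
        (fun i _ => Finset.sum_nonneg fun j _ => hc0 i j) (Finset.mem_univ i))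
  refine ⟨4 * r, fun u w => ?_⟩
  refine (abs_bForm_le (r := r * (‖u‖ * ‖w‖)) fun i j => ?_).trans_eq (by ring)
  refine (triple_middle ((hc0 0 0).trans (hle 0 0)) (fun m => ?_) u w i j).2
  filter_upwards [hc i m] with x hx
  exact hx.trans (hle i m)

end FiniteModes

/-- Here the torus problem enters the abstract theory. In `4 * C`, the `4` counts the terms of the
trilinear form and `C` is the constant of the sup bound. -/
theorem exists_isConvection_opB : ∃ C, IsConvection basisH eigH opB C := by
  obtain ⟨C, hC, hsup⟩ := exists_ae_abs_le
  have hext : ∀ {y z : H}, (∀ w, ⟪y, w⟫_ℝ = ⟪z, w⟫_ℝ) → y = z := fun h =>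
    ext_inner_right ℝ h
  refine ⟨4 * C, ?_⟩
  exact
  { one_le := fun k => one_le_eig k.2
    tail := exists_le_eig
    nonneg := by positivity
    sub_left := by
      intro u v w hu hv _
      rw [eq_sub_iff_add_eq]
      refine hext fun z => ?_
      rw [inner_add_left, inner_opB (sub_mem hu hv), inner_opB hv, inner_opB hu,
        ← bForm_add_left (sub_mem hu hv) hv, sub_add_cancel]
    add_right := by
      intro u v w hu hv hw
      refine hext fun z => ?_
      rw [inner_add_left, inner_opB hu, inner_opB hu, inner_opB hu,
        bForm_add_middle hu (mem_V_of_mem_specDom hv) (mem_V_of_mem_specDom hw)]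
    smul_right := by
      intro u v c hu hv
      refine hext fun z => ?_
      rw [real_inner_smul_left, inner_opB hu, inner_opB hu,
        bForm_smul_middle c _ (mem_V_of_mem_specDom hv)]
    norm_le := by
      intro u v hu hv
      have h := abs_bForm_le_left (mul_nonneg hC (norm_nonneg _)) (hsup u hu) v (opB u v)
      rw [← inner_opB hu, gradSq_eq hv, abs_of_nonneg real_inner_self_nonneg,
        real_inner_self_eq_norm_mul_norm] at h
      -- The form was tested with `opB u v` itself, so one factor of its norm is divided out.
      rcases (norm_nonneg (opB u v)).eq_or_lt with h0 | h0
      · rw [← h0]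
        positivity
      · have h1 := le_of_mul_le_mul_right h h0
        linarith
    abs_inner_le := by
      intro u v w hu hv hw
      have h := abs_bForm_le_right (mul_nonneg hC (norm_nonneg _)) (hsup w hw) u v
      rw [← inner_opB hu, gradSq_eq hv] at h
      refine h.trans_eq ?_
      simp only [Submodule.coe_norm]
      ring
    inner_basis := by
      intro u k l hu
      rw [inner_opB hu, inner_opB hu, bForm_basisH_antisymm]
    inner_specOp := by
      intro u F h
      rw [inner_opB (mem_specDom_of_finite h), bForm_specOp_of_finite h]
    basis_le := by
      intro k
      obtain ⟨c, hc⟩ := exists_abs_bForm_basisH_le k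
      refine ⟨c, fun {u w} hu _ => ?_⟩
      rw [inner_opB hu]
      exact hc u w }

/-! ### Strong solutions of the constrained Navier–Stokes equations -/

section Solutions

/-- Each coefficient of the derivative is a continuous functional of the field, although
differentiation itself is unbounded. -/
theorem aestronglyMeasurable_wpartial {μ : Measure ℝ} {g : ℝ → L2}
    (hg : AEStronglyMeasurable g μ) {i : Fin 2} (h : ∀ᵐ t ∂μ, ∃ w, IsWeakPartial i (g t) w) :
    AEStronglyMeasurable (fun t => wpartial i (g t)) μ := by
  refine aestronglyMeasurable_of_coord basisL2 fun p => ?_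
  have hm : AEStronglyMeasurable
      (fun t => -(2 * Real.pi * p.1 i * ⟪basisL2 (-p.1, p.2), g t⟫_ℝ)) μ :=
    ((aestronglyMeasurable_const.inner hg).const_mul _).neg
  refine hm.congr ?_
  filter_upwards [h] with t ht
  rw [inner_basisL2, inner_basisL2, coef_wpartial ht]

theorem norm_wpartial_le {u : H} (hu : u ∈ specDom basisH eigH) (i : Fin 2) :
    ‖wpartial i u‖ ≤ ‖specOp basisH eigH u‖ := by
  refine abs_le_of_sq_le_sq' ?_ (norm_nonneg _) |>.2
  refine (norm_wpartial_sq_le_gradSq i u).trans ?_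
  rw [gradSq_eq hu]
  exact energy_le_norm_sq (fun k => one_le_eig k.2) hu

theorem coe_constrainedRHS {u : H} (hu : u ∈ specDom basisH eigH) (f : H → H) :
    ((constrainedRHS basisH eigH opB f u : H) : L2) + stokesA u + (opB u u : L2)
      = gradSq u • (u : L2) + (f u : L2) := by
  rw [stokesA_eq ((mem_DA_iff u).2 hu), gradSq_eq hu, constrainedRHS]
  push_cast
  abel

variable {f : H → H} {T : ℝ} {u : ℝ → H}

theorem coe_intervalIntegral {h : ℝ → H} {t : ℝ} (hh : IntervalIntegrable h volume 0 t) :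
    ((∫ s in (0 : ℝ)..t, h s : H) : L2) = ∫ s in (0 : ℝ)..t, (h s : L2) :=
  (H.subtypeL.intervalIntegral_comp_comm hh).symm

theorem intervalIntegrable_of_memLp_of_mem {h : ℝ → H} (hh : MemLp h 2 (timeMeasure T)) {t : ℝ}
    (ht : t ∈ Icc 0 T) : IntervalIntegrable h volume 0 t :=
  intervalIntegrable_of_memLp ht.1 (hh.mono_measure (timeMeasure_mono ht.2))

theorem IsStrongSolution.aestronglyMeasurable_coe (hu : IsStrongSolution basisH eigH opB f T u)
    (hT : 0 ≤ T) : AEStronglyMeasurable (fun t => (u t : L2)) (timeMeasure T) :=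
  H.subtypeL.continuous.comp_aestronglyMeasurable
    (aestronglyMeasurable_of_continuousOn (hu.continuousOn hT))

theorem IsStrongSolution.memLpDA (hu : IsStrongSolution basisH eigH opB f T u) (hT : 0 ≤ T) :
    MemLpDA 2 T u := by
  have hm := hu.aestronglyMeasurable_coe hT
  have hDA : ∀ᵐ t ∂timeMeasure T, u t ∈ DA := by
    filter_upwards [hu.mem_specDom] with t ht
    exact (mem_DA_iff _).2 ht
  have hm1 : ∀ i, AEStronglyMeasurable (fun t => wpartial i (u t)) (timeMeasure T) := fun i =>
    aestronglyMeasurable_wpartial hm (hDA.mono fun t ht => ht.1 i)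
  refine ⟨hDA, memLp_of_continuousOn (hu.continuousOn hT) 2, fun i => ?_, fun i j => ?_⟩
  · refine hu.memLp_specOp.mono (hm1 i) ?_
    filter_upwards [hu.mem_specDom] with t ht
    exact norm_wpartial_le ht i
  · refine hu.memLp_specOp.mono
      (aestronglyMeasurable_wpartial (hm1 i) (hDA.mono fun t ht => ht.2 i j)) ?_
    filter_upwards [hu.mem_specDom] with t ht
    exact norm_second_le ht i j

theorem IsStrongSolution.memLpV (hu : IsStrongSolution basisH eigH opB f T u) (hT : 0 ≤ T) {Y : ℝ}
    (hY : ∀ t ∈ Icc 0 T, ∀ S : Finset Freq, ∑ k ∈ S, eigH k * ⟪basisH k, u t⟫_ℝ ^ 2 ≤ Y) :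
    MemLpV ∞ T u := by
  have hV : ∀ᵐ t ∂timeMeasure T, u t ∈ V := hu.mem_specDom.mono fun t => mem_V_of_mem_specDom
  refine ⟨hV, memLp_of_continuousOn (hu.continuousOn hT) ∞, fun i => ?_⟩
  refine MemLp.of_bound (aestronglyMeasurable_wpartial (hu.aestronglyMeasurable_coe hT)
    (hV.mono fun t ht => ht i)) (√Y) ?_
  filter_upwards [hV, ae_timeMeasure_of_Icc hY] with t ht hYt
  refine (norm_wpartial_le_sqrt i _).trans (Real.sqrt_le_sqrt ?_)
  exact hasSum_le_of_sum_le (hasSum_gradSq ht) hYt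

theorem IsStrongSolution.isSolutionOn (hu : IsStrongSolution basisH eigH opB f T u)
    (hT : 0 ≤ T) : IsSolutionOn f (u 0) T u := by
  refine ⟨rfl, hu.memLpDA hT, fun t => constrainedRHS basisH eigH opB f (u t),
    ⟨hu.memLp_rhs, fun t ht => ?_⟩, ?_⟩
  · rw [← coe_intervalIntegral (intervalIntegrable_of_memLp_of_mem hu.memLp_rhs ht),
      ← Submodule.coe_add, ← hu.eq_add_integral t ht]
  · filter_upwards [hu.mem_specDom] with t ht
    exact coe_constrainedRHS ht f

/-- The equation determines `u'` almost everywhere, so it may be replaced by the right-hand side in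
the integral identity. This brings every competing solution under the abstract uniqueness theorem.
-/
theorem IsSolutionOn.isStrongSolution {u₀ : H} (hu : IsSolutionOn f u₀ T u) :
    IsStrongSolution basisH eigH opB f T u := by
  obtain ⟨-, ⟨hDA, hL, -, hL2⟩, u', ⟨hu', heq⟩, hode⟩ := hu
  have hdom : ∀ᵐ t ∂timeMeasure T, u t ∈ specDom basisH eigH :=
    hDA.mono fun t ht => (mem_DA_iff _).1 ht
  have hrhs : u' =ᵐ[timeMeasure T] fun t => constrainedRHS basisH eigH opB f (u t) := by
    filter_upwards [hdom, hode] with t h1 h2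
    have h3 := coe_constrainedRHS h1 f
    rw [← h2, add_assoc, add_assoc] at h3
    exact Subtype.ext (add_right_cancel h3).symm
  have hmeas : AEStronglyMeasurable (fun t => specOp basisH eigH (u t)) (timeMeasure T) := by
    refine aestronglyMeasurable_of_coord basisH fun k => ?_
    have hm : AEStronglyMeasurable (fun t => eigH k * ⟪basisH k, u t⟫_ℝ) (timeMeasure T) :=
      (aestronglyMeasurable_const.inner hL.1).const_mul _
    refine hm.congr ?_
    filter_upwards [hdom] with t ht
    rw [coord_specOp ht]
  refine ⟨hdom, ?_, (memLp_congr_ae hrhs).1 hu', fun t ht => ?_⟩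
  · have hA : MemLp (fun t => stokesA (u t)) 2 (timeMeasure T) :=
      (memLp_finsetSum _ fun i _ => hL2 i i).neg
    refine hA.mono hmeas ?_
    filter_upwards [hDA] with t ht
    rw [stokesA_eq ht]
    rfl
  · refine Subtype.ext ?_
    have hint : ∫ s in (0 : ℝ)..t, u' s
        = ∫ s in (0 : ℝ)..t, constrainedRHS basisH eigH opB f (u s) := by
      rw [timeMeasure_eq_restrict_Ioc] at hrhs
      refine intervalIntegral.integral_congr_ae ?_
      filter_upwards [(ae_restrict_iff' measurableSet_Ioc).1 hrhs] with s hs hst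
      rw [uIoc_of_le ht.1] at hst
      exact hs ⟨hst.1, hst.2.trans ht.2⟩
    rw [← hint, Submodule.coe_add,
      coe_intervalIntegral (intervalIntegrable_of_memLp_of_mem hu' ht)]
    exact heq t ht

end Solutions

end CNS

end

theorem mainTheorem1 (f : CNS.H → CNS.H) (K : ℝ≥0) (hf : LipschitzWith K f)
    (hfM : ∀ u ∈ CNS.M, f u ∈ CNS.tangentM u)
    (u₀ : CNS.H) (hu₀V : u₀ ∈ CNS.V) (hu₀M : u₀ ∈ CNS.M) :
    ∃ u : ℝ → CNS.H,
      (∀ T : ℝ, 0 < T →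
        CNS.IsSolutionOn f u₀ T u ∧ CNS.MemLpV ∞ T u ∧ CNS.MemLpDA 2 T u) ∧
      ∀ T : ℝ, 0 < T → ∀ v : ℝ → CNS.H, CNS.IsSolutionOn f u₀ T v → EqOn v u (Icc 0 T) := by
  obtain ⟨C, hB⟩ := CNS.exists_isConvection_opB
  obtain ⟨u, hu0, hu⟩ := hB.exists_global_isStrongSolution hf hfM hu₀M
    ((CNS.mem_V_iff u₀).1 hu₀V)
  refine ⟨u, fun T hT => ?_, fun T hT v hv => ?_⟩
  · obtain ⟨hsol, Y, hY⟩ := hu T hT.le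
    exact ⟨hu0 ▸ hsol.isSolutionOn hT.le, hsol.memLpV hT.le hY, hsol.memLpDA hT.le⟩
  · exact hv.isStrongSolution.eqOn hB hf hT.le (hu T hT.le).1 (hv.1.trans hu0.symm)
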